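/- Let $\mathbb{K}$ be an algebraically closed field and $V$ a $\mathbb{K}$-vector space of finite positive dimension. A \emph{tridiagonal pair} on $V$ is a pair $A,A^*\in\mathrm{End}(V)$ of diagonalizable maps such that: the eigenspaces of $A$ can be ordered $V_0,\dots,V_d$ with $A^*V_i\subseteq V_{i-1}+V_i+V_{i+1}$; the eigenspaces of $A^*$ can be ordered $V^*_0,\dots,V^*_\delta$ with $AV^*_i\subseteq V^*_{i-1}+V^*_i+V^*_{i+1}$ (terms with index out of range are $0$); and no subspace other than $0$ and $V$ is invariant under both $A$ and $A^*$. Such orderings are called standard. Let $\Phi=(A;\{E_i\}_{i=0}^d;A^*;\{E_i^*\}_{i=0}^d)$ be a tridiagonal system on $V$ of diameter $d\ge 1$, that is, $A,A^*$ is a tridiagonal pair and $\{E_i\}$, $\{E_i^*\}$ are the projections onto the eigenspaces of $A$, $A^*$, respectively, in standard orderings. Assume that $\Phi$ has $q$-Racah type: there are nonzero $q,a,b\in\mathbb{K}$ with $q^4\ne 1$ such that for $0\le i\le d$ the eigenvalue of $A$ on $E_iV$ is $aq^{d-2i}+a^{-1}q^{2i-d}$ and the eigenvalue of $A^*$ on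 $E_i^*V$ is $bq^{d-2i}+b^{-1}q^{2i-d}$. For $0\le i\le d$ put $$U_i=(E_0^*V+\cdots+E_i^*V)\cap(E_iV+\cdots+E_dV),\qquad U_i^{\Downarrow}=(E_0^*V+\cdots+E_i^*V)\cap(E_0V+\cdots+E_{d-i}V),$$ and for $0\le i\le d/2$ put $$K_i=(E_0^*V+\cdots+E_i^*V)\cap(E_iV+\cdots+E_{d-i}V).$$ Let $M$ be the (unital) subalgebra of $\mathrm{End}(V)$ generated by $A$. Then there are a unique invertible $K\in\mathrm{End}(V)$ that acts on each $U_i$ as $q^{d-2i}I$ and a unique invertible $B\in\mathrm{End}(V)$ that acts on each $U_i^{\Downarrow}$ as $q^{d-2i}I$. Put $R=A-aK-a^{-1}K^{-1}$ and $R^{\Downarrow}=A-a^{-1}B-aB^{-1}$. There is a unique $\psi\in\mathrm{End}(V)$ with $\psi R-R\psi=(q-q^{-1})(K-K^{-1})$ and $\psi K_i=0$ for $0\le i\le d/2$. Let $U_q(\mathfrak{sl}_2)$ be the $\mathbb{K}$-algebra with generators $e,f,k,k^{-1}$ and relations $kk^{-1}=k^{-1}k=1$, $kek^{-1}=q^2e$,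 $kfk^{-1}=q^{-2}f$, $ef-fe=(k-k^{-1})/(q-q^{-1})$, and let $\Lambda=(q-q^{-1})^2ef+q^{-1}k+qk^{-1}$ be its normalized Casimir element. For $n\in\mathbb{N}$ let $L(n,1)$ be the $U_q(\mathfrak{sl}_2)$-module with basis $v_0,\dots,v_n$ on which $ev_i=[n+1-i]_qv_{i-1}$ ($1\le i\le n$), $ev_0=0$, $fv_i=[i+1]_qv_{i+1}$ ($0\le i\le n-1$), $fv_n=0$, $kv_i=q^{n-2i}v_i$, where $[m]_q=(q^m-q^{-m})/(q-q^{-1})$. There is a $U_q(\mathfrak{sl}_2)$-module structure on $V$ (the first action) on which $e,f,k,k^{-1}$ act as $(q-q^{-1})^{-1}\psi$, $(q-q^{-1})^{-1}R$, $K$, $K^{-1}$, and for it the following hold. (i) $V$ is semisimple, and every irreducible submodule of $V$ is isomorphic to $L(d-2i,1)$ for some $0\le i\le d/2$. (ii) For $0\le i\le d/2$ and $0\ne v\in K_i$, $Mv$ is an irreducible $U_q(\mathfrak{sl}_2)$-submodule of $V$ and is isomorphic to $L(d-2i,1)$. (iii) For $0\le i\le d/2$, $MK_i$ is a $U_q(\mathfrak{sl}_2)$-submodule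 of $V$, and it is the homogeneous component of $V$ associated with $L(d-2i,1)$, that is, the span of all submodules of $V$ isomorphic to $L(d-2i,1)$. (iv) For $0\le i\le d/2$, $MK_i=\{v\in V: \Lambda v=(q^{d-2i+1}+q^{2i-d-1})v\}$ (so $MK_i$ is an eigenspace of $\Lambda$ whenever $K_i\neq 0$). Likewise there is a $U_q(\mathfrak{sl}_2)$-module structure on $V$ (the second action) on which $e,f,k,k^{-1}$ act as $(q-q^{-1})^{-1}\psi$, $(q-q^{-1})^{-1}R^{\Downarrow}$, $B$, $B^{-1}$, with the same $\psi$, and (i)-(iv) hold for it as well. -/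

import Mathlib

/-! ### Tridiagonal pairs and tridiagonal systems -/

section TridiagonalPairs

/-- `W` is an eigenspace of `A`: it is nonzero and of the form `{v | A v = θ v}`. -/
def IsEigenspaceOf {𝕂 V : Type*} [Field 𝕂] [AddCommGroup V] [Module 𝕂 V]
    (A : Module.End 𝕂 V) (W : Submodule 𝕂 V) : Prop :=
  W ≠ ⊥ ∧ ∃ θ : 𝕂, W = A.eigenspace θ

/-- `V` is spanned by the eigenspaces of `A`. -/
def IsDiagonalizableEnd {𝕂 V : Type*} [Field 𝕂] [AddCommGroup V] [Module 𝕂 V]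
    (A : Module.End 𝕂 V) : Prop :=
  ⨆ θ : 𝕂, A.eigenspace θ = ⊤

/-- `W 0, …, W d` is an ordering of the (distinct) eigenspaces of `A` such that
`B W_i ⊆ W_{i-1} + W_i + W_{i+1}`, where `W_{-1} = W_{d+1} = 0`. -/
def IsStandardOrdering {𝕂 V : Type*} [Field 𝕂] [AddCommGroup V] [Module 𝕂 V]
    (A B : Module.End 𝕂 V) {d : ℕ} (W : Fin (d + 1) → Submodule 𝕂 V) : Prop :=
  Function.Injective W ∧
  (∀ X : Submodule 𝕂 V, IsEigenspaceOf A X ↔ ∃ i, W i = X) ∧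
  ∀ i : Fin (d + 1), (W i).map B ≤
    ⨆ (j : Fin (d + 1)) (_ : (j : ℕ) ≤ (i : ℕ) + 1 ∧ (i : ℕ) ≤ (j : ℕ) + 1), W j

/-- `A, B` is a tridiagonal pair on `V`. -/
structure IsTDPair {𝕂 V : Type*} [Field 𝕂] [AddCommGroup V] [Module 𝕂 V]
    (A B : Module.End 𝕂 V) : Prop where
  diag_left : IsDiagonalizableEnd A
  diag_right : IsDiagonalizableEnd B
  ordering_left : ∃ (d : ℕ) (W : Fin (d + 1) → Submodule 𝕂 V), IsStandardOrdering A B W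
  ordering_right : ∃ (δ : ℕ) (W : Fin (δ + 1) → Submodule 𝕂 V), IsStandardOrdering B A W
  irreducible : ¬ ∃ W : Submodule 𝕂 V, W.map A ≤ W ∧ W.map B ≤ W ∧ W ≠ ⊥ ∧ W ≠ ⊤

/-- `E 0, …, E d` is a standard ordering of the primitive idempotents of `A` (with respect to
`B`): for some standard ordering `W` of the eigenspaces, `E i` is the identity on `W i` and
zero on `W j` for `j ≠ i`. -/
def IsStandardIdempotents {𝕂 V : Type*} [Field 𝕂] [AddCommGroup V] [Module 𝕂 V]
    (A B : Module.End 𝕂 V) {d : ℕ} (E : Fin (d + 1) → Module.End 𝕂 V) : Prop :=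
  ∃ W : Fin (d + 1) → Submodule 𝕂 V, IsStandardOrdering A B W ∧
    ∀ i j, ∀ v ∈ W j, E i v = if j = i then v else 0

/-- A tridiagonal system of diameter `d` on `V`. -/
structure TDSystem (𝕂 V : Type*) [Field 𝕂] [AddCommGroup V] [Module 𝕂 V] (d : ℕ) where
  A : Module.End 𝕂 V
  E : Fin (d + 1) → Module.End 𝕂 V
  Astar : Module.End 𝕂 V
  Estar : Fin (d + 1) → Module.End 𝕂 V
  isTDPair : IsTDPair A Astar
  standard : IsStandardIdempotents A Astar E
  standard_star : IsStandardIdempotents Astar A Estar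

theorem IsStandardIdempotents.reverse {𝕂 V : Type*} [Field 𝕂] [AddCommGroup V] [Module 𝕂 V]
    {A B : Module.End 𝕂 V} {d : ℕ} {E : Fin (d + 1) → Module.End 𝕂 V}
    (h : IsStandardIdempotents A B E) : IsStandardIdempotents A B (fun i => E i.rev) := by
  obtain ⟨W, ⟨hinj, heig, htri⟩, hE⟩ := h
  refine ⟨fun i => W i.rev, ⟨hinj.comp Fin.rev_injective, fun X => ?_, fun i => ?_⟩, ?_⟩
  · rw [heig X]
    constructor
    · rintro ⟨i, hi⟩
      exact ⟨i.rev, by simpa using hi⟩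
    · rintro ⟨i, hi⟩
      exact ⟨i.rev, hi⟩
  · refine (htri i.rev).trans (iSup₂_le fun j hj => ?_)
    have hj' : ((j.rev : Fin (d + 1)) : ℕ) ≤ (i : ℕ) + 1 ∧
        (i : ℕ) ≤ ((j.rev : Fin (d + 1)) : ℕ) + 1 := by
      have h1 := i.isLt
      have h2 := j.isLt
      simp only [Fin.val_rev] at hj ⊢
      omega
    have := le_iSup₂ (f := fun (k : Fin (d + 1))
      (_ : (k : ℕ) ≤ (i : ℕ) + 1 ∧ (i : ℕ) ≤ (k : ℕ) + 1) => W k.rev) j.rev hj'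
    simpa using this
  · intro i j v hv
    rw [hE i.rev j.rev v hv]
    simp [Fin.rev_inj]

namespace TDSystem

/-- The second inversion `(A; E_d, …, E_0; A*; E*_0, …, E*_d)`. -/
def secondInversion {𝕂 V : Type*} [Field 𝕂] [AddCommGroup V] [Module 𝕂 V] {d : ℕ}
    (Φ : TDSystem 𝕂 V d) : TDSystem 𝕂 V d where
  A := Φ.A
  E := fun i => Φ.E i.rev
  Astar := Φ.Astar
  Estar := Φ.Estar
  isTDPair := Φ.isTDPair
  standard := Φ.standard.reverse
  standard_star := Φ.standard_star

/-- `θ` is the eigenvalue sequence and `θs` the dual eigenvalue sequence: `θ i` is the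
eigenvalue of `A` on its eigenspace `E_i V`, and `θs i` that of `A*` on `E*_i V`. -/
def HasEigenvalues {𝕂 V : Type*} [Field 𝕂] [AddCommGroup V] [Module 𝕂 V] {d : ℕ}
    (Φ : TDSystem 𝕂 V d) (θ θs : Fin (d + 1) → 𝕂) : Prop :=
  ∀ i, LinearMap.range (Φ.E i) = Φ.A.eigenspace (θ i) ∧
    LinearMap.range (Φ.Estar i) = Φ.Astar.eigenspace (θs i)

/-- The split subspace
`U_i = (E*_0 V + ⋯ + E*_i V) ∩ (E_i V + ⋯ + E_d V)` (zero for `i > d`). -/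
def splitSpace {𝕂 V : Type*} [Field 𝕂] [AddCommGroup V] [Module 𝕂 V] {d : ℕ}
    (Φ : TDSystem 𝕂 V d) (i : ℕ) : Submodule 𝕂 V :=
  (⨆ (j : Fin (d + 1)) (_ : (j : ℕ) ≤ i), LinearMap.range (Φ.Estar j)) ⊓
    (⨆ (j : Fin (d + 1)) (_ : i ≤ (j : ℕ)), LinearMap.range (Φ.E j))

/-- The subspace
`K_i = (E*_0 V + ⋯ + E*_i V) ∩ (E_i V + ⋯ + E_{d-i} V)`. -/
def kerSpace {𝕂 V : Type*} [Field 𝕂] [AddCommGroup V] [Module 𝕂 V] {d : ℕ}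
    (Φ : TDSystem 𝕂 V d) (i : ℕ) : Submodule 𝕂 V :=
  (⨆ (j : Fin (d + 1)) (_ : (j : ℕ) ≤ i), LinearMap.range (Φ.Estar j)) ⊓
    (⨆ (j : Fin (d + 1)) (_ : i ≤ (j : ℕ) ∧ (j : ℕ) + i ≤ d), LinearMap.range (Φ.E j))

/-- For `M` the subalgebra of `End(V)` generated by `A`, the `M`-submodule of `V` generated by
a set `S`, as a subspace of `V`. -/
def genM {𝕂 V : Type*} [Field 𝕂] [AddCommGroup V] [Module 𝕂 V] {d : ℕ}
    (Φ : TDSystem 𝕂 V d) (S : Set V) : Submodule 𝕂 V :=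
  (Submodule.span (Algebra.adjoin 𝕂 ({Φ.A} : Set (Module.End 𝕂 V))) S).restrictScalars 𝕂

/-- The invertible map `K` acts on `U_i` as `q^{d-2i}` times the identity, for `0 ≤ i ≤ d`. -/
def IsSplitOperator {𝕂 V : Type*} [Field 𝕂] [AddCommGroup V] [Module 𝕂 V] {d : ℕ}
    (Φ : TDSystem 𝕂 V d) (q : 𝕂) (K : (Module.End 𝕂 V)ˣ) : Prop :=
  ∀ i : ℕ, i ≤ d → ∀ v ∈ Φ.splitSpace i,
    (K : Module.End 𝕂 V) v = q ^ ((d : ℤ) - 2 * (i : ℤ)) • v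

/-- The raising map `R = A - a K - a⁻¹ K⁻¹`. -/
def raising {𝕂 V : Type*} [Field 𝕂] [AddCommGroup V] [Module 𝕂 V] {d : ℕ}
    (Φ : TDSystem 𝕂 V d) (a : 𝕂) (K : (Module.End 𝕂 V)ˣ) : Module.End 𝕂 V :=
  Φ.A - a • (K : Module.End 𝕂 V) - a⁻¹ • ((K⁻¹ : (Module.End 𝕂 V)ˣ) : Module.End 𝕂 V)

/-- The two conditions that characterize `ψ`:
`ψ R - R ψ = (q - q⁻¹)(K - K⁻¹)`, and `ψ K_i = 0` for `0 ≤ i ≤ d/2`. -/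
def IsPsi {𝕂 V : Type*} [Field 𝕂] [AddCommGroup V] [Module 𝕂 V] {d : ℕ}
    (Φ : TDSystem 𝕂 V d) (q a : 𝕂) (K : (Module.End 𝕂 V)ˣ) (ψ : Module.End 𝕂 V) : Prop :=
  ψ * Φ.raising a K - Φ.raising a K * ψ =
      (q - q⁻¹) • ((K : Module.End 𝕂 V) - ((K⁻¹ : (Module.End 𝕂 V)ˣ) : Module.End 𝕂 V)) ∧
    ∀ i : ℕ, 2 * i ≤ d → ∀ v ∈ Φ.kerSpace i, ψ v = 0

end TDSystem

end TridiagonalPairs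

/-! ### The algebra `U_q(sl₂)` and its modules `L(n, ε)` -/

section QuantumGroup

/-- Symbols for the Chevalley generators. -/
inductive UqGen : Type
  | e | f | k | kinv

/-- The defining relations of `U_q(sl₂)`. -/
inductive UqRel {𝕂 : Type*} [Field 𝕂] (q : 𝕂) :
    FreeAlgebra 𝕂 UqGen → FreeAlgebra 𝕂 UqGen → Prop
  | k_kinv : UqRel q (FreeAlgebra.ι 𝕂 UqGen.k * FreeAlgebra.ι 𝕂 UqGen.kinv) 1
  | kinv_k : UqRel q (FreeAlgebra.ι 𝕂 UqGen.kinv * FreeAlgebra.ι 𝕂 UqGen.k) 1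
  | k_e : UqRel q
      (FreeAlgebra.ι 𝕂 UqGen.k * FreeAlgebra.ι 𝕂 UqGen.e * FreeAlgebra.ι 𝕂 UqGen.kinv)
      (q ^ 2 • FreeAlgebra.ι 𝕂 UqGen.e)
  | k_f : UqRel q
      (FreeAlgebra.ι 𝕂 UqGen.k * FreeAlgebra.ι 𝕂 UqGen.f * FreeAlgebra.ι 𝕂 UqGen.kinv)
      ((q ^ 2)⁻¹ • FreeAlgebra.ι 𝕂 UqGen.f)
  | e_f : UqRel q
      (FreeAlgebra.ι 𝕂 UqGen.e * FreeAlgebra.ι 𝕂 UqGen.f -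
        FreeAlgebra.ι 𝕂 UqGen.f * FreeAlgebra.ι 𝕂 UqGen.e)
      ((q - q⁻¹)⁻¹ • (FreeAlgebra.ι 𝕂 UqGen.k - FreeAlgebra.ι 𝕂 UqGen.kinv))

/-- The algebra `U_q(sl₂)` over `𝕂`. -/
def Uq {𝕂 : Type*} [Field 𝕂] (q : 𝕂) : Type _ := RingQuot (UqRel q)

instance {𝕂 : Type*} [Field 𝕂] (q : 𝕂) : Ring (Uq q) :=
  inferInstanceAs (Ring (RingQuot (UqRel q)))

instance {𝕂 : Type*} [Field 𝕂] (q : 𝕂) : Algebra 𝕂 (Uq q) :=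
  inferInstanceAs (Algebra 𝕂 (RingQuot (UqRel q)))

namespace Uq

/-- The Chevalley generators `e, f, k, k⁻¹` as elements of `U_q(sl₂)`. -/
def gen {𝕂 : Type*} [Field 𝕂] (q : 𝕂) (x : UqGen) : Uq q :=
  RingQuot.mkAlgHom 𝕂 (UqRel q) (FreeAlgebra.ι 𝕂 x)

/-- The normalized Casimir element `Λ = (q - q⁻¹)² e f + q⁻¹ k + q k⁻¹`. -/
def casimir {𝕂 : Type*} [Field 𝕂] (q : 𝕂) : Uq q :=
  (q - q⁻¹) ^ 2 • (gen q .e * gen q .f) + q⁻¹ • gen q .k + q • gen q .kinv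

/-- The algebra homomorphism out of `U_q(sl₂)` given by elements that satisfy the relations. -/
noncomputable def lift {𝕂 B : Type*} [Field 𝕂] [Ring B] [Algebra 𝕂 B] (q : 𝕂)
    (g : UqGen → B)
    (h : ∀ ⦃x y : FreeAlgebra 𝕂 UqGen⦄, UqRel q x y →
      FreeAlgebra.lift 𝕂 g x = FreeAlgebra.lift 𝕂 g y) : Uq q →ₐ[𝕂] B :=
  RingQuot.liftAlgHom 𝕂 ⟨FreeAlgebra.lift 𝕂 g, h⟩

theorem lift_gen {𝕂 B : Type*} [Field 𝕂] [Ring B] [Algebra 𝕂 B] (q : 𝕂) (g : UqGen → B)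
    (h : ∀ ⦃x y : FreeAlgebra 𝕂 UqGen⦄, UqRel q x y →
      FreeAlgebra.lift 𝕂 g x = FreeAlgebra.lift 𝕂 g y) (x : UqGen) :
    lift q g h (gen q x) = g x := by
  unfold lift gen
  erw [RingQuot.liftAlgHom_mkAlgHom_apply]
  simp

/-- On the module `V`, the generators `e, f, k, k⁻¹` act as
`(q - q⁻¹)⁻¹ x`, `(q - q⁻¹)⁻¹ y`, `K`, `K⁻¹`. -/
def ActsBy {𝕂 V : Type*} [Field 𝕂] [AddCommGroup V] [Module 𝕂 V] (q : 𝕂)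
    [Module (Uq q) V] (x y : Module.End 𝕂 V) (K : (Module.End 𝕂 V)ˣ) : Prop :=
  ∀ v : V,
    gen q .e • v = (q - q⁻¹)⁻¹ • x v ∧
    gen q .f • v = (q - q⁻¹)⁻¹ • y v ∧
    gen q .k • v = (K : Module.End 𝕂 V) v ∧
    gen q .kinv • v = ((K⁻¹ : (Module.End 𝕂 V)ˣ) : Module.End 𝕂 V) v

/-- `[n]_q = (q^n - q^{-n}) / (q - q⁻¹)`. -/
def qInt {𝕂 : Type*} [Field 𝕂] (q : 𝕂) (n : ℤ) : 𝕂 := (q ^ n - q ^ (-n)) / (q - q⁻¹)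

/-- The basis vectors `v_0, …, v_n` of `𝕂^{n+1}`, with `v_i = 0` for `i > n`. -/
def stdVec (𝕂 : Type*) [Field 𝕂] (n i : ℕ) : Fin (n + 1) → 𝕂 :=
  fun j => if (j : ℕ) = i then 1 else 0

/-- The action of the Chevalley generators on the basis of `L(n, ε)`:
`e v_i = ε [n+1-i] v_{i-1}` (`e v_0 = 0`), `f v_i = [i+1] v_{i+1}` (`f v_n = 0`),
`k v_i = ε q^{n-2i} v_i`, `k⁻¹ v_i = ε q^{2i-n} v_i`. -/
noncomputable def simpleGen {𝕂 : Type*} [Field 𝕂] (q : 𝕂) (n : ℕ) (ε : ℤˣ) :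
    UqGen → Module.End 𝕂 (Fin (n + 1) → 𝕂)
  | .e => (Pi.basisFun 𝕂 (Fin (n + 1))).constr 𝕂 fun i =>
      if (i : ℕ) = 0 then 0
      else (((ε : ℤ) : 𝕂) * qInt q ((n : ℤ) + 1 - (i : ℕ))) • stdVec 𝕂 n ((i : ℕ) - 1)
  | .f => (Pi.basisFun 𝕂 (Fin (n + 1))).constr 𝕂 fun i =>
      qInt q (((i : ℕ) : ℤ) + 1) • stdVec 𝕂 n ((i : ℕ) + 1)
  | .k => (Pi.basisFun 𝕂 (Fin (n + 1))).constr 𝕂 fun i =>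
      (((ε : ℤ) : 𝕂) * q ^ ((n : ℤ) - 2 * ((i : ℕ) : ℤ))) • stdVec 𝕂 n i
  | .kinv => (Pi.basisFun 𝕂 (Fin (n + 1))).constr 𝕂 fun i =>
      (((ε : ℤ) : 𝕂) * q ^ (2 * ((i : ℕ) : ℤ) - (n : ℤ))) • stdVec 𝕂 n i

theorem single_eq_stdVec (𝕂 : Type*) [Field 𝕂] (n : ℕ) (i : Fin (n + 1)) :
    (Pi.single i 1 : Fin (n + 1) → 𝕂) = stdVec 𝕂 n i := by
  funext j
  simp [stdVec, Pi.single_apply, Fin.ext_iff]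

theorem stdVec_of_lt (𝕂 : Type*) [Field 𝕂] {n i : ℕ} (h : n < i) : stdVec 𝕂 n i = 0 := by
  funext j
  have := j.isLt
  simp only [stdVec, Pi.zero_apply, ite_eq_right_iff, one_ne_zero, imp_false]
  omega

theorem constr_stdVec {𝕂 : Type*} [Field 𝕂] {n i : ℕ} (h : i ≤ n)
    (g : Fin (n + 1) → Fin (n + 1) → 𝕂) :
    (Pi.basisFun 𝕂 (Fin (n + 1))).constr 𝕂 g (stdVec 𝕂 n i) = g ⟨i, by omega⟩ := by
  have h1 := (Pi.basisFun 𝕂 (Fin (n + 1))).constr_basis 𝕂 g ⟨i, by omega⟩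
  rwa [Pi.basisFun_apply, single_eq_stdVec] at h1

theorem simpleGen_e_zero {𝕂 : Type*} [Field 𝕂] (q : 𝕂) (n : ℕ) (ε : ℤˣ) :
    simpleGen q n ε .e (stdVec 𝕂 n 0) = 0 := by
  rw [simpleGen, constr_stdVec (Nat.zero_le n)]
  simp

theorem simpleGen_e_succ {𝕂 : Type*} [Field 𝕂] (q : 𝕂) (n : ℕ) (ε : ℤˣ) {i : ℕ}
    (h : i + 1 ≤ n) : simpleGen q n ε .e (stdVec 𝕂 n (i + 1)) =
      (((ε : ℤ) : 𝕂) * qInt q ((n : ℤ) - i)) • stdVec 𝕂 n i := by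
  rw [simpleGen, constr_stdVec h]
  simp

theorem simpleGen_f {𝕂 : Type*} [Field 𝕂] (q : 𝕂) (n : ℕ) (ε : ℤˣ) {i : ℕ}
    (h : i ≤ n) : simpleGen q n ε .f (stdVec 𝕂 n i) =
      qInt q ((i : ℤ) + 1) • stdVec 𝕂 n (i + 1) := by
  rw [simpleGen, constr_stdVec h]

theorem simpleGen_k {𝕂 : Type*} [Field 𝕂] (q : 𝕂) (n : ℕ) (ε : ℤˣ) {i : ℕ}
    (h : i ≤ n) : simpleGen q n ε .k (stdVec 𝕂 n i) =
      (((ε : ℤ) : 𝕂) * q ^ ((n : ℤ) - 2 * (i : ℤ))) • stdVec 𝕂 n i := by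
  rw [simpleGen, constr_stdVec h]

theorem simpleGen_kinv {𝕂 : Type*} [Field 𝕂] (q : 𝕂) (n : ℕ) (ε : ℤˣ) {i : ℕ}
    (h : i ≤ n) : simpleGen q n ε .kinv (stdVec 𝕂 n i) =
      (((ε : ℤ) : 𝕂) * q ^ (2 * (i : ℤ) - (n : ℤ))) • stdVec 𝕂 n i := by
  rw [simpleGen, constr_stdVec h]

theorem end_ext_stdVec {𝕂 : Type*} [Field 𝕂] {n : ℕ}
    {X Y : Module.End 𝕂 (Fin (n + 1) → 𝕂)}
    (h : ∀ i, i ≤ n → X (stdVec 𝕂 n i) = Y (stdVec 𝕂 n i)) : X = Y := by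
  refine (Pi.basisFun 𝕂 (Fin (n + 1))).ext fun i => ?_
  rw [Pi.basisFun_apply, single_eq_stdVec]
  exact h i (by omega)

theorem sign_mul_self (𝕂 : Type*) [Field 𝕂] (ε : ℤˣ) :
    (((ε : ℤ) : 𝕂)) * ((ε : ℤ) : 𝕂) = 1 := by
  rcases Int.units_eq_one_or ε with rfl | rfl <;> simp

theorem sub_inv_ne_zero {𝕂 : Type*} [Field 𝕂] {q : 𝕂} (hq : q ≠ 0) (hq4 : q ^ 4 ≠ 1) :
    q - q⁻¹ ≠ 0 := by
  intro h
  have h2 : q * q = 1 := by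
    have := sub_eq_zero.mp h
    nth_rewrite 2 [this]
    exact mul_inv_cancel₀ hq
  exact hq4 (by linear_combination (q * q + 1) * h2)

theorem qInt_identity {𝕂 : Type*} [Field 𝕂] {q : 𝕂} (hq : q ≠ 0) (hq4 : q ^ 4 ≠ 1)
    (n i : ℤ) : qInt q (i + 1) * qInt q (n - i) - qInt q (n + 1 - i) * qInt q i =
      (q - q⁻¹)⁻¹ * (q ^ (n - 2 * i) - q ^ (2 * i - n)) := by
  have h := sub_inv_ne_zero hq hq4
  have e1 : q ^ (n - 2 * i) = q ^ n * (q ^ i)⁻¹ * (q ^ i)⁻¹ := by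
    rw [two_mul, zpow_sub₀ hq, zpow_add₀ hq]
    field_simp
  have e2 : q ^ (2 * i - n) = (q ^ n)⁻¹ * q ^ i * q ^ i := by
    rw [two_mul, zpow_sub₀ hq, zpow_add₀ hq]
    field_simp
  have hn : q ^ n ≠ 0 := zpow_ne_zero n hq
  have hi : q ^ i ≠ 0 := zpow_ne_zero i hq
  rw [e1, e2]
  unfold qInt
  rw [inv_mul_eq_div, div_mul_div_comm, div_mul_div_comm, ← sub_div, div_eq_div_iff
    (mul_ne_zero h h) h]
  simp only [zpow_neg, zpow_sub₀ hq, zpow_add₀ hq, zpow_one]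
  field_simp
  ring

theorem simpleGen_rel {𝕂 : Type*} [Field 𝕂] {q : 𝕂} (hq : q ≠ 0) (hq4 : q ^ 4 ≠ 1)
    (n : ℕ) (ε : ℤˣ) ⦃x y : FreeAlgebra 𝕂 UqGen⦄ (h : UqRel q x y) :
    FreeAlgebra.lift 𝕂 (simpleGen q n ε) x = FreeAlgebra.lift 𝕂 (simpleGen q n ε) y := by
  have hε := sign_mul_self 𝕂 ε
  have hkk : ∀ i : ℤ, q ^ ((n : ℤ) - 2 * i) * q ^ (2 * i - (n : ℤ)) = 1 := fun i => by
    rw [← zpow_add₀ hq]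
    simp
  cases h with
  | k_kinv =>
    simp only [map_mul, FreeAlgebra.lift_ι_apply, map_one]
    refine end_ext_stdVec fun i hi => ?_
    simp only [Module.End.mul_apply, Module.End.one_apply, simpleGen_kinv q n ε hi,
      simpleGen_k q n ε hi, map_smul, smul_smul]
    rw [show ((ε : ℤ) : 𝕂) * q ^ (2 * (i : ℤ) - n) * (((ε : ℤ) : 𝕂) * q ^ ((n : ℤ) - 2 * i)) = 1
      by linear_combination (q ^ ((n : ℤ) - 2 * (i : ℤ)) * q ^ (2 * (i : ℤ) - (n : ℤ))) * hε +
        hkk i, one_smul]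
  | kinv_k =>
    simp only [map_mul, FreeAlgebra.lift_ι_apply, map_one]
    refine end_ext_stdVec fun i hi => ?_
    simp only [Module.End.mul_apply, Module.End.one_apply, simpleGen_kinv q n ε hi,
      simpleGen_k q n ε hi, map_smul, smul_smul]
    rw [show ((ε : ℤ) : 𝕂) * q ^ ((n : ℤ) - 2 * i) * (((ε : ℤ) : 𝕂) * q ^ (2 * (i : ℤ) - n)) = 1
      by linear_combination (q ^ ((n : ℤ) - 2 * (i : ℤ)) * q ^ (2 * (i : ℤ) - (n : ℤ))) * hε +
        hkk i, one_smul]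
  | k_e =>
    simp only [map_mul, FreeAlgebra.lift_ι_apply, map_smul]
    refine end_ext_stdVec fun i hi => ?_
    simp only [Module.End.mul_apply, LinearMap.smul_apply, simpleGen_kinv q n ε hi, map_smul]
    cases i with
    | zero => simp [simpleGen_e_zero]
    | succ i =>
      have hi' : i ≤ n := by omega
      simp only [simpleGen_e_succ q n ε hi, simpleGen_k q n ε hi', map_smul, smul_smul]
      congr 1
      have : q ^ (2 * ((i + 1 : ℕ) : ℤ) - n) = q ^ 2 * q ^ (2 * (i : ℤ) - n) := by
        rw [← zpow_natCast q 2, ← zpow_add₀ hq]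
        congr 1
        push_cast
        ring
      rw [this]
      linear_combination (q ^ 2 * ((ε : ℤ) : 𝕂) * qInt q ((n : ℤ) - i) *
        q ^ ((n : ℤ) - 2 * (i : ℤ)) * q ^ (2 * (i : ℤ) - (n : ℤ))) * hε +
        (q ^ 2 * ((ε : ℤ) : 𝕂) * qInt q ((n : ℤ) - i)) * hkk i
  | k_f =>
    simp only [map_mul, FreeAlgebra.lift_ι_apply, map_smul]
    refine end_ext_stdVec fun i hi => ?_
    simp only [Module.End.mul_apply, LinearMap.smul_apply, simpleGen_kinv q n ε hi, map_smul,
      simpleGen_f q n ε hi]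
    rcases Nat.lt_or_ge n (i + 1) with h' | h'
    · simp [stdVec_of_lt 𝕂 h']
    · simp only [simpleGen_k q n ε h', smul_smul]
      congr 1
      have : q ^ ((n : ℤ) - 2 * ((i + 1 : ℕ) : ℤ)) = (q ^ 2)⁻¹ * q ^ ((n : ℤ) - 2 * (i : ℤ)) := by
        rw [← zpow_natCast q 2, ← zpow_neg, ← zpow_add₀ hq]
        congr 1
        push_cast
        ring
      rw [this]
      linear_combination ((q ^ 2)⁻¹ * qInt q ((i : ℤ) + 1) *
        q ^ ((n : ℤ) - 2 * (i : ℤ)) * q ^ (2 * (i : ℤ) - (n : ℤ))) * hε +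
        ((q ^ 2)⁻¹ * qInt q ((i : ℤ) + 1)) * hkk i
  | e_f =>
    simp only [map_mul, map_sub, FreeAlgebra.lift_ι_apply, map_smul]
    refine end_ext_stdVec fun i hi => ?_
    have key := qInt_identity hq hq4 n i
    simp only [Module.End.mul_apply, LinearMap.smul_apply, LinearMap.sub_apply,
      simpleGen_kinv q n ε hi, simpleGen_k q n ε hi, simpleGen_f q n ε hi, map_smul]
    have h1 : qInt q ((i : ℤ) + 1) • simpleGen q n ε .e (stdVec 𝕂 n (i + 1)) =
        (((ε : ℤ) : 𝕂) * (qInt q ((i : ℤ) + 1) * qInt q ((n : ℤ) - i))) • stdVec 𝕂 n i := by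
      rcases Nat.lt_or_ge n (i + 1) with h' | h'
      · have : i = n := by omega
        subst this
        simp [stdVec_of_lt 𝕂 h', qInt]
      · rw [simpleGen_e_succ q n ε h', smul_smul]
        congr 1
        ring
    have h2 : simpleGen q n ε .f (simpleGen q n ε .e (stdVec 𝕂 n i)) =
        (((ε : ℤ) : 𝕂) * (qInt q ((n : ℤ) + 1 - i) * qInt q i)) • stdVec 𝕂 n i := by
      cases i with
      | zero => simp [simpleGen_e_zero, qInt]
      | succ i =>
        have hi' : i ≤ n := by omega
        rw [simpleGen_e_succ q n ε hi, map_smul, simpleGen_f q n ε hi', smul_smul]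
        congr 1
        push_cast
        rw [show (n : ℤ) + 1 - (i + 1) = n - i by ring]
        ring
    rw [h1, h2, ← sub_smul, ← sub_smul, smul_smul]
    congr 1
    linear_combination ((ε : ℤ) : 𝕂) * key

/-- The `U_q(sl₂)`-module `L(n, ε)`, with underlying space `𝕂^{n+1}`. -/
@[nolint unusedArguments]
def L {𝕂 : Type*} [Field 𝕂] {q : 𝕂} (_hq : q ≠ 0) (_hq4 : q ^ 4 ≠ 1) (n : ℕ) (_ε : ℤˣ) :
    Type _ :=
  Fin (n + 1) → 𝕂

instance {𝕂 : Type*} [Field 𝕂] {q : 𝕂} (hq : q ≠ 0) (hq4 : q ^ 4 ≠ 1) (n : ℕ) (ε : ℤˣ) :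
    AddCommGroup (L hq hq4 n ε) :=
  inferInstanceAs (AddCommGroup (Fin (n + 1) → 𝕂))

noncomputable instance {𝕂 : Type*} [Field 𝕂] {q : 𝕂} (hq : q ≠ 0) (hq4 : q ^ 4 ≠ 1) (n : ℕ)
    (ε : ℤˣ) : Module (Uq q) (L hq hq4 n ε) :=
  Module.compHom (Fin (n + 1) → 𝕂)
    (lift q (simpleGen q n ε) (simpleGen_rel hq hq4 n ε)).toRingHom

theorem L_gen_smul {𝕂 : Type*} [Field 𝕂] {q : 𝕂} (hq : q ≠ 0) (hq4 : q ^ 4 ≠ 1) (n : ℕ)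
    (ε : ℤˣ) (x : UqGen) (v : Fin (n + 1) → 𝕂) :
    (gen q x • (show L hq hq4 n ε from v) : L hq hq4 n ε) = simpleGen q n ε x v := by
  change lift q (simpleGen q n ε) (simpleGen_rel hq hq4 n ε) (gen q x) v = _
  rw [lift_gen]

end Uq

end QuantumGroup

/-!
# The two `U_q(sl₂)`-actions of a tridiagonal system of `q`-Racah type

The sums `∑ i, (E*_0 V + ⋯ + E*_{i+r-1} V) ∩ (E_i V + ⋯ + E_d V)` for `r = 0` and `r = 1` are
invariant under `A` and `A*`. By irreducibility the first is `0` and the second is `V`; this is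
the split decomposition `V = U_0 ⊕ ⋯ ⊕ U_d`, on which `K` is defined and `R` raises the degree.
On `U_i` the power `R^k` is the product `(A - θ_i) ⋯ (A - θ_{i+k-1})`. A vector of `U_i` killed by
`R^{d-2i}` therefore lies in `E_0 V + ⋯ + E_{d-i-1} V`, and it vanishes by the same disjointness
for the second inversion. Comparing dimensions, `R^{d-2i} : U_i → U_{d-i}` is bijective: `R` has
the hard Lefschetz property (`IsLefschetz`), and `K_i` is its space of primitive vectors
(`TDSystem.HasEigenvalues.kerSpace_eq`). Hence `V` is the direct sum of the spaces `R^j K_i`, with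
`0 ≤ i ≤ d/2` and `0 ≤ j ≤ d - 2i`.

The conditions on `ψ` force `ψ R^j x = (q - q⁻¹)² [j] [d-2i+1-j] R^{j-1} x` for `x ∈ K_i`, and this
formula defines an operator that satisfies them. So `ψ`, `R`, `K` give an action of `U_q(sl₂)` in
which each nonzero `x ∈ K_i` is a highest weight vector, with `M x = span {R^j x} ≅ L(d-2i, 1)`. The
eigenvalues `θ_i` are distinct, so `q^{2j} ≠ 1` for `1 ≤ j ≤ d`. This makes these modules simple
and their Casimir eigenvalues pairwise distinct, from which the structure of `V` follows
(`TDSystem.exists_action`).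

The second action is the first one for the second inversion, once the same `ψ` is known to serve
both (`TDSystem.IsPsi.secondInversion`). As `ψ` is nilpotent, `N = 1 - a q ψ` and
`N' = 1 - a⁻¹ q ψ` are invertible, and `N'⁻¹ N K` satisfies with `A` and `ψ`
the relations expected of `B`, with `a⁻¹` in place of `a`
(`TwistData.B_A`, `TwistData.psi_comm`). It is also upper triangular for the flag of `A*`, and
these two properties characterize `B` (`TDSystem.HasEigenvalues.eq_splitOperator`).
-/

/-! ### Direct sums and eigenspaces -/

section LinearAlgebra

variable {𝕂 V : Type*} [Field 𝕂] [AddCommGroup V] [Module 𝕂 V]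

open Polynomial in
theorem Module.End.ker_aeval_prod_X_sub_C {ι : Type*} (A : Module.End 𝕂 V) (s : Finset ι)
    (θ : ι → 𝕂) (h : Set.InjOn θ s) :
    LinearMap.ker (aeval A (∏ j ∈ s, (X - C (θ j)))) = ⨆ j ∈ s, A.eigenspace (θ j) := by
  classical
  induction s using Finset.induction_on with
  | empty => simp [Module.End.one_eq_id]
  | insert j s hj ih =>
    have hcop : IsCoprime (X - C (θ j)) (∏ k ∈ s, (X - C (θ k))) := by
      refine IsCoprime.prod_right fun k hk => ?_
      refine isCoprime_X_sub_C_of_isUnit_sub (sub_ne_zero.mpr fun e => ?_).isUnit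
      have := h (by simp) (by simp [hk]) e
      exact hj (this ▸ hk)
    rw [Finset.prod_insert hj, ← sup_ker_aeval_eq_ker_aeval_mul_of_coprime A hcop,
      ih (h.mono (by simp)), Finset.iSup_insert]
    congr 1
    ext v
    simp [sub_eq_zero, Module.algebraMap_end_apply]

/-- Along a direct sum decomposition a linear map can be prescribed summand by summand. -/
theorem exists_end_of_iSupIndep {ι : Type*} {W : ι → Submodule 𝕂 V} (hW : iSupIndep W)
    (htop : ⨆ i, W i = ⊤) (f : ι → Module.End 𝕂 V) :
    ∃ T : Module.End 𝕂 V, ∀ i, ∀ v ∈ W i, T v = f i v := by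
  classical
  have hint : DirectSum.IsInternal W :=
    (DirectSum.isInternal_submodule_iff_iSupIndep_and_iSup_eq_top W).mpr ⟨hW, htop⟩
  let e := LinearEquiv.ofBijective (DirectSum.coeLinearMap W) hint
  refine ⟨(DirectSum.toModule 𝕂 ι V fun i => (f i).comp (W i).subtype) ∘ₗ e.symm.toLinearMap,
    fun i v hv => ?_⟩
  have : e.symm v = DirectSum.lof 𝕂 ι (fun i => W i) i ⟨v, hv⟩ := by
    rw [LinearEquiv.symm_apply_eq]
    exact (DirectSum.coeLinearMap_lof W i ⟨v, hv⟩).symm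
  simp [this]

theorem LinearMap.ext_of_iSup_eq_top {ι V' : Type*} [AddCommGroup V'] [Module 𝕂 V']
    {W : ι → Submodule 𝕂 V} (htop : ⨆ i, W i = ⊤) {S T : V →ₗ[𝕂] V'}
    (h : ∀ i, ∀ v ∈ W i, S v = T v) : S = T := by
  rw [← sub_eq_zero, ← LinearMap.ker_eq_top, eq_top_iff, ← htop, iSup_le_iff]
  intro i v hv
  simp [h i v hv]

theorem iSupIndep_of_disjoint_lt {U : ℕ → Submodule 𝕂 V}
    (h : ∀ n, Disjoint (U n) (⨆ j, ⨆ (_ : j < n), U j)) : iSupIndep U := by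
  rw [iSupIndep_iff_finsetSum_eq_zero_imp_eq_zero]
  intro s v
  induction s using Finset.induction_on_max with
  | empty => simp
  | insert m s hm ih =>
    intro hv hsum
    rw [Finset.sum_insert fun hms => (hm m hms).false] at hsum
    have h1 : v m = 0 := by
      refine Submodule.disjoint_def.mp (h m) _ (hv m (by simp)) ?_
      rw [eq_neg_of_add_eq_zero_left hsum]
      refine Submodule.neg_mem _ (Submodule.sum_mem _ fun j hj => ?_)
      exact Submodule.mem_iSup_of_mem j
        (Submodule.mem_iSup_of_mem (hm j hj) (hv j (by simp [hj])))
    rw [h1, zero_add] at hsum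
    simpa [h1] using ih (fun i hi => hv i (by simp [hi])) hsum

/-- Independent subspaces cannot be shrunk without losing part of their sum. -/
theorem iSupIndep.le_of_iSup_eq_top {ι : Type*} {U N : ι → Submodule 𝕂 V} (hU : iSupIndep U)
    (h : ∀ i, N i ≤ U i) (htop : ⨆ i, N i = ⊤) (i : ι) : U i ≤ N i := by
  intro v hv
  have hle : (⊤ : Submodule 𝕂 V) ≤ N i ⊔ ⨆ (j) (_ : j ≠ i), N j := by
    rw [← htop]
    refine iSup_le fun j => ?_
    by_cases hj : j = i
    · exact hj ▸ le_sup_left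
    · exact le_sup_of_le_right (le_iSup₂_of_le j hj le_rfl)
  obtain ⟨x, hx, y, hy, rfl⟩ := Submodule.mem_sup.mp (hle (Submodule.mem_top (x := v)))
  have hy' : y ∈ U i := by
    have := Submodule.sub_mem _ hv (h i hx)
    rwa [add_sub_cancel_left] at this
  rw [Submodule.disjoint_def.mp (hU i) y hy' ((iSup₂_mono fun j _ => h j) hy), add_zero]
  exact hx

/-- If `V` is the sum of subspaces on which `T` acts by pairwise distinct scalars, these subspaces
are the eigenspaces of `T`. -/
theorem Module.End.eigenspace_le_of_iSup_eq_top {ι : Type*} {T : Module.End 𝕂 V}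
    {N : ι → Submodule 𝕂 V} {c : ι → 𝕂} (hc : Function.Injective c) (htop : ⨆ i, N i = ⊤)
    (h : ∀ i, N i ≤ T.eigenspace (c i)) (i : ι) : T.eigenspace (c i) ≤ N i :=
  (T.eigenspaces_iSupIndep.comp hc).le_of_iSup_eq_top h htop i

end LinearAlgebra

/-! ### Flags of eigenspaces and the split decomposition -/

section Flags

variable {𝕂 V : Type*} [Field 𝕂] [AddCommGroup V] [Module 𝕂 V] {d : ℕ}

/-- The sum `W_0 + ⋯ + W_{i-1}`. The bound is strict, so that `lowerFlag W 0 = ⊥`. -/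
def lowerFlag (W : Fin (d + 1) → Submodule 𝕂 V) (i : ℕ) : Submodule 𝕂 V :=
  ⨆ (j : Fin (d + 1)) (_ : (j : ℕ) < i), W j

/-- The sum `W_i + ⋯ + W_d`. -/
def upperFlag (W : Fin (d + 1) → Submodule 𝕂 V) (i : ℕ) : Submodule 𝕂 V :=
  ⨆ (j : Fin (d + 1)) (_ : i ≤ (j : ℕ)), W j

theorem le_lowerFlag (W : Fin (d + 1) → Submodule 𝕂 V) {i : ℕ} (j : Fin (d + 1))
    (h : (j : ℕ) < i) : W j ≤ lowerFlag W i :=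
  le_iSup₂_of_le j h le_rfl

theorem le_upperFlag (W : Fin (d + 1) → Submodule 𝕂 V) {i : ℕ} (j : Fin (d + 1))
    (h : i ≤ (j : ℕ)) : W j ≤ upperFlag W i :=
  le_iSup₂_of_le j h le_rfl

theorem lowerFlag_mono (W : Fin (d + 1) → Submodule 𝕂 V) : Monotone (lowerFlag W) :=
  fun _ _ h => iSup₂_le fun k hk => le_lowerFlag W k (by omega)

theorem upperFlag_anti (W : Fin (d + 1) → Submodule 𝕂 V) : Antitone (upperFlag W) :=
  fun _ _ h => iSup₂_le fun k hk => le_upperFlag W k (by omega)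

theorem lowerFlag_zero (W : Fin (d + 1) → Submodule 𝕂 V) : lowerFlag W 0 = ⊥ := by
  simp [lowerFlag]

theorem upperFlag_of_lt (W : Fin (d + 1) → Submodule 𝕂 V) {i : ℕ} (h : d < i) :
    upperFlag W i = ⊥ := by
  rw [eq_bot_iff]
  exact iSup₂_le fun k hk => by omega

theorem lowerFlag_of_lt (W : Fin (d + 1) → Submodule 𝕂 V) {i : ℕ} (h : d < i) :
    lowerFlag W i = ⨆ j, W j :=
  le_antisymm (iSup₂_le fun k _ => le_iSup W k) (iSup_le fun k => le_lowerFlag W k (by omega))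

theorem upperFlag_zero (W : Fin (d + 1) → Submodule 𝕂 V) : upperFlag W 0 = ⨆ j, W j :=
  le_antisymm (iSup₂_le fun k _ => le_iSup W k)
    (iSup_le fun k => le_upperFlag W k (Nat.zero_le _))

theorem lowerFlag_succ (W : Fin (d + 1) → Submodule 𝕂 V) (i : Fin (d + 1)) :
    lowerFlag W ((i : ℕ) + 1) = lowerFlag W i ⊔ W i := by
  refine le_antisymm (iSup₂_le fun k hk => ?_)
    (sup_le (lowerFlag_mono W (by omega)) (le_lowerFlag W i (by omega)))
  rcases Nat.lt_succ_iff_lt_or_eq.mp hk with h | h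
  · exact le_sup_of_le_left (le_lowerFlag W k h)
  · exact Fin.ext h ▸ le_sup_right

theorem upperFlag_succ (W : Fin (d + 1) → Submodule 𝕂 V) (i : Fin (d + 1)) :
    upperFlag W i = upperFlag W ((i : ℕ) + 1) ⊔ W i := by
  refine le_antisymm (iSup₂_le fun k hk => ?_)
    (sup_le (upperFlag_anti W (by omega)) (le_upperFlag W i (by omega)))
  rcases hk.lt_or_eq with h | h
  · exact le_sup_of_le_left (le_upperFlag W k h)
  · exact Fin.ext h ▸ le_sup_right

theorem disjoint_lowerFlag {W : Fin (d + 1) → Submodule 𝕂 V} (hW : iSupIndep W)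
    (i : Fin (d + 1)) : Disjoint (W i) (lowerFlag W i) :=
  (hW i).mono_right (iSup₂_mono' fun k hk => ⟨k, fun h => by simp [h] at hk, le_rfl⟩)

theorem disjoint_upperFlag {W : Fin (d + 1) → Submodule 𝕂 V} (hW : iSupIndep W)
    (i : Fin (d + 1)) : Disjoint (W i) (upperFlag W ((i : ℕ) + 1)) :=
  (hW i).mono_right (iSup₂_mono' fun k hk => ⟨k, fun h => by simp [h] at hk, le_rfl⟩)

/-- The ordering of the eigenspaces of `A` given by a sequence of eigenvalues; only the terms
`θ 0, …, θ d` matter. -/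
def eigenspaceFamily (A : Module.End 𝕂 V) (θ : ℕ → 𝕂) (d : ℕ) (i : Fin (d + 1)) :
    Submodule 𝕂 V :=
  A.eigenspace (θ i)

theorem sub_smul_mem_upperFlag {A : Module.End 𝕂 V} {θ : ℕ → 𝕂} {i : ℕ} {v : V}
    (hv : v ∈ upperFlag (eigenspaceFamily A θ d) i) :
    A v - θ i • v ∈ upperFlag (eigenspaceFamily A θ d) (i + 1) := by
  suffices h : upperFlag (eigenspaceFamily A θ d) i ≤
      (upperFlag (eigenspaceFamily A θ d) (i + 1)).comap (A - θ i • 1) by simpa using h hv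
  refine iSup₂_le fun j hj v hv => ?_
  have hv' : A v = θ j • v := Module.End.mem_eigenspace_iff.mp hv
  simp only [Submodule.mem_comap, LinearMap.sub_apply, hv', LinearMap.smul_apply,
    Module.End.one_apply]
  rcases hj.lt_or_eq with h | h
  · rw [← sub_smul]
    exact Submodule.smul_mem _ _ (le_upperFlag _ j h hv)
  · simp [h]

theorem sub_smul_mem_lowerFlag {A : Module.End 𝕂 V} {θ : ℕ → 𝕂} {i : ℕ} {v : V}
    (hv : v ∈ lowerFlag (eigenspaceFamily A θ d) (i + 1)) :
    A v - θ i • v ∈ lowerFlag (eigenspaceFamily A θ d) i := by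
  suffices h : lowerFlag (eigenspaceFamily A θ d) (i + 1) ≤
      (lowerFlag (eigenspaceFamily A θ d) i).comap (A - θ i • 1) by simpa using h hv
  refine iSup₂_le fun j hj v hv => ?_
  have hv' : A v = θ j • v := Module.End.mem_eigenspace_iff.mp hv
  simp only [Submodule.mem_comap, LinearMap.sub_apply, hv', LinearMap.smul_apply,
    Module.End.one_apply]
  rcases Nat.lt_succ_iff_lt_or_eq.mp hj with h | h
  · rw [← sub_smul]
    exact Submodule.smul_mem _ _ (le_lowerFlag _ j h hv)
  · simp [h]

theorem IsStandardOrdering.apply_mem_upperFlag {A B : Module.End 𝕂 V}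
    {W : Fin (d + 1) → Submodule 𝕂 V} (h : IsStandardOrdering A B W) {i : ℕ} {v : V}
    (hv : v ∈ upperFlag W (i + 1)) : B v ∈ upperFlag W i := by
  suffices h : upperFlag W (i + 1) ≤ (upperFlag W i).comap B from h hv
  refine iSup₂_le fun j hj => Submodule.map_le_iff_le_comap.mp ((h.2.2 j).trans ?_)
  exact iSup₂_le fun k hk => le_upperFlag W k (by omega)

theorem IsStandardOrdering.apply_mem_lowerFlag {A B : Module.End 𝕂 V}
    {W : Fin (d + 1) → Submodule 𝕂 V} (h : IsStandardOrdering A B W) {i : ℕ} {v : V}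
    (hv : v ∈ lowerFlag W i) : B v ∈ lowerFlag W (i + 1) := by
  suffices h : lowerFlag W i ≤ (lowerFlag W (i + 1)).comap B from h hv
  refine iSup₂_le fun j hj => Submodule.map_le_iff_le_comap.mp ((h.2.2 j).trans ?_)
  exact iSup₂_le fun k hk => le_lowerFlag W k (by omega)

/-- The subspace `∑ i, (W*_0 + ⋯ + W*_{i+r-1}) ∩ (W_i + ⋯ + W_d)` is stable under both maps: the
first one raises the index `i` by at most one, the second lowers it by at most one. Only `r = 0`
and `r = 1` are needed, and for these no term falls off the ends. -/
theorem IsStandardOrdering.map_iSup_inf_le {A B : Module.End 𝕂 V} {θ θs : ℕ → 𝕂}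
    (hA : IsStandardOrdering A B (eigenspaceFamily A θ d))
    (hB : IsStandardOrdering B A (eigenspaceFamily B θs d)) {r : ℕ} (hr : r ≤ 1) :
    let S := ⨆ i : ℕ, lowerFlag (eigenspaceFamily B θs d) (i + r) ⊓
      upperFlag (eigenspaceFamily A θ d) i
    S.map A ≤ S ∧ S.map B ≤ S := by
  intro S
  have hS : ∀ i v, v ∈ lowerFlag (eigenspaceFamily B θs d) (i + r) →
      v ∈ upperFlag (eigenspaceFamily A θ d) i → v ∈ S :=
    fun i v h1 h2 => Submodule.mem_iSup_of_mem i ⟨h1, h2⟩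
  constructor
  · rw [Submodule.map_le_iff_le_comap]
    refine iSup_le fun i v ⟨h1, h2⟩ => ?_
    have h3 := hB.apply_mem_lowerFlag h1
    have h4 := sub_smul_mem_upperFlag h2
    have h5 : A v - θ i • v ∈ S := by
      refine hS (i + 1) _ (Submodule.sub_mem _ ?_ (Submodule.smul_mem _ _ ?_)) h4
      · rwa [add_right_comm]
      · exact lowerFlag_mono _ (by omega) h1
    simpa using Submodule.add_mem _ h5 (Submodule.smul_mem _ (θ i) (hS i v h1 h2))
  · rw [Submodule.map_le_iff_le_comap]
    refine iSup_le fun i v ⟨h1, h2⟩ => ?_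
    rcases Nat.eq_zero_or_pos (i + r) with h0 | h0
    · rw [h0, lowerFlag_zero] at h1
      have : v = 0 := by simpa using h1
      simp [this]
    obtain ⟨m, hm⟩ := Nat.exists_eq_succ_of_ne_zero h0.ne'
    have h3 : B v - θs m • v ∈ lowerFlag (eigenspaceFamily B θs d) m :=
      sub_smul_mem_lowerFlag (by rwa [hm] at h1)
    have h5 : B v - θs m • v ∈ S := by
      cases i with
      | zero =>
        have : m = 0 := by omega
        subst this
        rw [lowerFlag_zero, Submodule.mem_bot] at h3
        simp [h3]
      | succ i =>
        refine hS i _ ?_ (Submodule.sub_mem _ (hA.apply_mem_upperFlag h2)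
          (Submodule.smul_mem _ _ (upperFlag_anti _ (Nat.le_succ i) h2)))
        rwa [show i + r = m by omega]
    simpa using Submodule.add_mem _ h5 (Submodule.smul_mem _ (θs m) (hS i v h1 h2))

theorem IsStandardOrdering.iSupIndep {A B : Module.End 𝕂 V} {θ : ℕ → 𝕂}
    (hA : IsStandardOrdering A B (eigenspaceFamily A θ d)) :
    iSupIndep (eigenspaceFamily A θ d) :=
  A.eigenspaces_iSupIndep.comp (f := fun i : Fin (d + 1) => θ i) fun _ _ h =>
    hA.1 (congrArg A.eigenspace h)

theorem IsStandardOrdering.ne_bot {A B : Module.End 𝕂 V} {W : Fin (d + 1) → Submodule 𝕂 V}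
    (hA : IsStandardOrdering A B W) (i : Fin (d + 1)) : W i ≠ ⊥ :=
  ((hA.2.1 _).mpr ⟨i, rfl⟩).1

theorem IsStandardOrdering.iSup_eq_top {A B : Module.End 𝕂 V} {W : Fin (d + 1) → Submodule 𝕂 V}
    (hA : IsStandardOrdering A B W) (hd : IsDiagonalizableEnd A) : ⨆ i, W i = ⊤ := by
  rw [eq_top_iff, ← hd]
  refine iSup_le fun c => ?_
  by_cases hc : A.eigenspace c = ⊥
  · simp [hc]
  · obtain ⟨i, hi⟩ := (hA.2.1 _).mp ⟨hc, c, rfl⟩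
    exact hi ▸ le_iSup W i

/-- The sum of these intersections is invariant and contained in `W_1 + ⋯ + W_d`, so it vanishes by
irreducibility. -/
theorem IsStandardOrdering.lowerFlag_inf_upperFlag {A B : Module.End 𝕂 V} {θ θs : ℕ → 𝕂}
    (hA : IsStandardOrdering A B (eigenspaceFamily A θ d))
    (hB : IsStandardOrdering B A (eigenspaceFamily B θs d)) (h : IsTDPair A B) (i : ℕ) :
    lowerFlag (eigenspaceFamily B θs d) i ⊓ upperFlag (eigenspaceFamily A θ d) i = ⊥ := by
  obtain ⟨h1, h2⟩ := hA.map_iSup_inf_le hB (Nat.zero_le 1)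
  set S := ⨆ i : ℕ, lowerFlag (eigenspaceFamily B θs d) (i + 0) ⊓
      upperFlag (eigenspaceFamily A θ d) i with hSdef
  have hS : S ≤ upperFlag (eigenspaceFamily A θ d) 1 := by
    refine iSup_le fun i => ?_
    cases i with
    | zero => simp [lowerFlag_zero]
    | succ i => exact inf_le_right.trans (upperFlag_anti _ (by omega))
  -- `S` misses the nonzero eigenspace `W_0`.
  have hne : S ≠ ⊤ := fun htop => by
    have := disjoint_upperFlag hA.iSupIndep 0
    have h1 : upperFlag (eigenspaceFamily A θ d) 1 = ⊤ := top_le_iff.mp (by rwa [htop] at hS)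
    rw [Fin.val_zero, zero_add, h1, disjoint_top] at this
    exact hA.ne_bot 0 this
  have hbot : S = ⊥ := by
    by_contra hb
    exact h.irreducible ⟨S, h1, h2, hb, hne⟩
  rw [eq_bot_iff, ← hbot]
  exact le_iSup (fun i : ℕ => lowerFlag (eigenspaceFamily B θs d) (i + 0) ⊓
      upperFlag (eigenspaceFamily A θ d) i) i

/-- The sum of the split subspaces is invariant and contains `W*_0`, so it is everything by
irreducibility. -/
theorem IsStandardOrdering.iSup_lowerFlag_inf_upperFlag {A B : Module.End 𝕂 V} {θ θs : ℕ → 𝕂}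
    (hA : IsStandardOrdering A B (eigenspaceFamily A θ d))
    (hB : IsStandardOrdering B A (eigenspaceFamily B θs d)) (h : IsTDPair A B) :
    ⨆ i : ℕ, lowerFlag (eigenspaceFamily B θs d) (i + 1) ⊓
      upperFlag (eigenspaceFamily A θ d) i = ⊤ := by
  obtain ⟨h1, h2⟩ := hA.map_iSup_inf_le hB le_rfl
  by_contra htop
  refine h.irreducible ⟨_, h1, h2, fun hbot => hB.ne_bot 0 ?_, htop⟩
  rw [eq_bot_iff, ← hbot]
  refine le_iSup_of_le 0 (le_inf (le_lowerFlag _ 0 (by simp)) ?_)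
  rw [upperFlag_zero, hA.iSup_eq_top h.diag_left]
  exact le_top

end Flags

/-! ### The split decomposition of a tridiagonal system -/

namespace TDSystem

variable {𝕂 V : Type*} [Field 𝕂] [AddCommGroup V] [Module 𝕂 V] {d : ℕ}

/-- `E*_0 V + ⋯ + E*_{i-1} V`, with a strict bound. -/
def lowerStar (Φ : TDSystem 𝕂 V d) (i : ℕ) : Submodule 𝕂 V :=
  lowerFlag (fun j => LinearMap.range (Φ.Estar j)) i

/-- `E_i V + ⋯ + E_d V`. -/
def upper (Φ : TDSystem 𝕂 V d) (i : ℕ) : Submodule 𝕂 V :=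
  upperFlag (fun j => LinearMap.range (Φ.E j)) i

theorem splitSpace_eq (Φ : TDSystem 𝕂 V d) (i : ℕ) :
    Φ.splitSpace i = Φ.lowerStar (i + 1) ⊓ Φ.upper i := by
  simp only [splitSpace, lowerStar, upper, lowerFlag, upperFlag, Nat.lt_succ_iff]

theorem _root_.IsStandardIdempotents.isStandardOrdering_range {A B : Module.End 𝕂 V}
    {E : Fin (d + 1) → Module.End 𝕂 V} (h : IsStandardIdempotents A B E)
    (hd : IsDiagonalizableEnd A) :
    IsStandardOrdering A B (fun i => LinearMap.range (E i)) := by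
  obtain ⟨W, hW, hE⟩ := h
  convert hW with i
  apply le_antisymm
  · rw [LinearMap.range_eq_map, ← hW.iSup_eq_top hd, Submodule.map_iSup, iSup_le_iff]
    rintro j _ ⟨v, hv, rfl⟩
    rw [hE i j v hv]
    split_ifs with hji
    · exact hji ▸ hv
    · exact Submodule.zero_mem _
  · intro v hv
    exact ⟨v, by simp [hE i i v hv]⟩

theorem HasEigenvalues.standard {Φ : TDSystem 𝕂 V d} {θ θs : ℕ → 𝕂}
    (h : Φ.HasEigenvalues (fun i => θ i) (fun i => θs i)) :
    IsStandardOrdering Φ.A Φ.Astar (eigenspaceFamily Φ.A θ d) := by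
  have := Φ.standard.isStandardOrdering_range Φ.isTDPair.diag_left
  simp only [(h _).1] at this
  exact this

theorem HasEigenvalues.standard_star {Φ : TDSystem 𝕂 V d} {θ θs : ℕ → 𝕂}
    (h : Φ.HasEigenvalues (fun i => θ i) (fun i => θs i)) :
    IsStandardOrdering Φ.Astar Φ.A (eigenspaceFamily Φ.Astar θs d) := by
  have := Φ.standard_star.isStandardOrdering_range Φ.isTDPair.diag_right
  simp only [(h _).2] at this
  exact this

theorem HasEigenvalues.injOn {Φ : TDSystem 𝕂 V d} {θ θs : ℕ → 𝕂}
    (h : Φ.HasEigenvalues (fun i => θ i) (fun i => θs i)) : Set.InjOn θ (Set.Iic d) := by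
  intro i hi j hj hij
  simp only [Set.mem_Iic] at hi hj
  have := h.standard.1 (a₁ := ⟨i, by omega⟩) (a₂ := ⟨j, by omega⟩)
    (congrArg Φ.A.eigenspace hij)
  simpa using this

theorem HasEigenvalues.upper_eq {Φ : TDSystem 𝕂 V d} {θ θs : ℕ → 𝕂}
    (h : Φ.HasEigenvalues (fun i => θ i) (fun i => θs i)) (i : ℕ) :
    Φ.upper i = upperFlag (eigenspaceFamily Φ.A θ d) i := by
  simp only [upper, (h _).1]
  rfl

theorem HasEigenvalues.lowerStar_eq {Φ : TDSystem 𝕂 V d} {θ θs : ℕ → 𝕂}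
    (h : Φ.HasEigenvalues (fun i => θ i) (fun i => θs i)) (i : ℕ) :
    Φ.lowerStar i = lowerFlag (eigenspaceFamily Φ.Astar θs d) i := by
  simp only [lowerStar, (h _).2]
  rfl

/-- The second inversion reverses the eigenvalue sequence of `A`. -/
theorem HasEigenvalues.secondInversion {Φ : TDSystem 𝕂 V d} {θ θs θ' : ℕ → 𝕂}
    (h : Φ.HasEigenvalues (fun i => θ i) (fun i => θs i)) (hθ' : ∀ i ≤ d, θ' i = θ (d - i)) :
    Φ.secondInversion.HasEigenvalues (fun i => θ' i) (fun i => θs i) := by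
  intro i
  have h1 : LinearMap.range (Φ.E i.rev) = Φ.A.eigenspace (θ (i.rev : ℕ)) := (h i.rev).1
  rw [Fin.val_rev, Nat.add_sub_add_right, ← hθ' _ (by omega)] at h1
  exact ⟨h1, (h i).2⟩

variable {Φ : TDSystem 𝕂 V d} {θ θs : ℕ → 𝕂}

theorem HasEigenvalues.lowerStar_inf_upper
    (h : Φ.HasEigenvalues (fun i => θ i) (fun i => θs i)) (i : ℕ) :
    Φ.lowerStar i ⊓ Φ.upper i = ⊥ := by
  rw [h.upper_eq, h.lowerStar_eq]
  exact h.standard.lowerFlag_inf_upperFlag h.standard_star Φ.isTDPair i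

theorem HasEigenvalues.iSup_splitSpace
    (h : Φ.HasEigenvalues (fun i => θ i) (fun i => θs i)) : ⨆ i, Φ.splitSpace i = ⊤ := by
  simp only [splitSpace_eq, h.upper_eq, h.lowerStar_eq]
  exact h.standard.iSup_lowerFlag_inf_upperFlag h.standard_star Φ.isTDPair

theorem lowerStar_mono (Φ : TDSystem 𝕂 V d) : Monotone Φ.lowerStar := lowerFlag_mono _

theorem upper_anti (Φ : TDSystem 𝕂 V d) : Antitone Φ.upper := upperFlag_anti _

theorem lowerStar_zero (Φ : TDSystem 𝕂 V d) : Φ.lowerStar 0 = ⊥ := lowerFlag_zero _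

theorem HasEigenvalues.lowerStar_top
    (h : Φ.HasEigenvalues (fun i => θ i) (fun i => θs i)) : Φ.lowerStar (d + 1) = ⊤ := by
  rw [h.lowerStar_eq, lowerFlag_of_lt _ (Nat.lt_succ_self d),
    h.standard_star.iSup_eq_top Φ.isTDPair.diag_right]

theorem splitSpace_of_lt (Φ : TDSystem 𝕂 V d) {i : ℕ} (hi : d < i) : Φ.splitSpace i = ⊥ := by
  rw [splitSpace_eq, upper, upperFlag_of_lt _ hi, inf_bot_eq]

theorem splitSpace_le_lowerStar (Φ : TDSystem 𝕂 V d) {i j : ℕ} (hij : i < j) :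
    Φ.splitSpace i ≤ Φ.lowerStar j := by
  rw [splitSpace_eq]
  exact inf_le_left.trans (Φ.lowerStar_mono hij)

theorem splitSpace_le_upper (Φ : TDSystem 𝕂 V d) {i j : ℕ} (hij : j ≤ i) :
    Φ.splitSpace i ≤ Φ.upper j := by
  rw [splitSpace_eq]
  exact inf_le_right.trans (Φ.upper_anti hij)

theorem HasEigenvalues.iSupIndep_splitSpace
    (h : Φ.HasEigenvalues (fun i => θ i) (fun i => θs i)) : iSupIndep Φ.splitSpace := by
  refine iSupIndep_of_disjoint_lt fun n => ?_
  refine Disjoint.mono (Φ.splitSpace_le_upper le_rfl)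
    (iSup₂_le fun j hj => Φ.splitSpace_le_lowerStar hj) (disjoint_iff.mpr ?_)
  rw [inf_comm, h.lowerStar_inf_upper]

theorem HasEigenvalues.apply_mem_lowerStar
    (h : Φ.HasEigenvalues (fun i => θ i) (fun i => θs i)) {i : ℕ} {v : V}
    (hv : v ∈ Φ.lowerStar i) : Φ.A v ∈ Φ.lowerStar (i + 1) := by
  rw [h.lowerStar_eq] at *
  exact h.standard_star.apply_mem_lowerFlag hv

/-- `(A - θ_i) U_i ⊆ U_{i+1}`. -/
theorem HasEigenvalues.sub_smul_mem_splitSpace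
    (h : Φ.HasEigenvalues (fun i => θ i) (fun i => θs i)) {i : ℕ} {v : V}
    (hv : v ∈ Φ.splitSpace i) : Φ.A v - θ i • v ∈ Φ.splitSpace (i + 1) := by
  rw [splitSpace_eq] at *
  refine ⟨Submodule.sub_mem _ (h.apply_mem_lowerStar hv.1)
    (Submodule.smul_mem _ _ (Φ.lowerStar_mono (Nat.le_succ _) hv.1)), ?_⟩
  rw [h.upper_eq]
  have := hv.2
  rw [h.upper_eq] at this
  exact sub_smul_mem_upperFlag this

theorem HasEigenvalues.lowerStar_eq_iSup
    (h : Φ.HasEigenvalues (fun i => θ i) (fun i => θs i)) (i : ℕ) :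
    Φ.lowerStar i = ⨆ j, ⨆ (_ : j < i), Φ.splitSpace j := by
  refine le_antisymm (fun v hv => ?_) (iSup₂_le fun j hj => Φ.splitSpace_le_lowerStar hj)
  have htop : (⊤ : Submodule 𝕂 V) ≤
      (⨆ j, ⨆ (_ : j < i), Φ.splitSpace j) ⊔ Φ.upper i := by
    rw [← h.iSup_splitSpace]
    refine iSup_le fun j => ?_
    rcases lt_or_ge j i with hj | hj
    · exact le_sup_of_le_left (le_iSup₂_of_le j hj le_rfl)
    · exact le_sup_of_le_right (Φ.splitSpace_le_upper hj)
  obtain ⟨x, hx, y, hy, rfl⟩ := Submodule.mem_sup.mp (htop (Submodule.mem_top (x := v)))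
  have hx' : x ∈ Φ.lowerStar i :=
    (iSup₂_le fun j hj => Φ.splitSpace_le_lowerStar hj :
      (⨆ j, ⨆ (_ : j < i), Φ.splitSpace j) ≤ _) hx
  have hy' : y ∈ Φ.lowerStar i ⊓ Φ.upper i :=
    ⟨by simpa using Submodule.sub_mem _ hv hx', hy⟩
  rw [h.lowerStar_inf_upper, Submodule.mem_bot] at hy'
  simpa [hy'] using hx

theorem HasEigenvalues.upper_eq_sup
    (h : Φ.HasEigenvalues (fun i => θ i) (fun i => θs i)) (i : ℕ) :
    Φ.upper i = Φ.upper (i + 1) ⊔ Φ.splitSpace i := by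
  refine le_antisymm (fun v hv => ?_)
    (sup_le (Φ.upper_anti (Nat.le_succ i)) (Φ.splitSpace_le_upper le_rfl))
  have htop : (⊤ : Submodule 𝕂 V) ≤ Φ.lowerStar (i + 1) ⊔ Φ.upper (i + 1) := by
    rw [← h.iSup_splitSpace]
    refine iSup_le fun j => ?_
    rcases lt_or_ge j (i + 1) with hj | hj
    · exact le_sup_of_le_left (Φ.splitSpace_le_lowerStar hj)
    · exact le_sup_of_le_right (Φ.splitSpace_le_upper hj)
  obtain ⟨x, hx, y, hy, rfl⟩ := Submodule.mem_sup.mp (htop (Submodule.mem_top (x := v)))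
  refine Submodule.add_mem _ (Submodule.mem_sup_right ?_) (Submodule.mem_sup_left hy)
  rw [splitSpace_eq]
  exact ⟨hx, by simpa using Submodule.sub_mem _ hv (Φ.upper_anti (Nat.le_succ i) hy)⟩

theorem _root_.Submodule.finrank_eq_of_sup_eq_sup [FiniteDimensional 𝕂 V]
    {X Y Z : Submodule 𝕂 V} (hXY : Disjoint X Y) (hXZ : Disjoint X Z)
    (h : X ⊔ Y = X ⊔ Z) : Module.finrank 𝕂 Y = Module.finrank 𝕂 Z := by
  have h1 := Submodule.finrank_sup_add_finrank_inf_eq X Y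
  have h2 := Submodule.finrank_sup_add_finrank_inf_eq X Z
  rw [hXY.eq_bot, finrank_bot] at h1
  rw [hXZ.eq_bot, finrank_bot, ← h] at h2
  omega

theorem HasEigenvalues.finrank_splitSpace [FiniteDimensional 𝕂 V]
    (h : Φ.HasEigenvalues (fun i => θ i) (fun i => θs i)) (i : Fin (d + 1)) :
    Module.finrank 𝕂 (Φ.splitSpace i) = Module.finrank 𝕂 (LinearMap.range (Φ.E i)) := by
  have hind := h.standard.iSupIndep
  refine Submodule.finrank_eq_of_sup_eq_sup (X := Φ.upper ((i : ℕ) + 1)) ?_ ?_ ?_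
  · refine (Disjoint.mono_left (Φ.splitSpace_le_lowerStar (Nat.lt_succ_self _))
      (disjoint_iff.mpr (h.lowerStar_inf_upper _))).symm
  · rw [h.upper_eq, (h i).1]
    exact (disjoint_upperFlag hind i).symm
  · rw [← h.upper_eq_sup]
    exact upperFlag_succ _ i

theorem HasEigenvalues.finrank_splitSpace_star [FiniteDimensional 𝕂 V]
    (h : Φ.HasEigenvalues (fun i => θ i) (fun i => θs i)) (i : Fin (d + 1)) :
    Module.finrank 𝕂 (Φ.splitSpace i) = Module.finrank 𝕂 (LinearMap.range (Φ.Estar i)) := by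
  have hind := h.standard_star.iSupIndep
  refine Submodule.finrank_eq_of_sup_eq_sup (X := Φ.lowerStar i) ?_ ?_ ?_
  · exact Disjoint.mono_right (Φ.splitSpace_le_upper le_rfl)
      (disjoint_iff.mpr (h.lowerStar_inf_upper _))
  · rw [h.lowerStar_eq, (h i).2]
    exact (disjoint_lowerFlag hind i).symm
  · have h1 : Φ.lowerStar ((i : ℕ) + 1) = Φ.lowerStar i ⊔ LinearMap.range (Φ.Estar i) :=
      lowerFlag_succ _ i
    rw [← h1, h.lowerStar_eq_iSup ((i : ℕ) + 1), h.lowerStar_eq_iSup i]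
    exact (Nat.iSup_lt_succ Φ.splitSpace (i : ℕ)).symm

/-- `dim U_i = dim U_{d-i}`: both `U_i` and the corresponding subspace of the second inversion
have the dimension of `E*_i V`, and the latter has the dimension of `E_{d-i} V`. -/
theorem HasEigenvalues.finrank_splitSpace_sub [FiniteDimensional 𝕂 V]
    (h : Φ.HasEigenvalues (fun i => θ i) (fun i => θs i)) {i : ℕ} (hi : i ≤ d) :
    Module.finrank 𝕂 (Φ.splitSpace i) = Module.finrank 𝕂 (Φ.splitSpace (d - i)) := by
  have h1 := h.finrank_splitSpace_star ⟨i, by omega⟩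
  have h' := h.secondInversion (θ' := fun n => θ (d - n)) fun _ _ => rfl
  have h2 := HasEigenvalues.finrank_splitSpace_star (θ := fun n => θ (d - n)) h' ⟨i, by omega⟩
  have h3 := HasEigenvalues.finrank_splitSpace (θ := fun n => θ (d - n)) h' ⟨i, by omega⟩
  have h4 := h.finrank_splitSpace (Fin.rev ⟨i, by omega⟩)
  rw [Fin.val_rev, Nat.add_sub_add_right] at h4
  exact h1.trans (h2.symm.trans (h3.trans h4.symm))

open Polynomial in
/-- The sum of the eigenspaces with index in `s` is the kernel of `∏ (A - θ_j)` over `s`. -/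
theorem HasEigenvalues.iSup_range_E
    (h : Φ.HasEigenvalues (fun i => θ i) (fun i => θs i)) {s : Finset ℕ}
    (hs : ∀ j ∈ s, j ≤ d) :
    ⨆ (j : Fin (d + 1)) (_ : (j : ℕ) ∈ s), LinearMap.range (Φ.E j) =
      LinearMap.ker (aeval Φ.A (∏ j ∈ s, (X - C (θ j)))) := by
  rw [Module.End.ker_aeval_prod_X_sub_C Φ.A s θ (h.injOn.mono fun j hj => hs j hj)]
  simp only [(h _).1]
  refine le_antisymm (iSup₂_le fun j hj => le_iSup₂_of_le (j : ℕ) hj le_rfl)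
    (iSup₂_le fun j hj => ?_)
  exact le_iSup₂_of_le (f := fun (j : Fin (d + 1)) (_ : (j : ℕ) ∈ s) => Φ.A.eigenspace (θ j))
    ⟨j, Nat.lt_succ_of_le (hs j hj)⟩ hj le_rfl

open Polynomial in
/-- On `U_i` a power of the raising map is a product of factors `A - θ_j`. -/
theorem aeval_prod_Ico_eq_pow {A R : Module.End 𝕂 V} {U : ℕ → Submodule 𝕂 V} {θ : ℕ → 𝕂}
    (hR : ∀ i, ∀ v ∈ U i, R v = A v - θ i • v) (hU : ∀ i, ∀ v ∈ U i, R v ∈ U (i + 1))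
    {i : ℕ} {v : V} (hv : v ∈ U i) (k : ℕ) :
    (R ^ k) v ∈ U (i + k) ∧
      aeval A (∏ j ∈ Finset.Ico i (i + k), (X - C (θ j))) v = (R ^ k) v := by
  induction k with
  | zero => simpa using hv
  | succ k ih =>
    have h1 : (R ^ (k + 1)) v = R ((R ^ k) v) := by rw [pow_succ', Module.End.mul_apply]
    refine ⟨h1 ▸ hU _ _ ih.1, ?_⟩
    rw [← add_assoc, Finset.prod_Ico_succ_top (Nat.le_add_right i k), mul_comm, map_mul,
      Module.End.mul_apply, ih.2, h1, hR _ _ ih.1]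
    simp [Module.algebraMap_end_apply]

end TDSystem

/-! ### Strings of a raising map -/

section Lefschetz

variable {𝕂 V : Type*} [Field 𝕂] [AddCommGroup V] [Module 𝕂 V]

/-- `V = U_0 ⊕ ⋯ ⊕ U_d` is graded and the degree one map `R` has the hard Lefschetz property:
`R^{d-2i} : U_i → U_{d-i}` is bijective for `i ≤ d/2`. -/
structure IsLefschetz (d : ℕ) (U : ℕ → Submodule 𝕂 V) (R : Module.End 𝕂 V) : Prop where
  indep : iSupIndep U
  iSup_eq_top : ⨆ i, U i = ⊤
  eq_bot : ∀ i, d < i → U i = ⊥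
  apply_mem : ∀ i, ∀ v ∈ U i, R v ∈ U (i + 1)
  inj : ∀ i, 2 * i ≤ d → ∀ v ∈ U i, (R ^ (d - 2 * i)) v = 0 → v = 0
  surj : ∀ i, 2 * i ≤ d → ∀ w ∈ U (d - i), ∃ v ∈ U i, (R ^ (d - 2 * i)) v = w

/-- The primitive vectors of degree `i`: those killed by `R^{d-2i+1}`. -/
def primitivePart (d : ℕ) (U : ℕ → Submodule 𝕂 V) (R : Module.End 𝕂 V) (i : ℕ) :
    Submodule 𝕂 V :=
  U i ⊓ LinearMap.ker (R ^ (d - 2 * i + 1))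

/-- The pairs `(i, j)` such that `R^j` is injective on the primitive vectors of degree `i`. -/
def StringIndex (d : ℕ) : Type := {p : ℕ × ℕ // 2 * p.1 ≤ d ∧ p.2 ≤ d - 2 * p.1}

/-- The `j`-th level `R^j P_i` of the strings that start at the primitive vectors of degree `i`. -/
def stringSpace (d : ℕ) (U : ℕ → Submodule 𝕂 V) (R : Module.End 𝕂 V) (p : StringIndex d) :
    Submodule 𝕂 V :=
  (primitivePart d U R p.1.1).map (R ^ p.1.2)

namespace IsLefschetz

variable {d : ℕ} {U : ℕ → Submodule 𝕂 V} {R : Module.End 𝕂 V}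

theorem pow_mem (h : IsLefschetz d U R) {i : ℕ} {v : V} (hv : v ∈ U i) (k : ℕ) :
    (R ^ k) v ∈ U (i + k) := by
  induction k with
  | zero => simpa using hv
  | succ k ih =>
    rw [pow_succ', Module.End.mul_apply]
    exact h.apply_mem _ _ ih

theorem pow_primitive_eq_zero {i k : ℕ} {v : V} (hv : v ∈ primitivePart d U R i)
    (hk : d - 2 * i < k) : (R ^ k) v = 0 := by
  obtain ⟨m, rfl⟩ := Nat.exists_eq_add_of_lt hk
  rw [show d - 2 * i + m + 1 = m + (d - 2 * i + 1) by omega, pow_add, Module.End.mul_apply,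
    LinearMap.mem_ker.mp hv.2, map_zero]

theorem pow_primitive_injective (h : IsLefschetz d U R) {i k : ℕ} (hi : 2 * i ≤ d)
    (hk : k ≤ d - 2 * i) {v : V} (hv : v ∈ primitivePart d U R i) (h0 : (R ^ k) v = 0) :
    v = 0 := by
  refine h.inj i hi v hv.1 ?_
  rw [← Nat.sub_add_cancel hk, pow_add, Module.End.mul_apply, h0, map_zero]

theorem iSup_stringSpace (h : IsLefschetz d U R) : ⨆ p, stringSpace d U R p = ⊤ := by
  set S := ⨆ p, stringSpace d U R p
  have hmem : ∀ i j, 2 * i ≤ d → ∀ v ∈ primitivePart d U R i, (R ^ j) v ∈ S := by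
    intro i j hi v hv
    rcases lt_or_ge (d - 2 * i) j with hj | hj
    · simp [pow_primitive_eq_zero hv hj]
    · exact Submodule.mem_iSup_of_mem (⟨(i, j), hi, hj⟩ : StringIndex d)
        (Submodule.mem_map_of_mem hv)
  have hR : ∀ v ∈ S, R v ∈ S := by
    suffices S ≤ S.comap R from this
    refine iSup_le fun p => ?_
    rintro _ ⟨v, hv, rfl⟩
    rw [Submodule.mem_comap, ← Module.End.mul_apply, ← pow_succ']
    exact hmem _ _ p.2.1 v hv
  have hpow : ∀ k, ∀ v ∈ S, (R ^ k) v ∈ S := by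
    intro k
    induction k with
    | zero => simp
    | succ k ih =>
      intro v hv
      rw [pow_succ', Module.End.mul_apply]
      exact hR _ (ih v hv)
  -- Below the middle, `U_{m+1} = P_{m+1} + R U_m`.
  have hlow : ∀ m, 2 * m ≤ d → U m ≤ S := by
    intro m
    induction m with
    | zero =>
      intro _ v hv
      have h0 : (R ^ (d - 2 * 0 + 1)) v = 0 := by
        have := h.pow_mem hv (d - 2 * 0 + 1)
        rwa [h.eq_bot _ (by omega), Submodule.mem_bot] at this
      simpa using hmem 0 0 (by omega) v ⟨hv, h0⟩
    | succ m ih =>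
      intro hm x hx
      have h1 : (R ^ (d - 2 * (m + 1) + 1)) x ∈ U (d - m) := by
        have := h.pow_mem hx (d - 2 * (m + 1) + 1)
        rwa [show m + 1 + (d - 2 * (m + 1) + 1) = d - m by omega] at this
      obtain ⟨y, hy, hyx⟩ := h.surj m (by omega) _ h1
      have h2 : (R ^ (d - 2 * (m + 1) + 1)) (x - R y) = 0 := by
        rw [map_sub, ← hyx, ← Module.End.mul_apply, ← pow_succ,
          show d - 2 * (m + 1) + 1 + 1 = d - 2 * m by omega, sub_self]
      have h3 := hmem (m + 1) 0 hm (x - R y) ⟨Submodule.sub_mem _ hx (h.apply_mem m y hy), h2⟩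
      simpa using Submodule.add_mem _ h3 (hR y (ih (by omega) hy))
  rw [eq_top_iff, ← h.iSup_eq_top]
  refine iSup_le fun m => ?_
  rcases lt_or_ge d m with hm | hm
  · simp [h.eq_bot m hm]
  rcases le_or_gt (2 * m) d with hm' | hm'
  · exact hlow m hm'
  · intro x hx
    obtain ⟨y, hy, rfl⟩ := h.surj (d - m) (by omega) x (by rwa [Nat.sub_sub_self hm])
    exact hpow _ _ (hlow _ (by omega) hy)

theorem iSupIndep_stringSpace (h : IsLefschetz d U R) : iSupIndep (stringSpace d U R) := by
  classical
  rw [iSupIndep_iff_finsetSum_eq_zero_imp_eq_zero]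
  intro s v hv hsum
  let deg : StringIndex d → ℕ := fun p => p.1.1 + p.1.2
  have hdeg : ∀ p ∈ s, ∑ p' ∈ s with deg p' = deg p, v p' = 0 := by
    intro p hp
    refine (iSupIndep_iff_finsetSum_eq_zero_imp_eq_zero U).mp h.indep (s.image deg)
      (fun m => ∑ p' ∈ s with deg p' = m, v p') ?_ ?_ (deg p) (Finset.mem_image_of_mem _ hp)
    · intro m _
      refine Submodule.sum_mem _ fun p' hp' => ?_
      rw [Finset.mem_filter] at hp'
      obtain ⟨x, hx, hxv⟩ := hv p' hp'.1
      rw [← hxv, ← hp'.2]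
      exact h.pow_mem hx.1 _
    · rw [Finset.sum_fiberwise_of_maps_to (fun p hp => Finset.mem_image_of_mem deg hp)]
      exact hsum
  -- In a fixed degree, `R^{d-2i-j}` kills the strings that start above `i`.
  suffices ∀ n, ∀ p ∈ s, p.1.1 = n → v p = 0 from fun p hp => this _ p hp rfl
  intro n
  induction n using Nat.strong_induction_on with
  | _ n ih =>
  intro p hp hpn
  have h0 := congrArg (R ^ (d - 2 * p.1.1 - p.1.2)) (hdeg p hp)
  rw [map_zero, map_sum, Finset.sum_eq_single p] at h0
  · obtain ⟨x, hx, hxv⟩ := hv p hp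
    rw [← hxv, ← Module.End.mul_apply, ← pow_add, Nat.sub_add_cancel p.2.2] at h0
    rw [← hxv, h.inj _ p.2.1 x hx.1 h0, map_zero]
  · intro p' hp' hne
    rw [Finset.mem_filter] at hp'
    have hd' : p'.1.1 + p'.1.2 = p.1.1 + p.1.2 := hp'.2
    rcases lt_trichotomy p'.1.1 p.1.1 with hlt | heq | hgt
    · rw [ih _ (hpn ▸ hlt) p' hp'.1 rfl, map_zero]
    · exact absurd (Subtype.ext (Prod.ext heq (by omega))) hne
    · obtain ⟨x, hx, hxv⟩ := hv p' hp'.1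
      rw [← hxv, ← Module.End.mul_apply, ← pow_add]
      have h1 := p.2
      have h2 := p'.2
      exact pow_primitive_eq_zero hx (by omega)
  · intro hp'
    simp [hp] at hp'

theorem ext_strings (h : IsLefschetz d U R) {S T : Module.End 𝕂 V}
    (hST : ∀ i j, 2 * i ≤ d → j ≤ d - 2 * i → ∀ x ∈ primitivePart d U R i,
      S ((R ^ j) x) = T ((R ^ j) x)) : S = T := by
  refine LinearMap.ext_of_iSup_eq_top h.iSup_stringSpace fun p => ?_
  rintro _ ⟨x, hx, rfl⟩
  exact hST _ _ p.2.1 p.2.2 x hx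

/-- A lowering map with prescribed coefficients along the strings. -/
theorem exists_lowering (h : IsLefschetz d U R) (c : ℕ → ℕ → 𝕂) :
    ∃ T : Module.End 𝕂 V, ∀ i, 2 * i ≤ d → ∀ x ∈ primitivePart d U R i,
      T x = 0 ∧ ∀ j, j < d - 2 * i → T ((R ^ (j + 1)) x) = c i (j + 1) • (R ^ j) x := by
  have hinv : ∀ p : StringIndex d, ∃ g : Module.End 𝕂 V,
      ∀ x ∈ primitivePart d U R p.1.1, g ((R ^ p.1.2) x) = x := by
    intro p
    obtain ⟨g, hg⟩ := ((R ^ p.1.2).domRestrict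
      (primitivePart d U R p.1.1)).exists_leftInverse_of_injective (by
        rw [LinearMap.ker_eq_bot']
        intro x hx
        exact Subtype.ext (h.pow_primitive_injective p.2.1 p.2.2 x.2 hx))
    refine ⟨(Submodule.subtype _).comp g, fun x hx => ?_⟩
    exact congrArg Subtype.val (LinearMap.congr_fun hg ⟨x, hx⟩)
  choose g hg using hinv
  obtain ⟨T, hT⟩ := exists_end_of_iSupIndep h.iSupIndep_stringSpace h.iSup_stringSpace
    fun p => if p.1.2 = 0 then 0 else c p.1.1 p.1.2 • (R ^ (p.1.2 - 1) * g p)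
  refine ⟨T, fun i hi x hx => ⟨?_, fun j hj => ?_⟩⟩
  · simpa using hT ⟨(i, 0), hi, Nat.zero_le _⟩ x ⟨x, hx, by simp⟩
  · rw [hT ⟨(i, j + 1), hi, hj⟩ _ ⟨x, hx, rfl⟩]
    have := hg ⟨(i, j + 1), hi, hj⟩ x hx
    simp only at this
    simp [this]

end IsLefschetz

end Lefschetz

/-! ### The lowering operator along the strings -/

section LoweringOperator

variable {𝕂 V : Type*} [Field 𝕂] [AddCommGroup V] [Module 𝕂 V]

/-- The scalar `(q - q⁻¹)² [j]_q [n+1-j]_q`, the effect of lowering the `j`-th vector of a string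
of length `n + 1`. -/
def stringCoeff (q : 𝕂) (n j : ℤ) : 𝕂 :=
  (q ^ j - q ^ (-j)) * (q ^ (n + 1 - j) - q ^ (-(n + 1 - j)))

theorem stringCoeff_zero (q : 𝕂) (n : ℤ) : stringCoeff q n 0 = 0 := by simp [stringCoeff]

theorem stringCoeff_top (q : 𝕂) (n : ℤ) : stringCoeff q n (n + 1) = 0 := by simp [stringCoeff]

theorem stringCoeff_succ {q : 𝕂} (hq : q ≠ 0) (n j : ℤ) :
    stringCoeff q n (j + 1) =
      stringCoeff q n j + (q - q⁻¹) * (q ^ (n - 2 * j) - q ^ (2 * j - n)) := by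
  have hn : q ^ n ≠ 0 := zpow_ne_zero n hq
  have hj : q ^ j ≠ 0 := zpow_ne_zero j hq
  simp only [stringCoeff, two_mul, zpow_neg, zpow_sub₀ hq, zpow_add₀ hq, zpow_one]
  field_simp
  ring

/-- The eigenvalue of the normalized Casimir element on a string, read off from its `j`-th
vector. -/
theorem stringCoeff_casimir {q : 𝕂} (hq : q ≠ 0) (n j : ℤ) :
    stringCoeff q n (j + 1) + q⁻¹ * q ^ (n - 2 * j) + q * q ^ (2 * j - n) =
      q ^ (n + 1) + q ^ (-n - 1) := by
  have hn : q ^ n ≠ 0 := zpow_ne_zero n hq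
  have hj : q ^ j ≠ 0 := zpow_ne_zero j hq
  simp only [stringCoeff, two_mul, zpow_neg, zpow_sub₀ hq, zpow_add₀ hq, zpow_one]
  field_simp
  ring

/-- `ψ` is the lowering operator attached to `R` and `K`: it has the commutator with `R` that the
relation between `e` and `f` in `U_q(sl₂)` prescribes, and it kills the primitive vectors. -/
structure IsLoweringOperator (d : ℕ) (U : ℕ → Submodule 𝕂 V) (R : Module.End 𝕂 V) (q : 𝕂)
    (K : (Module.End 𝕂 V)ˣ) (ψ : Module.End 𝕂 V) : Prop where
  comm : ψ * R - R * ψ = (q - q⁻¹) •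
    ((K : Module.End 𝕂 V) - ((K⁻¹ : (Module.End 𝕂 V)ˣ) : Module.End 𝕂 V))
  primitive : ∀ i, 2 * i ≤ d → ∀ x ∈ primitivePart d U R i, ψ x = 0

theorem Units.inv_apply_of_apply_eq_smul {K : (Module.End 𝕂 V)ˣ} {c : 𝕂} (hc : c ≠ 0) {v : V}
    (h : (K : Module.End 𝕂 V) v = c • v) :
    ((K⁻¹ : (Module.End 𝕂 V)ˣ) : Module.End 𝕂 V) v = c⁻¹ • v := by
  have h1 : ((K⁻¹ : (Module.End 𝕂 V)ˣ) : Module.End 𝕂 V) ((K : Module.End 𝕂 V) v) = v := by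
    rw [← Module.End.mul_apply, Units.inv_mul, Module.End.one_apply]
  rw [h, map_smul] at h1
  rw [← h1, smul_smul, inv_mul_cancel₀ hc, one_smul, h1]

variable {d : ℕ} {U : ℕ → Submodule 𝕂 V} {R : Module.End 𝕂 V} {q : 𝕂}
  {K : (Module.End 𝕂 V)ˣ} {ψ : Module.End 𝕂 V}

namespace IsLefschetz

theorem K_string (h : IsLefschetz d U R)
    (hK : ∀ i ≤ d, ∀ v ∈ U i, (K : Module.End 𝕂 V) v = q ^ ((d : ℤ) - 2 * (i : ℤ)) • v)
    {i j : ℕ} (hi : 2 * i ≤ d) (hj : j ≤ d - 2 * i) {x : V} (hx : x ∈ primitivePart d U R i) :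
    (K : Module.End 𝕂 V) ((R ^ j) x) = q ^ (((d : ℤ) - 2 * i) - 2 * j) • (R ^ j) x := by
  rw [hK (i + j) (by omega) _ (h.pow_mem hx.1 j)]
  congr 2
  push_cast
  ring

theorem Kinv_string (h : IsLefschetz d U R) (hq : q ≠ 0)
    (hK : ∀ i ≤ d, ∀ v ∈ U i, (K : Module.End 𝕂 V) v = q ^ ((d : ℤ) - 2 * (i : ℤ)) • v)
    {i j : ℕ} (hi : 2 * i ≤ d) (hj : j ≤ d - 2 * i) {x : V} (hx : x ∈ primitivePart d U R i) :
    ((K⁻¹ : (Module.End 𝕂 V)ˣ) : Module.End 𝕂 V) ((R ^ j) x) =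
      q ^ (2 * j - ((d : ℤ) - 2 * i)) • (R ^ j) x := by
  rw [Units.inv_apply_of_apply_eq_smul (zpow_ne_zero _ hq) (h.K_string hK hi hj hx), ← zpow_neg,
    neg_sub]

/-- The action of the lowering operator along a string is forced by the commutation rule. -/
theorem lowering_string (h : IsLefschetz d U R) (hq : q ≠ 0)
    (hK : ∀ i ≤ d, ∀ v ∈ U i, (K : Module.End 𝕂 V) v = q ^ ((d : ℤ) - 2 * (i : ℤ)) • v)
    (hψ : IsLoweringOperator d U R q K ψ)
    {i j : ℕ} (hi : 2 * i ≤ d) (hj : j ≤ d - 2 * i) {x : V} (hx : x ∈ primitivePart d U R i) :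
    ψ ((R ^ (j + 1)) x) = stringCoeff q ((d : ℤ) - 2 * i) (j + 1) • (R ^ j) x := by
  have key : ∀ v, ψ (R v) = R (ψ v) + (q - q⁻¹) • ((K : Module.End 𝕂 V) v -
      ((K⁻¹ : (Module.End 𝕂 V)ˣ) : Module.End 𝕂 V) v) := fun v => by
    have := LinearMap.congr_fun hψ.comm v
    simp only [LinearMap.sub_apply, Module.End.mul_apply, LinearMap.smul_apply] at this
    rw [← this]
    abel
  have hstep : ∀ j : ℕ, ((R ^ (j + 1)) x) = R ((R ^ j) x) := fun j => by
    rw [pow_succ', Module.End.mul_apply]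
  induction j with
  | zero =>
    rw [hstep, key, h.K_string hK hi hj hx, h.Kinv_string hq hK hi hj hx, stringCoeff_succ hq]
    simp [hψ.primitive i hi x hx, ← sub_smul, smul_smul, stringCoeff_zero]
  | succ j ih =>
    rw [hstep, key, h.K_string hK hi hj hx, h.Kinv_string hq hK hi hj hx, ih (by omega),
      map_smul, ← hstep, ← sub_smul, smul_smul, ← add_smul, stringCoeff_succ hq _ ((j + 1 : ℕ) : ℤ)]
    push_cast
    rfl

theorem existsUnique_lowering (h : IsLefschetz d U R) (hq : q ≠ 0)
    (hK : ∀ i ≤ d, ∀ v ∈ U i, (K : Module.End 𝕂 V) v = q ^ ((d : ℤ) - 2 * (i : ℤ)) • v) :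
    ∃! ψ, IsLoweringOperator d U R q K ψ := by
  obtain ⟨T, hT⟩ := h.exists_lowering fun i j => stringCoeff q ((d : ℤ) - 2 * i) j
  refine ⟨T, ⟨h.ext_strings fun i j hi hj x hx => ?_, fun i hi x hx => (hT i hi x hx).1⟩, ?_⟩
  · have hTj : ∀ j ≤ d - 2 * i, T (R ((R ^ j) x)) =
        stringCoeff q ((d : ℤ) - 2 * i) (j + 1) • (R ^ j) x := by
      intro j hj
      rw [← Module.End.mul_apply R, ← pow_succ']
      rcases hj.lt_or_eq with hj | hj
      · simpa using (hT i hi x hx).2 j hj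
      · have hd : ((j : ℕ) : ℤ) = (d : ℤ) - 2 * i := by omega
        rw [pow_primitive_eq_zero hx (by omega), hd, stringCoeff_top, map_zero, zero_smul]
    have hRT : R (T ((R ^ j) x)) = stringCoeff q ((d : ℤ) - 2 * i) j • (R ^ j) x := by
      cases j with
      | zero => simp [(hT i hi x hx).1, stringCoeff_zero]
      | succ j =>
        rw [(hT i hi x hx).2 j hj, map_smul, ← Module.End.mul_apply, ← pow_succ']
    simp only [LinearMap.sub_apply, Module.End.mul_apply, LinearMap.smul_apply]
    rw [hTj j hj, hRT, h.K_string hK hi hj hx, h.Kinv_string hq hK hi hj hx, ← sub_smul,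
      ← sub_smul, smul_smul, stringCoeff_succ hq, add_sub_cancel_left]
  · intro ψ hψ
    refine h.ext_strings fun i j hi hj x hx => ?_
    cases j with
    | zero => simp [hψ.primitive i hi x hx, (hT i hi x hx).1]
    | succ j =>
      rw [h.lowering_string hq hK hψ hi (by omega) hx, (hT i hi x hx).2 j hj]
      push_cast
      rfl

theorem K_mul_R (h : IsLefschetz d U R) (hq : q ≠ 0)
    (hK : ∀ i ≤ d, ∀ v ∈ U i, (K : Module.End 𝕂 V) v = q ^ ((d : ℤ) - 2 * (i : ℤ)) • v) :
    (K : Module.End 𝕂 V) * R = (q ^ 2)⁻¹ • (R * (K : Module.End 𝕂 V)) := by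
  refine LinearMap.ext_of_iSup_eq_top h.iSup_eq_top fun i v hv => ?_
  simp only [Module.End.mul_apply, LinearMap.smul_apply]
  have h1 := h.apply_mem i v hv
  rcases lt_or_ge i d with hi | hi
  · rw [hK i hi.le v hv, hK (i + 1) hi _ h1, map_smul, smul_smul, ← zpow_natCast, ← zpow_neg,
      ← zpow_add₀ hq]
    congr 2
    push_cast
    ring
  · have h0 : R v = 0 := by rwa [h.eq_bot (i + 1) (by omega), Submodule.mem_bot] at h1
    rcases hi.lt_or_eq with hi | rfl
    · have : v = 0 := by rwa [h.eq_bot i hi, Submodule.mem_bot] at hv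
      simp [this]
    · rw [h0, hK _ le_rfl v hv, map_smul, h0]
      simp

theorem K_mul_lowering (h : IsLefschetz d U R) (hq : q ≠ 0)
    (hK : ∀ i ≤ d, ∀ v ∈ U i, (K : Module.End 𝕂 V) v = q ^ ((d : ℤ) - 2 * (i : ℤ)) • v)
    (hψ : IsLoweringOperator d U R q K ψ) :
    (K : Module.End 𝕂 V) * ψ = q ^ 2 • (ψ * (K : Module.End 𝕂 V)) := by
  refine h.ext_strings fun i j hi hj x hx => ?_
  simp only [Module.End.mul_apply, LinearMap.smul_apply]
  rw [h.K_string hK hi hj hx, map_smul]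
  cases j with
  | zero => simp [hψ.primitive i hi x hx]
  | succ j =>
    rw [h.lowering_string hq hK hψ hi (by omega) hx, map_smul, h.K_string hK hi (by omega) hx,
      smul_smul, smul_smul, smul_smul]
    congr 1
    have : q ^ ((d : ℤ) - 2 * i - 2 * j) = q ^ 2 * q ^ ((d : ℤ) - 2 * i - 2 * ((j + 1 : ℕ) : ℤ)) := by
      rw [← zpow_natCast q 2, ← zpow_add₀ hq]
      congr 1
      push_cast
      ring
    rw [this]
    ring

/-- The graded pieces are spanned by the levels of the strings that they contain. -/
theorem le_iSup_stringSpace (h : IsLefschetz d U R) (m : ℕ) :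
    U m ≤ ⨆ (p : StringIndex d) (_ : p.1.1 + p.1.2 = m), stringSpace d U R p := by
  refine h.indep.le_of_iSup_eq_top
    (N := fun m => ⨆ (p : StringIndex d) (_ : p.1.1 + p.1.2 = m), stringSpace d U R p)
    (fun m => iSup₂_le fun p hp => ?_) ?_ m
  · rintro _ ⟨x, hx, rfl⟩
    exact hp ▸ h.pow_mem hx.1 _
  · rw [eq_top_iff, ← h.iSup_stringSpace]
    exact iSup_le fun p => le_iSup_of_le (p.1.1 + p.1.2) (le_iSup₂_of_le p rfl le_rfl)

/-- The lowering operator strictly lowers the degree. -/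
theorem lowering_mem (h : IsLefschetz d U R) (hq : q ≠ 0)
    (hK : ∀ i ≤ d, ∀ v ∈ U i, (K : Module.End 𝕂 V) v = q ^ ((d : ℤ) - 2 * (i : ℤ)) • v)
    (hψ : IsLoweringOperator d U R q K ψ) (m : ℕ) :
    U m ≤ (⨆ i, ⨆ (_ : i < m), U i).comap ψ := by
  refine (h.le_iSup_stringSpace m).trans (iSup₂_le fun p hp => ?_)
  obtain ⟨⟨i, j⟩, hi, hj⟩ := p
  rintro _ ⟨x, hx, rfl⟩
  simp only at hp hi hj hx
  rw [Submodule.mem_comap]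
  cases j with
  | zero => simp [hψ.primitive i hi x hx]
  | succ j =>
    rw [h.lowering_string hq hK hψ hi (by omega) hx]
    exact Submodule.smul_mem _ _ (Submodule.mem_iSup_of_mem (i + j)
      (Submodule.mem_iSup_of_mem (by omega) (h.pow_mem hx.1 j)))

end IsLefschetz

end LoweringOperator

/-! ### Modules over `U_q(sl₂)` -/

namespace Uq

variable {𝕂 : Type*} [Field 𝕂] {q : 𝕂}

/-- A property of the generators that is stable under the algebra operations holds on all of
`U_q(sl₂)`. -/
theorem induction_on {p : Uq q → Prop} (u : Uq q) (halg : ∀ c : 𝕂, p (algebraMap 𝕂 (Uq q) c))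
    (hgen : ∀ x, p (gen q x)) (hmul : ∀ u v, p u → p v → p (u * v))
    (hadd : ∀ u v, p u → p v → p (u + v)) : p u := by
  obtain ⟨x, rfl⟩ := RingQuot.mkAlgHom_surjective 𝕂 (UqRel q) u
  induction x using FreeAlgebra.induction with
  | grade0 c =>
    rw [AlgHom.commutes]
    exact halg c
  | grade1 x => exact hgen x
  | mul a b ha hb =>
    rw [map_mul]
    exact hmul _ _ ha hb
  | add a b ha hb =>
    rw [map_add]
    exact hadd _ _ ha hb

variable {V : Type*} [AddCommGroup V] [Module 𝕂 V]

/-- The images of the generators `e, f, k, k⁻¹` under the action given by `ψ`, `R`, `K`. -/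
def actionGen (q : 𝕂) (ψ R : Module.End 𝕂 V) (K : (Module.End 𝕂 V)ˣ) :
    UqGen → Module.End 𝕂 V
  | .e => (q - q⁻¹)⁻¹ • ψ
  | .f => (q - q⁻¹)⁻¹ • R
  | .k => K
  | .kinv => ((K⁻¹ : (Module.End 𝕂 V)ˣ) : Module.End 𝕂 V)

theorem actionGen_rel (hq : q ≠ 0) (hq4 : q ^ 4 ≠ 1) {ψ R : Module.End 𝕂 V}
    {K : (Module.End 𝕂 V)ˣ}
    (hKψ : (K : Module.End 𝕂 V) * ψ = q ^ 2 • (ψ * (K : Module.End 𝕂 V)))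
    (hKR : (K : Module.End 𝕂 V) * R = (q ^ 2)⁻¹ • (R * (K : Module.End 𝕂 V)))
    (hψR : ψ * R - R * ψ = (q - q⁻¹) •
      ((K : Module.End 𝕂 V) - ((K⁻¹ : (Module.End 𝕂 V)ˣ) : Module.End 𝕂 V)))
    ⦃x y : FreeAlgebra 𝕂 UqGen⦄ (h : UqRel q x y) :
    FreeAlgebra.lift 𝕂 (actionGen q ψ R K) x = FreeAlgebra.lift 𝕂 (actionGen q ψ R K) y := by
  have h0 := sub_inv_ne_zero hq hq4
  cases h with
  | k_kinv => simp [actionGen]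
  | kinv_k => simp [actionGen]
  | k_e =>
    simp only [map_mul, FreeAlgebra.lift_ι_apply, map_smul, actionGen, mul_smul_comm,
      smul_mul_assoc]
    rw [hKψ, smul_mul_assoc, mul_assoc, Units.mul_inv, mul_one, smul_comm]
  | k_f =>
    simp only [map_mul, FreeAlgebra.lift_ι_apply, map_smul, actionGen, mul_smul_comm,
      smul_mul_assoc]
    rw [hKR, smul_mul_assoc, mul_assoc, Units.mul_inv, mul_one, smul_comm]
  | e_f =>
    simp only [map_mul, map_sub, FreeAlgebra.lift_ι_apply, map_smul, actionGen, mul_smul_comm,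
      smul_mul_assoc]
    rw [← smul_sub, ← smul_sub, hψR, smul_smul (_)⁻¹ (q - q⁻¹), inv_mul_cancel₀ h0, one_smul]

/-- Endomorphisms that satisfy the relations make `V` a module. -/
theorem exists_module (hq : q ≠ 0) (hq4 : q ^ 4 ≠ 1) {ψ R : Module.End 𝕂 V}
    {K : (Module.End 𝕂 V)ˣ}
    (hKψ : (K : Module.End 𝕂 V) * ψ = q ^ 2 • (ψ * (K : Module.End 𝕂 V)))
    (hKR : (K : Module.End 𝕂 V) * R = (q ^ 2)⁻¹ • (R * (K : Module.End 𝕂 V)))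
    (hψR : ψ * R - R * ψ = (q - q⁻¹) •
      ((K : Module.End 𝕂 V) - ((K⁻¹ : (Module.End 𝕂 V)ˣ) : Module.End 𝕂 V))) :
    ∃ (_ : Module (Uq q) V) (_ : IsScalarTower 𝕂 (Uq q) V), ActsBy q ψ R K := by
  let φ := lift q (actionGen q ψ R K) (actionGen_rel hq hq4 hKψ hKR hψR)
  let _ : Module (Uq q) V := Module.compHom V φ.toRingHom
  have hsmul : ∀ (u : Uq q) (v : V), u • v = φ u v := fun _ _ => rfl
  refine ⟨inferInstance, ⟨fun c u v => ?_⟩, fun v => ⟨?_, ?_, ?_, ?_⟩⟩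
  · rw [hsmul, hsmul, map_smul, LinearMap.smul_apply]
  all_goals
    rw [hsmul, lift_gen]
    rfl

/-! ### The simple modules `L(n, 1)` -/

theorem L_smul {hq : q ≠ 0} {hq4 : q ^ 4 ≠ 1} {n : ℕ} {ε : ℤˣ} (u : Uq q)
    (w : Fin (n + 1) → 𝕂) : (u • (show L hq hq4 n ε from w) : L hq hq4 n ε) =
      lift q (simpleGen q n ε) (simpleGen_rel hq hq4 n ε) u w :=
  rfl

theorem L_algebraMap_smul {hq : q ≠ 0} {hq4 : q ^ 4 ≠ 1} {n : ℕ} {ε : ℤˣ} (c : 𝕂)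
    (w : Fin (n + 1) → 𝕂) :
    (algebraMap 𝕂 (Uq q) c • (show L hq hq4 n ε from w) : L hq hq4 n ε) = c • w := by
  rw [L_smul, AlgHom.commutes]
  rfl

theorem qInt_ne_zero (hq : q ≠ 0) (hq4 : q ^ 4 ≠ 1) {j : ℕ} (hj : q ^ (2 * j) ≠ 1) :
    qInt q j ≠ 0 := by
  refine div_ne_zero (fun h => hj ?_) (sub_inv_ne_zero hq hq4)
  rw [sub_eq_zero, zpow_neg, zpow_natCast] at h
  rw [two_mul, pow_add]
  nth_rewrite 2 [h]
  exact mul_inv_cancel₀ (pow_ne_zero _ hq)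

theorem eq_sum_stdVec {n : ℕ} (w : Fin (n + 1) → 𝕂) :
    w = ∑ i, w i • stdVec 𝕂 n (i : ℕ) := by
  conv_lhs => rw [← (Pi.basisFun 𝕂 (Fin (n + 1))).sum_repr w]
  simp [single_eq_stdVec]

theorem simpleGen_e_apply {n : ℕ} (w : Fin (n + 1) → 𝕂) {j : ℕ} (hj : j + 1 < n + 1) :
    simpleGen q n 1 .e w ⟨j, by omega⟩ = qInt q ((n - j : ℕ) : ℤ) * w ⟨j + 1, hj⟩ := by
  conv_lhs => rw [eq_sum_stdVec w, map_sum, Finset.sum_apply]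
  rw [Finset.sum_eq_single ⟨j + 1, hj⟩]
  · rw [map_smul, simpleGen_e_succ _ _ _ (by simpa using hj), Nat.cast_sub (by omega)]
    simp [stdVec, mul_comm]
  · rintro ⟨i, hi⟩ _ hne
    cases i with
    | zero => simp [simpleGen_e_zero]
    | succ i =>
      have : j ≠ i := fun h => hne (by simp [h])
      rw [map_smul, simpleGen_e_succ _ _ _ (by simpa using hi)]
      simp [stdVec, this]
  · simp

/-- `L(n, 1)` is simple as long as none of `[1]_q, …, [n]_q` vanishes: powers of `e` take any
nonzero vector to the highest weight line, and `f` generates the module from there. -/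
theorem isSimpleModule_L (hq : q ≠ 0) (hq4 : q ^ 4 ≠ 1) {n : ℕ}
    (hn : ∀ j, 1 ≤ j → j ≤ n → q ^ (2 * j) ≠ 1) : IsSimpleModule (Uq q) (L hq hq4 n 1) := by
  have hint : ∀ j : ℕ, 1 ≤ j → j ≤ n → qInt q j ≠ 0 := fun j h1 h2 =>
    qInt_ne_zero hq hq4 (hn j h1 h2)
  have hsm : ∀ (P : Submodule (Uq q) (L hq hq4 n 1)) (c : 𝕂) (w : Fin (n + 1) → 𝕂),
      (show L hq hq4 n 1 from w) ∈ P → (show L hq hq4 n 1 from c • w) ∈ P := fun P c w hw =>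
    L_algebraMap_smul (hq := hq) (hq4 := hq4) (ε := 1) c w ▸ P.smul_mem (algebraMap 𝕂 _ c) hw
  have hdiv : ∀ (P : Submodule (Uq q) (L hq hq4 n 1)) (c : 𝕂) (w : Fin (n + 1) → 𝕂), c ≠ 0 →
      (show L hq hq4 n 1 from c • w) ∈ P → (show L hq hq4 n 1 from w) ∈ P := by
    intro P c w hc hw
    have := hsm P c⁻¹ _ hw
    rwa [smul_smul, inv_mul_cancel₀ hc, one_smul] at this
  have hgen : ∀ (P : Submodule (Uq q) (L hq hq4 n 1)) x (w : Fin (n + 1) → 𝕂),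
      (show L hq hq4 n 1 from w) ∈ P → (show L hq hq4 n 1 from simpleGen q n 1 x w) ∈ P :=
    fun P x w hw => L_gen_smul hq hq4 n 1 x w ▸ P.smul_mem (gen q x) hw
  have hlow : ∀ (P : Submodule (Uq q) (L hq hq4 n 1)) (j : ℕ) (hj : j < n + 1)
      (w : Fin (n + 1) → 𝕂), (show L hq hq4 n 1 from w) ∈ P → w ⟨j, hj⟩ ≠ 0 →
      (∀ k (hk : k < n + 1), j < k → w ⟨k, hk⟩ = 0) →
      (show L hq hq4 n 1 from stdVec 𝕂 n 0) ∈ P := by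
    intro P j
    induction j with
    | zero =>
      intro hj w hw h0 hlt
      refine hdiv P (w ⟨0, hj⟩) _ h0 ?_
      have : w ⟨0, hj⟩ • stdVec 𝕂 n 0 = w := by
        funext k
        rcases Nat.eq_zero_or_pos (k : ℕ) with hk | hk
        · have : k = ⟨0, hj⟩ := Fin.ext hk
          simp [this, stdVec]
        · simp [stdVec, hk.ne', hlt k k.2 hk]
      rwa [this]
    | succ j ih =>
      intro hj w hw h0 hlt
      refine ih (by omega) _ (hgen P .e w hw) ?_ fun k hk hjk => ?_
      · rw [simpleGen_e_apply w hj]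
        exact mul_ne_zero (hint _ (by omega) (by omega)) h0
      · rcases Nat.lt_or_ge (k + 1) (n + 1) with hk' | hk'
        · rw [simpleGen_e_apply w hk', hlt (k + 1) hk' (by omega), mul_zero]
        · conv_lhs => rw [eq_sum_stdVec w, map_sum, Finset.sum_apply]
          refine Finset.sum_eq_zero ?_
          rintro ⟨i, hi⟩ _
          cases i with
          | zero => simp [simpleGen_e_zero]
          | succ i =>
            have : k ≠ i := by omega
            rw [map_smul, simpleGen_e_succ _ _ _ (by simpa using hi)]
            simp [stdVec, this]
  have htop : ∀ P : Submodule (Uq q) (L hq hq4 n 1),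
      (show L hq hq4 n 1 from stdVec 𝕂 n 0) ∈ P → P = ⊤ := by
    intro P h0
    have hall : ∀ i, i ≤ n → (show L hq hq4 n 1 from stdVec 𝕂 n i) ∈ P := by
      intro i
      induction i with
      | zero => exact fun _ => h0
      | succ i ih =>
        intro hi
        have := hgen P .f _ (ih (by omega))
        rw [simpleGen_f _ _ _ (by omega : i ≤ n)] at this
        exact hdiv P _ _ (by exact_mod_cast hint (i + 1) (by omega) hi) this
    rw [eq_top_iff]
    intro w _
    have hw : w = ∑ i : Fin (n + 1), (show L hq hq4 n 1 from
      (show Fin (n + 1) → 𝕂 from w) i • stdVec 𝕂 n (i : ℕ)) := eq_sum_stdVec _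
    rw [hw]
    exact Submodule.sum_mem _ fun i _ => hsm P _ _ (hall i (by omega))
  have hne : Nontrivial (L hq hq4 n 1) := inferInstanceAs (Nontrivial (Fin (n + 1) → 𝕂))
  classical
  rw [isSimpleModule_iff, isSimpleOrder_iff]
  refine ⟨inferInstance, fun P => ?_⟩
  by_cases hP : P = ⊥
  · exact Or.inl hP
  refine Or.inr (htop P ?_)
  obtain ⟨w, hw, hw0⟩ := P.ne_bot_iff.mp hP
  have hex : ∃ j, (show Fin (n + 1) → 𝕂 from w) j ≠ 0 := by
    by_contra! h
    exact hw0 (funext h)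
  -- the last nonzero coordinate
  obtain ⟨j, hj, hmax⟩ := Finset.exists_max_image
    (Finset.univ.filter fun j => (show Fin (n + 1) → 𝕂 from w) j ≠ 0) id
    (by obtain ⟨j, hj⟩ := hex; exact ⟨j, by simpa using hj⟩)
  refine hlow P j j.2 w hw (by simpa using hj) fun k hk hjk => ?_
  by_contra hk0
  have := hmax ⟨k, hk⟩ (by simpa using hk0)
  exact absurd (Fin.le_def.mp this) (by simpa using hjk)

/-- The normalized Casimir element acts on `L(n, 1)` as the scalar `q^{n+1} + q^{-n-1}`. -/
theorem casimir_smul_L (hq : q ≠ 0) (hq4 : q ^ 4 ≠ 1) {n : ℕ} (w : L hq hq4 n 1) :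
    casimir q • w =
      algebraMap 𝕂 (Uq q) (q ^ ((n : ℤ) + 1) + q ^ (-(n : ℤ) - 1)) • w := by
  have h0 := sub_inv_ne_zero hq hq4
  change lift q (simpleGen q n 1) (simpleGen_rel hq hq4 n 1) _ (show Fin (n + 1) → 𝕂 from w) =
    lift q (simpleGen q n 1) (simpleGen_rel hq hq4 n 1) _ (show Fin (n + 1) → 𝕂 from w)
  congr 1
  refine end_ext_stdVec fun i hi => ?_
  simp only [casimir, map_add, map_smul, map_mul, lift_gen, AlgHom.commutes, LinearMap.add_apply,
    LinearMap.smul_apply, Module.End.mul_apply, Module.algebraMap_end_apply,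
    simpleGen_k q n 1 hi, simpleGen_kinv q n 1 hi, simpleGen_f q n 1 hi]
  have h1 : qInt q ((i : ℤ) + 1) • simpleGen q n 1 .e (stdVec 𝕂 n (i + 1)) =
      (((q - q⁻¹) ^ 2)⁻¹ * stringCoeff q n (i + 1)) • stdVec 𝕂 n i := by
    rcases Nat.lt_or_ge n (i + 1) with h' | h'
    · have : i = n := by omega
      subst this
      simp [stdVec_of_lt 𝕂 h', stringCoeff_top]
    · rw [simpleGen_e_succ q n 1 h', smul_smul]
      congr 1
      simp only [qInt, stringCoeff, add_sub_add_right_eq_sub]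
      field_simp
      simp
  rw [h1, smul_smul, smul_smul, smul_smul, ← add_smul, ← add_smul, ← add_smul]
  congr 1
  rw [← stringCoeff_casimir hq n i, mul_inv_cancel_left₀ (pow_ne_zero 2 h0)]
  simp

end Uq

/-! ### The `U_q(sl₂)`-action attached to the split decomposition -/

namespace TDSystem

variable {𝕂 V : Type*} [Field 𝕂] [AddCommGroup V] [Module 𝕂 V] {d : ℕ}
  {Φ : TDSystem 𝕂 V d} {θ θs : ℕ → 𝕂}

theorem secondInversion_kerSpace (Φ : TDSystem 𝕂 V d) (i : ℕ) :
    Φ.secondInversion.kerSpace i = Φ.kerSpace i := by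
  unfold kerSpace
  congr 1
  refine le_antisymm (iSup₂_le fun j hj => ?_) (iSup₂_le fun j hj => ?_)
  · refine le_iSup₂_of_le (f := fun (j : Fin (d + 1))
      (_ : i ≤ (j : ℕ) ∧ (j : ℕ) + i ≤ d) => LinearMap.range (Φ.E j)) j.rev ?_ le_rfl
    rw [Fin.val_rev]
    omega
  · refine le_iSup₂_of_le (f := fun (j : Fin (d + 1))
      (_ : i ≤ (j : ℕ) ∧ (j : ℕ) + i ≤ d) => LinearMap.range (Φ.E j.rev)) j.rev ?_ ?_
    · rw [Fin.val_rev]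
      omega
    · rw [Fin.rev_rev]

theorem secondInversion_upper (Φ : TDSystem 𝕂 V d) {i : ℕ} (hi : i ≤ d) :
    Φ.secondInversion.upper i =
      ⨆ (j : Fin (d + 1)) (_ : (j : ℕ) ∈ Finset.range (d - i + 1)), LinearMap.range (Φ.E j) := by
  refine le_antisymm (iSup₂_le fun j hj => ?_) (iSup₂_le fun j hj => ?_)
  · refine le_iSup₂_of_le (f := fun (j : Fin (d + 1))
      (_ : (j : ℕ) ∈ Finset.range (d - i + 1)) => LinearMap.range (Φ.E j)) j.rev ?_ le_rfl
    rw [Fin.val_rev, Finset.mem_range]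
    omega
  · rw [Finset.mem_range] at hj
    refine le_trans ?_ (le_upperFlag _ j.rev (by rw [Fin.val_rev]; omega))
    change LinearMap.range (Φ.E j) ≤ LinearMap.range (Φ.E j.rev.rev)
    rw [Fin.rev_rev]

/-- The raising map has the hard Lefschetz property on the split decomposition. -/
theorem HasEigenvalues.isLefschetz [FiniteDimensional 𝕂 V]
    (h : Φ.HasEigenvalues (fun i => θ i) (fun i => θs i)) {R : Module.End 𝕂 V}
    (hR : ∀ i, ∀ v ∈ Φ.splitSpace i, R v = Φ.A v - θ i • v) :
    IsLefschetz d Φ.splitSpace R := by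
  have hU : ∀ i, ∀ v ∈ Φ.splitSpace i, R v ∈ Φ.splitSpace (i + 1) := fun i v hv => by
    rw [hR i v hv]
    exact h.sub_smul_mem_splitSpace hv
  have hinj : ∀ i, 2 * i ≤ d → ∀ v ∈ Φ.splitSpace i, (R ^ (d - 2 * i)) v = 0 → v = 0 := by
    intro i hi v hv h0
    -- `v` lies in `E_i V + ⋯ + E_{d-i-1} V`, which the second inversion separates from the
    -- flag of `A*`.
    have h1 : v ∈ ⨆ (j : Fin (d + 1)) (_ : (j : ℕ) ∈ Finset.Ico i (i + (d - 2 * i))),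
        LinearMap.range (Φ.E j) := by
      rw [h.iSup_range_E (fun j hj => by rw [Finset.mem_Ico] at hj; omega), LinearMap.mem_ker,
        (aeval_prod_Ico_eq_pow hR hU hv _).2, h0]
    have h2 : v ∈ Φ.secondInversion.upper (i + 1) := by
      rcases Nat.lt_or_ge i d with hid | hid
      · rw [secondInversion_upper _ (by omega)]
        refine (iSup₂_mono' (fun j hj => ⟨j, ?_, le_rfl⟩) :
          (⨆ (j : Fin (d + 1)) (_ : (j : ℕ) ∈ Finset.Ico i (i + (d - 2 * i))),
          LinearMap.range (Φ.E j)) ≤ _) h1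
        rw [Finset.mem_Ico] at hj
        rw [Finset.mem_range]
        omega
      · have : d - 2 * i = 0 := by omega
        rw [this] at h0
        have : v = 0 := by simpa using h0
        simp [this]
    have h' := h.secondInversion (θ' := fun n => θ (d - n)) fun _ _ => rfl
    have h3 := HasEigenvalues.lowerStar_inf_upper (θ := fun n => θ (d - n)) h' (i + 1)
    have h4 : v ∈ Φ.secondInversion.lowerStar (i + 1) ⊓ Φ.secondInversion.upper (i + 1) :=
      ⟨Φ.splitSpace_le_lowerStar (Nat.lt_succ_self i) hv, h2⟩
    rwa [h3, Submodule.mem_bot] at h4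
  refine ⟨h.iSupIndep_splitSpace, h.iSup_splitSpace, fun i hi => Φ.splitSpace_of_lt hi, hU, hinj,
    fun i hi w hw => ?_⟩
  have hle : (Φ.splitSpace i).map (R ^ (d - 2 * i)) ≤ Φ.splitSpace (d - i) := by
    rintro _ ⟨v, hv, rfl⟩
    have := (aeval_prod_Ico_eq_pow hR hU hv (d - 2 * i)).1
    rwa [show i + (d - 2 * i) = d - i by omega] at this
  have heq : (Φ.splitSpace i).map (R ^ (d - 2 * i)) = Φ.splitSpace (d - i) := by
    refine Submodule.eq_of_le_of_finrank_eq hle ?_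
    rw [← h.finrank_splitSpace_sub (by omega), ← LinearMap.range_domRestrict]
    refine LinearMap.finrank_range_of_inj ?_
    rw [← LinearMap.ker_eq_bot, LinearMap.ker_eq_bot']
    exact fun v hv => Subtype.ext (hinj i hi v v.2 hv)
  rw [← heq] at hw
  obtain ⟨v, hv, hvw⟩ := hw
  exact ⟨v, hv, hvw⟩

/-- The subspaces `K_i` consist of the primitive vectors of the raising map. -/
theorem HasEigenvalues.kerSpace_eq (h : Φ.HasEigenvalues (fun i => θ i) (fun i => θs i))
    {R : Module.End 𝕂 V} (hR : ∀ i, ∀ v ∈ Φ.splitSpace i, R v = Φ.A v - θ i • v) {i : ℕ}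
    (hi : 2 * i ≤ d) : Φ.kerSpace i = primitivePart d Φ.splitSpace R i := by
  have hU : ∀ i, ∀ v ∈ Φ.splitSpace i, R v ∈ Φ.splitSpace (i + 1) := fun i v hv => by
    rw [hR i v hv]
    exact h.sub_smul_mem_splitSpace hv
  have hE : (⨆ (j : Fin (d + 1)) (_ : i ≤ (j : ℕ) ∧ (j : ℕ) + i ≤ d), LinearMap.range (Φ.E j)) =
      ⨆ (j : Fin (d + 1)) (_ : (j : ℕ) ∈ Finset.Ico i (i + (d - 2 * i + 1))),
        LinearMap.range (Φ.E j) := by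
    refine iSup_congr fun j => iSup_congr_Prop ?_ fun _ => rfl
    rw [Finset.mem_Ico]
    omega
  have hker : ∀ v ∈ Φ.splitSpace i,
      (v ∈ ⨆ (j : Fin (d + 1)) (_ : i ≤ (j : ℕ) ∧ (j : ℕ) + i ≤ d), LinearMap.range (Φ.E j)) ↔
        v ∈ LinearMap.ker (R ^ (d - 2 * i + 1)) := fun v hv => by
    rw [hE, h.iSup_range_E (fun j hj => by rw [Finset.mem_Ico] at hj; omega), LinearMap.mem_ker,
      LinearMap.mem_ker, (aeval_prod_Ico_eq_pow hR hU hv _).2]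
  ext v
  constructor
  · intro hv
    have hvU : v ∈ Φ.splitSpace i :=
      ⟨hv.1, (iSup₂_mono' fun j hj => ⟨j, hj.1, le_rfl⟩ :
        (⨆ (j : Fin (d + 1)) (_ : i ≤ (j : ℕ) ∧ (j : ℕ) + i ≤ d), LinearMap.range (Φ.E j)) ≤
          ⨆ (j : Fin (d + 1)) (_ : i ≤ (j : ℕ)), LinearMap.range (Φ.E j)) hv.2⟩
    exact ⟨hvU, (hker v hvU).mp hv.2⟩
  · intro hv
    exact ⟨hv.1.1, (hker v hv.1).mpr hv.2⟩

theorem HasEigenvalues.existsUnique_splitOperator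
    (h : Φ.HasEigenvalues (fun i => θ i) (fun i => θs i)) {q : 𝕂} (hq : q ≠ 0) :
    ∃! K : (Module.End 𝕂 V)ˣ, Φ.IsSplitOperator q K := by
  obtain ⟨K, hK⟩ := exists_end_of_iSupIndep h.iSupIndep_splitSpace h.iSup_splitSpace
    fun i => q ^ ((d : ℤ) - 2 * (i : ℤ)) • (1 : Module.End 𝕂 V)
  obtain ⟨K', hK'⟩ := exists_end_of_iSupIndep h.iSupIndep_splitSpace h.iSup_splitSpace
    fun i => q ^ (-((d : ℤ) - 2 * (i : ℤ))) • (1 : Module.End 𝕂 V)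
  refine ⟨⟨K, K', ?_, ?_⟩, fun i _ v hv => by simpa using hK i v hv, fun T hT => ?_⟩
  · refine LinearMap.ext_of_iSup_eq_top h.iSup_splitSpace fun i v hv => ?_
    simp [Module.End.mul_apply, hK' i v hv, hK i v hv, smul_smul, mul_comm, ← zpow_add₀ hq]
  · refine LinearMap.ext_of_iSup_eq_top h.iSup_splitSpace fun i v hv => ?_
    simp [Module.End.mul_apply, hK' i v hv, hK i v hv, smul_smul, ← zpow_add₀ hq]
  · refine Units.ext (LinearMap.ext_of_iSup_eq_top h.iSup_splitSpace fun i v hv => ?_)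
    rcases Nat.lt_or_ge d i with hi | hi
    · rw [Φ.splitSpace_of_lt hi, Submodule.mem_bot] at hv
      simp [hv]
    · rw [hT i hi v hv]
      simpa using (hK i v hv).symm

theorem raising_apply {q a : 𝕂} (hq : q ≠ 0) {K : (Module.End 𝕂 V)ˣ}
    (hK : Φ.IsSplitOperator q K) (i : ℕ) (v : V) (hv : v ∈ Φ.splitSpace i) :
    Φ.raising a K v =
      Φ.A v - (a * q ^ ((d : ℤ) - 2 * (i : ℕ)) + a⁻¹ * q ^ (2 * (i : ℕ) - (d : ℤ))) • v := by
  rcases Nat.lt_or_ge d i with hi | hi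
  · rw [Φ.splitSpace_of_lt hi, Submodule.mem_bot] at hv
    simp [hv]
  · have h1 := hK i hi v hv
    simp only [raising, LinearMap.sub_apply, LinearMap.smul_apply, h1,
      Units.inv_apply_of_apply_eq_smul (zpow_ne_zero _ hq) h1, smul_smul, add_smul, ← zpow_neg,
      neg_sub]
    abel

/-! ### The cyclic spaces `M v` -/

theorem subset_genM (Φ : TDSystem 𝕂 V d) (S : Set V) : S ⊆ Φ.genM S :=
  Submodule.subset_span

theorem apply_mem_genM (Φ : TDSystem 𝕂 V d) {S : Set V} {v : V} (hv : v ∈ Φ.genM S) :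
    Φ.A v ∈ Φ.genM S :=
  Submodule.smul_mem _ (⟨Φ.A, Algebra.subset_adjoin rfl⟩ :
    Algebra.adjoin 𝕂 ({Φ.A} : Set (Module.End 𝕂 V))) hv

/-- `genM S` is the smallest `A`-stable subspace that contains `S`. -/
theorem genM_le (Φ : TDSystem 𝕂 V d) {S : Set V} {X : Submodule 𝕂 V} (hS : S ⊆ X)
    (hX : ∀ v ∈ X, Φ.A v ∈ X) : Φ.genM S ≤ X := by
  have hadj : ∀ T ∈ Algebra.adjoin 𝕂 ({Φ.A} : Set (Module.End 𝕂 V)), ∀ v ∈ X, T v ∈ X := by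
    intro T hT
    induction hT using Algebra.adjoin_induction with
    | mem T hT =>
      rw [Set.mem_singleton_iff.mp hT]
      exact hX
    | algebraMap c =>
      intro v hv
      rw [Module.algebraMap_end_apply]
      exact X.smul_mem c hv
    | add S T _ _ hS hT => exact fun v hv => X.add_mem (hS v hv) (hT v hv)
    | mul S T _ _ hS hT => exact fun v hv => hS _ (hT v hv)
  intro v hv
  have hv' : v ∈ Submodule.span (Algebra.adjoin 𝕂 ({Φ.A} : Set (Module.End 𝕂 V))) S := hv
  induction hv' using Submodule.span_induction with
  | mem x hx => exact hS hx
  | zero => exact X.zero_mem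
  | add x y hx hy ihx ihy => exact X.add_mem (ihx hx) (ihy hy)
  | smul T x hx ih => exact hadj T T.2 x (ih hx)

theorem genM_mono (Φ : TDSystem 𝕂 V d) {S T : Set V} (h : S ⊆ T) : Φ.genM S ≤ Φ.genM T :=
  Φ.genM_le (h.trans (Φ.subset_genM T)) fun _ => Φ.apply_mem_genM

theorem genM_le_iSup (Φ : TDSystem 𝕂 V d) (S : Set V) :
    Φ.genM S ≤ ⨆ x ∈ S, Φ.genM {x} := by
  refine Φ.genM_le (fun x hx => ?_) ?_
  · exact Submodule.mem_iSup_of_mem x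
      (Submodule.mem_iSup_of_mem hx (Φ.subset_genM {x} rfl))
  · suffices (⨆ x ∈ S, Φ.genM {x}) ≤ (⨆ x ∈ S, Φ.genM {x}).comap Φ.A from this
    refine iSup₂_le fun x hx v hv => ?_
    exact Submodule.mem_iSup_of_mem x (Submodule.mem_iSup_of_mem hx (Φ.apply_mem_genM hv))

theorem HasEigenvalues.pow_mem_genM (h : Φ.HasEigenvalues (fun i => θ i) (fun i => θs i))
    {R : Module.End 𝕂 V} (hR : ∀ i, ∀ v ∈ Φ.splitSpace i, R v = Φ.A v - θ i • v)
    {i : ℕ} {x : V} (hx : x ∈ Φ.splitSpace i) (j : ℕ) : (R ^ j) x ∈ Φ.genM {x} := by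
  suffices (R ^ j) x ∈ Φ.splitSpace (i + j) ∧ (R ^ j) x ∈ Φ.genM {x} from this.2
  induction j with
  | zero => exact ⟨hx, Φ.subset_genM {x} rfl⟩
  | succ j ih =>
    rw [pow_succ', Module.End.mul_apply, hR _ _ ih.1]
    exact ⟨h.sub_smul_mem_splitSpace ih.1,
      Submodule.sub_mem _ (Φ.apply_mem_genM ih.2) (Submodule.smul_mem _ _ ih.2)⟩

end TDSystem

/-! ### The strings as `U_q(sl₂)`-submodules -/

namespace Uq

variable {𝕂 V : Type*} [Field 𝕂] {q : 𝕂} [AddCommGroup V] [Module 𝕂 V]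

theorem casimir_smul_of_equiv [Module (Uq q) V] [IsScalarTower 𝕂 (Uq q) V] {hq : q ≠ 0}
    {hq4 : q ^ 4 ≠ 1} {n : ℕ} {W : Submodule (Uq q) V} (e : W ≃ₗ[Uq q] L hq hq4 n 1) {v : V}
    (hv : v ∈ W) : casimir q • v = (q ^ ((n : ℤ) + 1) + q ^ (-(n : ℤ) - 1)) • v := by
  have h1 : casimir q • (⟨v, hv⟩ : W) =
      algebraMap 𝕂 (Uq q) (q ^ ((n : ℤ) + 1) + q ^ (-(n : ℤ) - 1)) • (⟨v, hv⟩ : W) := by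
    apply e.injective
    rw [map_smul, map_smul, casimir_smul_L]
  rw [← algebraMap_smul (Uq q) (q ^ ((n : ℤ) + 1) + q ^ (-(n : ℤ) - 1)) v]
  exact congrArg Subtype.val h1

/-- A linear map out of `L(n, 1)` that commutes with the generators is a module
homomorphism. -/
def homOfGen [Module (Uq q) V] [IsScalarTower 𝕂 (Uq q) V] (hq : q ≠ 0)
    (hq4 : q ^ 4 ≠ 1) {n : ℕ} (φ : (Fin (n + 1) → 𝕂) →ₗ[𝕂] V)
    (h : ∀ x, ∀ i ≤ n, φ (simpleGen q n 1 x (stdVec 𝕂 n i)) = gen q x • φ (stdVec 𝕂 n i)) :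
    L hq hq4 n 1 →ₗ[Uq q] V where
  toFun w := φ w
  map_add' := φ.map_add
  map_smul' u := by
    induction u using induction_on with
    | halg c =>
      intro w
      exact (congrArg φ (L_algebraMap_smul (hq := hq) (hq4 := hq4) (ε := 1) c w)).trans
        ((φ.map_smul c w).trans (algebraMap_smul (Uq q) c (φ w)).symm)
    | hgen x =>
      have : φ ∘ₗ simpleGen q n 1 x = Algebra.lsmul 𝕂 𝕂 V (gen q x) ∘ₗ φ := by
        refine (Pi.basisFun 𝕂 (Fin (n + 1))).ext fun i => ?_
        rw [Pi.basisFun_apply, single_eq_stdVec]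
        exact h x i (by omega)
      exact fun w => (congrArg φ (L_gen_smul hq hq4 n 1 x w)).trans (LinearMap.congr_fun this w)
    | hmul u v hu hv =>
      intro w
      rw [mul_smul, hu, hv, RingHom.id_apply, RingHom.id_apply, RingHom.id_apply, mul_smul]
    | hadd u v hu hv =>
      intro w
      have h1 : φ ((u + v) • w : L hq hq4 n 1) = φ (u • w : L hq hq4 n 1) +
        φ (v • w : L hq hq4 n 1) := by
        rw [add_smul]
        exact φ.map_add _ _
      rw [h1, hu, hv, RingHom.id_apply, RingHom.id_apply, RingHom.id_apply, add_smul]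

end Uq

section Strings

variable {𝕂 V : Type*} [Field 𝕂] [AddCommGroup V] [Module 𝕂 V]
  {d : ℕ} {U : ℕ → Submodule 𝕂 V} {R : Module.End 𝕂 V} {q : 𝕂}
  {K : (Module.End 𝕂 V)ˣ} {ψ : Module.End 𝕂 V}

open Uq in
/-- The map `L(d-2i, 1) → V` that sends the highest weight vector to a given primitive vector
`x`: the `j`-th basis vector goes to `f^j x / [j]_q!`, that is, to `R^j x` divided by
`∏ (q^{m+1} - q^{-m-1})` over `m < j`. -/
theorem IsLefschetz.exists_hom (h : IsLefschetz d U R) (hq : q ≠ 0) (hq4 : q ^ 4 ≠ 1)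
    (hqd : ∀ j, 1 ≤ j → j ≤ d → q ^ (2 * j) ≠ 1)
    (hK : ∀ i ≤ d, ∀ v ∈ U i, (K : Module.End 𝕂 V) v = q ^ ((d : ℤ) - 2 * (i : ℤ)) • v)
    (hψ : IsLoweringOperator d U R q K ψ)
    [Module (Uq q) V] [IsScalarTower 𝕂 (Uq q) V] (hact : ActsBy q ψ R K)
    {i : ℕ} (hi : 2 * i ≤ d) {x : V} (hx : x ∈ primitivePart d U R i) :
    ∃ φ : L hq hq4 (d - 2 * i) 1 →ₗ[Uq q] V,
      φ (show L hq hq4 (d - 2 * i) 1 from stdVec 𝕂 (d - 2 * i) 0) = x ∧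
      ∀ w, φ w ∈ Submodule.span 𝕂 (Set.range fun j : ℕ => (R ^ j) x) := by
  have h0 := sub_inv_ne_zero hq hq4
  set n := d - 2 * i with hn
  have hnd : (d : ℤ) - 2 * i = n := by omega
  let s : ℕ → 𝕂 := fun j => ∏ m ∈ Finset.range j, ((q - q⁻¹) * qInt q ((m : ℤ) + 1))
  have hint : ∀ j : ℕ, j < n → qInt q ((j : ℤ) + 1) ≠ 0 := fun j hj => by
    exact_mod_cast qInt_ne_zero hq hq4 (hqd (j + 1) (by omega) (by omega))
  have hs : ∀ j, j ≤ n → s j ≠ 0 := fun j hj => by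
    refine Finset.prod_ne_zero_iff.mpr fun m hm => mul_ne_zero h0 (hint m ?_)
    rw [Finset.mem_range] at hm
    omega
  have hs1 : ∀ j, s (j + 1) = s j * ((q - q⁻¹) * qInt q ((j : ℤ) + 1)) := fun j =>
    Finset.prod_range_succ _ _
  let φ : (Fin (n + 1) → 𝕂) →ₗ[𝕂] V :=
    (Pi.basisFun 𝕂 (Fin (n + 1))).constr 𝕂 fun j => (s j)⁻¹ • (R ^ (j : ℕ)) x
  have hφ : ∀ j, j ≤ n → φ (stdVec 𝕂 n j) = (s j)⁻¹ • (R ^ j) x := fun j hj => by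
    have := (Pi.basisFun 𝕂 (Fin (n + 1))).constr_basis 𝕂
      (fun j => (s j)⁻¹ • (R ^ (j : ℕ)) x) ⟨j, by omega⟩
    rwa [Pi.basisFun_apply, single_eq_stdVec] at this
  have hgen : ∀ y, ∀ j ≤ n,
      φ (simpleGen q n 1 y (stdVec 𝕂 n j)) = gen q y • φ (stdVec 𝕂 n j) := by
    intro y j hj
    cases y with
    | e =>
      rw [(hact _).1, hφ j hj, map_smul]
      cases j with
      | zero => simp [simpleGen_e_zero, hψ.primitive i hi x hx]
      | succ j =>
        rw [simpleGen_e_succ q n 1 hj, map_smul, hφ j (by omega),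
          h.lowering_string hq hK hψ hi (by omega) hx, smul_smul, smul_smul, smul_smul, hs1, hnd]
        congr 1
        have h1 := hs j (by omega)
        have h2 := hint j (by omega)
        have h3 : stringCoeff q n ((j : ℤ) + 1) =
            (q - q⁻¹) ^ 2 * qInt q ((j : ℤ) + 1) * qInt q ((n : ℤ) - j) := by
          simp only [stringCoeff, qInt, add_sub_add_right_eq_sub]
          rw [div_eq_mul_inv, div_eq_mul_inv]
          linear_combination (-(q ^ ((j : ℤ) + 1) - q ^ (-((j : ℤ) + 1))) *
            (q ^ ((n : ℤ) - j) - q ^ (-((n : ℤ) - j))) *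
            ((q - q⁻¹) * (q - q⁻¹)⁻¹ + 1)) * mul_inv_cancel₀ h0
        generalize q - q⁻¹ = t at *
        rw [h3]
        field_simp
        simp
    | f =>
      rw [(hact _).2.1, hφ j hj, map_smul, simpleGen_f q n 1 hj, map_smul,
        ← Module.End.mul_apply, ← pow_succ']
      rcases hj.lt_or_eq with hj' | rfl
      · rw [hφ (j + 1) hj', smul_smul, smul_smul, hs1]
        congr 1
        have h1 := hs j hj
        have h2 := hint j hj'
        generalize q - q⁻¹ = t at *
        field_simp
      · rw [stdVec_of_lt 𝕂 (Nat.lt_succ_self _), IsLefschetz.pow_primitive_eq_zero hx (by omega)]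
        simp
    | k =>
      rw [(hact _).2.2.1, hφ j hj, map_smul, simpleGen_k q n 1 hj, map_smul, hφ j hj,
        h.K_string hK hi hj hx, hnd, smul_comm]
      simp
    | kinv =>
      rw [(hact _).2.2.2, hφ j hj, map_smul, simpleGen_kinv q n 1 hj, map_smul, hφ j hj,
        h.Kinv_string hq hK hi hj hx, hnd, smul_comm]
      simp
  refine ⟨homOfGen hq hq4 φ hgen, ?_, fun w => ?_⟩
  · exact (hφ 0 (Nat.zero_le _)).trans (by simp [s])
  · change φ (show Fin (n + 1) → 𝕂 from w) ∈ _
    rw [eq_sum_stdVec (show Fin (n + 1) → 𝕂 from w), map_sum]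
    refine Submodule.sum_mem _ fun j _ => ?_
    rw [map_smul, hφ j (by omega)]
    exact Submodule.smul_mem _ _ (Submodule.smul_mem _ _ (Submodule.subset_span ⟨j, rfl⟩))

end Strings

namespace TDSystem

variable {𝕂 V : Type*} [Field 𝕂] [AddCommGroup V] [Module 𝕂 V] {d : ℕ}
  {Φ : TDSystem 𝕂 V d} {θ θs : ℕ → 𝕂} {q a : 𝕂} {K : (Module.End 𝕂 V)ˣ}

/-- A submodule for an action in which `f`, `k` come from the raising map and the split operator
is stable under `A = R + a K + a⁻¹ K⁻¹`. -/
theorem apply_mem_of_actsBy (hq : q ≠ 0) (hq4 : q ^ 4 ≠ 1) {ψ : Module.End 𝕂 V}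
    [Module (Uq q) V] [IsScalarTower 𝕂 (Uq q) V] (hact : Uq.ActsBy q ψ (Φ.raising a K) K)
    (W : Submodule (Uq q) V) {v : V} (hv : v ∈ W) : Φ.A v ∈ W := by
  have h0 := Uq.sub_inv_ne_zero hq hq4
  have : Φ.A v = ((q - q⁻¹) • Uq.gen q .f + a • Uq.gen q .k + a⁻¹ • Uq.gen q .kinv) • v := by
    simp only [add_smul, smul_assoc, (hact v).2.1, (hact v).2.2.1, (hact v).2.2.2]
    rw [smul_smul, mul_inv_cancel₀ h0, one_smul]
    simp only [raising, LinearMap.sub_apply, LinearMap.smul_apply]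
    abel
  rw [this]
  exact W.smul_mem _ hv

end TDSystem

/-! ### Semisimplicity, isotypic components and the Casimir element -/

namespace TDSystem

variable {𝕂 V : Type*} [Field 𝕂] [AddCommGroup V] [Module 𝕂 V] {d : ℕ}
  {Φ : TDSystem 𝕂 V d} {θs : ℕ → 𝕂} {q a : 𝕂} {K : (Module.End 𝕂 V)ˣ}

/-- The eigenvalues of `q`-Racah type. -/
def qRacah (q a : 𝕂) (d i : ℕ) : 𝕂 :=
  a * q ^ ((d : ℤ) - 2 * (i : ℕ)) + a⁻¹ * q ^ (2 * (i : ℕ) - (d : ℤ))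

theorem qRacah_inv (q a : 𝕂) {d i : ℕ} (hi : i ≤ d) :
    qRacah q a⁻¹ d i = qRacah q a d (d - i) := by
  simp only [qRacah, inv_inv, Nat.cast_sub hi]
  rw [show (d : ℤ) - 2 * ((d : ℤ) - i) = 2 * i - d by ring,
    show 2 * ((d : ℤ) - i) - d = d - 2 * i by ring, add_comm]

/-- The eigenvalues `θ_0` and `θ_j` are distinct, so `q^{2j} ≠ 1`. -/
theorem HasEigenvalues.pow_ne_one (hq : q ≠ 0)
    (h : Φ.HasEigenvalues (fun i => qRacah q a d i) (fun i => θs i)) {j : ℕ} (h1 : 1 ≤ j)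
    (hj : j ≤ d) : q ^ (2 * j) ≠ 1 := by
  intro hqj
  have hz : q ^ (2 * (j : ℤ)) = 1 := by exact_mod_cast hqj
  have h0 : (0 : ℕ) = j := by
    refine h.injOn (by simp) (by simpa using hj) ?_
    simp only [qRacah, zpow_sub₀ hq, hz]
    simp
  omega

/-- The scalars by which the Casimir element acts on the modules `L(d-2i, 1)` are distinct. -/
theorem casimir_eigenvalue_injective (hq : q ≠ 0)
    (hqd : ∀ j, 1 ≤ j → j ≤ d → q ^ (2 * j) ≠ 1) :
    Function.Injective fun i : {i : ℕ // 2 * i ≤ d} =>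
      q ^ ((d : ℤ) - 2 * (i : ℕ) + 1) + q ^ (2 * (i : ℕ) - (d : ℤ) - 1) := by
  have key : ∀ i j : ℕ, i < j → 2 * j ≤ d →
      q ^ ((d : ℤ) - 2 * i + 1) + q ^ (2 * i - (d : ℤ) - 1) ≠
        q ^ ((d : ℤ) - 2 * j + 1) + q ^ (2 * j - (d : ℤ) - 1) := by
    intro i j hij hj he
    set y := q ^ ((d : ℤ) - 2 * j + 1) with hy
    have hy0 : y ≠ 0 := zpow_ne_zero _ hq
    have hq1 := hqd (j - i) (by omega) (by omega)
    have hq2 := hqd (d + 1 - i - j) (by omega) (by omega)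
    have e1 : q ^ ((d : ℤ) - 2 * i + 1) = q ^ (2 * (j - i)) * y := by
      rw [hy, ← zpow_natCast, ← zpow_add₀ hq]
      congr 1
      omega
    have e2 : q ^ (2 * i - (d : ℤ) - 1) = (q ^ (2 * (j - i)) * y)⁻¹ := by
      rw [← e1, ← zpow_neg]
      congr 1
      ring
    have e3 : q ^ (2 * j - (d : ℤ) - 1) = y⁻¹ := by
      rw [hy, ← zpow_neg]
      congr 1
      ring
    have e4 : q ^ (2 * (d + 1 - i - j)) = q ^ (2 * (j - i)) * y * y := by
      rw [hy, mul_assoc, ← zpow_natCast, ← zpow_natCast, ← zpow_add₀ hq, ← zpow_add₀ hq]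
      congr 1
      omega
    rw [e1, e2, e3] at he
    rw [e4] at hq2
    have ht0 : q ^ (2 * (j - i)) ≠ 0 := pow_ne_zero _ hq
    generalize q ^ (2 * (j - i)) = t at *
    -- `t y + 1 / (t y) = y + 1 / y` means `(t - 1) (t y² - 1) = 0`.
    have hprod : (t - 1) * (t * y * y - 1) = 0 := by
      field_simp at he
      linear_combination he
    rcases mul_eq_zero.mp hprod with h | h
    · exact hq1 (sub_eq_zero.mp h)
    · exact hq2 (sub_eq_zero.mp h)
  rintro ⟨i, hi⟩ ⟨j, hj⟩ he
  rcases lt_trichotomy i j with h | h | h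
  · exact absurd he (key i j h hj)
  · exact Subtype.ext h
  · exact absurd he.symm (key j i h hi)

/-- The subspaces `K_i` being the primitive vectors, `ψ` is the lowering operator attached to
`R` and `K`. -/
theorem isPsi_iff_isLoweringOperator
    (h : Φ.HasEigenvalues (fun i => qRacah q a d i) (fun i => θs i)) (hq : q ≠ 0)
    (hK : Φ.IsSplitOperator q K) (ψ : Module.End 𝕂 V) :
    Φ.IsPsi q a K ψ ↔ IsLoweringOperator d Φ.splitSpace (Φ.raising a K) q K ψ := by
  have hR := raising_apply (a := a) hq hK
  constructor
  · rintro ⟨h1, h2⟩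
    refine ⟨h1, fun i hi x hx => h2 i hi x ?_⟩
    rwa [HasEigenvalues.kerSpace_eq (θ := qRacah q a d) h hR hi]
  · rintro ⟨h1, h2⟩
    refine ⟨h1, fun i hi x hx => h2 i hi x ?_⟩
    rwa [← HasEigenvalues.kerSpace_eq (θ := qRacah q a d) h hR hi]

theorem HasEigenvalues.isLefschetz_raising [FiniteDimensional 𝕂 V]
    (h : Φ.HasEigenvalues (fun i => qRacah q a d i) (fun i => θs i)) (hq : q ≠ 0)
    (hK : Φ.IsSplitOperator q K) : IsLefschetz d Φ.splitSpace (Φ.raising a K) :=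
  HasEigenvalues.isLefschetz (θ := qRacah q a d) h (raising_apply hq hK)

theorem HasEigenvalues.existsUnique_isPsi [FiniteDimensional 𝕂 V]
    (h : Φ.HasEigenvalues (fun i => qRacah q a d i) (fun i => θs i)) (hq : q ≠ 0)
    (hK : Φ.IsSplitOperator q K) : ∃! ψ, Φ.IsPsi q a K ψ := by
  simp only [isPsi_iff_isLoweringOperator h hq hK]
  exact (h.isLefschetz_raising hq hK).existsUnique_lowering hq hK

/-- For `0 ≠ x ∈ K_i` the space `M x` is a submodule isomorphic to `L(d-2i, 1)`. -/
theorem exists_submodule_genM [FiniteDimensional 𝕂 V]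
    (h : Φ.HasEigenvalues (fun i => qRacah q a d i) (fun i => θs i)) (hq : q ≠ 0)
    (hq4 : q ^ 4 ≠ 1) (hK : Φ.IsSplitOperator q K) {ψ : Module.End 𝕂 V}
    (hψ : Φ.IsPsi q a K ψ) [Module (Uq q) V] [IsScalarTower 𝕂 (Uq q) V]
    (hact : Uq.ActsBy q ψ (Φ.raising a K) K) {i : ℕ} (hi : 2 * i ≤ d) {x : V}
    (hx : x ∈ Φ.kerSpace i) (hx0 : x ≠ 0) :
    ∃ W : Submodule (Uq q) V, W.restrictScalars 𝕂 = Φ.genM {x} ∧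
      IsSimpleModule (Uq q) W ∧ Nonempty (W ≃ₗ[Uq q] Uq.L hq hq4 (d - 2 * i) 1) := by
  have hR := raising_apply (a := a) hq hK
  have hL := h.isLefschetz_raising hq hK
  rw [HasEigenvalues.kerSpace_eq (θ := qRacah q a d) h hR hi] at hx
  obtain ⟨φ, hφ, hspan⟩ := hL.exists_hom hq hq4 (fun _ => h.pow_ne_one hq) hK
    ((isPsi_iff_isLoweringOperator h hq hK ψ).mp hψ) hact hi hx
  have hsimple : IsSimpleModule (Uq q) (Uq.L hq hq4 (d - 2 * i) 1) :=
    Uq.isSimpleModule_L hq hq4 fun j h1 hj => h.pow_ne_one hq h1 (by omega)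
  have hinj : Function.Injective φ := by
    rcases LinearMap.injective_or_eq_zero φ with h1 | h1
    · exact h1
    · rw [h1] at hφ
      exact absurd hφ.symm hx0
  let e := LinearEquiv.ofInjective φ hinj
  refine ⟨LinearMap.range φ, le_antisymm ?_ ?_, .congr e.symm, ⟨e.symm⟩⟩
  · rintro _ ⟨w, rfl⟩
    refine Submodule.span_le.mpr ?_ (hspan w)
    rintro _ ⟨j, rfl⟩
    exact HasEigenvalues.pow_mem_genM (θ := qRacah q a d) h hR hx.1 j
  · refine Φ.genM_le ?_ fun v hv => apply_mem_of_actsBy hq hq4 hact _ hv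
    rintro _ rfl
    exact ⟨_, hφ⟩

/-- The statements about the `U_q(sl₂)`-action of `ψ`, `R`, `K` on `V`. -/
theorem exists_action [FiniteDimensional 𝕂 V]
    (h : Φ.HasEigenvalues (fun i => qRacah q a d i) (fun i => θs i)) (hq : q ≠ 0)
    (hq4 : q ^ 4 ≠ 1) (hK : Φ.IsSplitOperator q K) {ψ : Module.End 𝕂 V}
    (hψ : Φ.IsPsi q a K ψ) :
    ∃ (_ : Module (Uq q) V) (_ : IsScalarTower 𝕂 (Uq q) V),
      Uq.ActsBy q ψ (Φ.raising a K) K ∧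
      IsSemisimpleModule (Uq q) V ∧
      (∀ W : Submodule (Uq q) V, IsSimpleModule (Uq q) W →
        ∃ i : ℕ, 2 * i ≤ d ∧ Nonempty (W ≃ₗ[Uq q] Uq.L hq hq4 (d - 2 * i) 1)) ∧
      ∀ i : ℕ, 2 * i ≤ d →
        (∀ v ∈ Φ.kerSpace i, v ≠ 0 →
          ∃ W : Submodule (Uq q) V, W.restrictScalars 𝕂 = Φ.genM {v} ∧
            IsSimpleModule (Uq q) W ∧
            Nonempty (W ≃ₗ[Uq q] Uq.L hq hq4 (d - 2 * i) 1)) ∧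
        (isotypicComponent (Uq q) V (Uq.L hq hq4 (d - 2 * i) 1)).restrictScalars 𝕂 =
          Φ.genM (Φ.kerSpace i) ∧
        ∀ v : V, v ∈ Φ.genM (Φ.kerSpace i) ↔
          Uq.casimir q • v =
            (q ^ ((d : ℤ) - 2 * i + 1) + q ^ (2 * i - (d : ℤ) - 1)) • v := by
  have hR := raising_apply (a := a) hq hK
  have hL := h.isLefschetz_raising hq hK
  have hlow := (isPsi_iff_isLoweringOperator h hq hK ψ).mp hψ
  obtain ⟨_, _, hact⟩ := Uq.exists_module hq hq4 (hL.K_mul_lowering hq hK hlow)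
    (hL.K_mul_R hq hK) hlow.comm
  have hstr : ∀ i, 2 * i ≤ d → ∀ x ∈ Φ.kerSpace i, x ≠ 0 → ∃ W : Submodule (Uq q) V,
      W.restrictScalars 𝕂 = Φ.genM {x} ∧ IsSimpleModule (Uq q) W ∧
        Nonempty (W ≃ₗ[Uq q] Uq.L hq hq4 (d - 2 * i) 1) :=
    fun i hi x hx hx0 => exists_submodule_genM h hq hq4 hK hψ hact hi hx hx0
  have hpow : ∀ p : StringIndex d, ∀ x ∈ primitivePart d Φ.splitSpace (Φ.raising a K) p.1.1,
      x ∈ Φ.kerSpace p.1.1 ∧ (Φ.raising a K ^ p.1.2) x ∈ Φ.genM {x} := fun p x hx =>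
    ⟨by rwa [HasEigenvalues.kerSpace_eq (θ := qRacah q a d) h hR p.2.1],
      HasEigenvalues.pow_mem_genM (θ := qRacah q a d) h hR hx.1 _⟩
  -- The simple submodules `M x`, with `x` in some `K_i`, span `V`.
  let S : Set (Submodule (Uq q) V) := {W | IsSimpleModule (Uq q) W ∧
    ∃ i, 2 * i ≤ d ∧ Nonempty (W ≃ₗ[Uq q] Uq.L hq hq4 (d - 2 * i) 1)}
  have hS : sSup S = ⊤ := by
    have : (⊤ : Submodule 𝕂 V) ≤ (sSup S).restrictScalars 𝕂 := by
      rw [← hL.iSup_stringSpace]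
      refine iSup_le fun p => ?_
      rintro _ ⟨x, hx, rfl⟩
      by_cases hx0 : x = 0
      · simp [hx0]
      obtain ⟨W, hW, hWs, hWL⟩ := hstr p.1.1 p.2.1 x (hpow p x hx).1 hx0
      have hxW : (Φ.raising a K ^ p.1.2) x ∈ W.restrictScalars 𝕂 := hW ▸ (hpow p x hx).2
      exact (le_sSup (show W ∈ S from ⟨hWs, p.1.1, p.2.1, hWL⟩) : W ≤ sSup S) hxW
    exact eq_top_iff.mpr fun v _ => this Submodule.mem_top
  have hSs : ∀ W : S, IsSimpleModule (Uq q) W := fun W => W.2.1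
  have hss : IsSemisimpleModule (Uq q) V :=
    .of_sSup_simples_eq_top (top_le_iff.mp (hS ▸ sSup_le_sSup fun W hW => hW.1))
  -- The spaces `M K_i` are eigenspaces of the Casimir element.
  let c : {i : ℕ // 2 * i ≤ d} → 𝕂 := fun i =>
    q ^ ((d : ℤ) - 2 * (i : ℕ) + 1) + q ^ (2 * (i : ℕ) - (d : ℤ) - 1)
  have hcas : ∀ i : {i : ℕ // 2 * i ≤ d}, ∀ W : Submodule (Uq q) V,
      Nonempty (W ≃ₗ[Uq q] Uq.L hq hq4 (d - 2 * i) 1) → ∀ v ∈ W,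
        Uq.casimir q • v = c i • v := by
    rintro ⟨i, hi⟩ W ⟨e⟩ v hv
    rw [Uq.casimir_smul_of_equiv e hv, Nat.cast_sub hi]
    simp only [c]
    congr 3
    push_cast
    ring
  have hle : ∀ i : {i : ℕ // 2 * i ≤ d}, Φ.genM (Φ.kerSpace i) ≤
      Module.End.eigenspace (Algebra.lsmul 𝕂 𝕂 V (Uq.casimir q)) (c i) := by
    intro i
    refine (Φ.genM_le_iSup _).trans (iSup₂_le fun x hx v hv => ?_)
    rw [Module.End.mem_eigenspace_iff, Algebra.lsmul_coe]
    by_cases hx0 : x = 0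
    · have hv0 : v ∈ (⊥ : Submodule 𝕂 V) :=
        Φ.genM_le (by simp [hx0]) (by simp) hv
      rw [Submodule.mem_bot] at hv0
      simp [hv0]
    · obtain ⟨W, hW, -, hWL⟩ := hstr i i.2 x hx hx0
      exact hcas i W hWL v (show v ∈ W.restrictScalars 𝕂 from hW ▸ hv)
  have htop : ⨆ i : {i : ℕ // 2 * i ≤ d}, Φ.genM (Φ.kerSpace i) = ⊤ := by
    rw [eq_top_iff, ← hL.iSup_stringSpace]
    refine iSup_le fun p => le_iSup_of_le ⟨p.1.1, p.2.1⟩ ?_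
    rintro _ ⟨x, hx, rfl⟩
    exact Φ.genM_mono (Set.singleton_subset_iff.mpr (hpow p x hx).1) (hpow p x hx).2
  have heig : ∀ i : {i : ℕ // 2 * i ≤ d}, ∀ v,
      v ∈ Φ.genM (Φ.kerSpace i) ↔ Uq.casimir q • v = c i • v := by
    intro i v
    have := Module.End.eigenspace_le_of_iSup_eq_top
      (casimir_eigenvalue_injective hq fun _ => h.pow_ne_one hq) htop hle i
    refine ⟨fun hv => ?_, fun hv => this ?_⟩
    · simpa [Module.End.mem_eigenspace_iff] using hle i hv
    · simpa [Module.End.mem_eigenspace_iff] using hv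
  refine ⟨inferInstance, inferInstance, hact, hss, fun W hW => ?_, fun i hi =>
    ⟨hstr i hi, le_antisymm ?_ ?_, heig ⟨i, hi⟩⟩⟩
  · obtain ⟨W', ⟨-, i, hi, ⟨e'⟩⟩, ⟨e⟩⟩ := Submodule.linearEquiv_of_sSup_eq_top W S hS
    exact ⟨i, hi, ⟨e.trans e'⟩⟩
  · intro v hv
    change v ∈ sSup {m : Submodule (Uq q) V |
      Nonempty (m ≃ₗ[Uq q] Uq.L hq hq4 (d - 2 * i) 1)} at hv
    rw [sSup_eq_iSup'] at hv
    induction hv using Submodule.iSup_induction' with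
    | mem W v hv => exact (heig ⟨i, hi⟩ v).mpr (hcas ⟨i, hi⟩ W W.2 v hv)
    | zero => exact Submodule.zero_mem _
    | add x y hx hy ihx ihy => exact Submodule.add_mem _ ihx ihy
  · refine (Φ.genM_le_iSup _).trans (iSup₂_le fun x hx v hv => ?_)
    by_cases hx0 : x = 0
    · have hv0 : v ∈ (⊥ : Submodule 𝕂 V) :=
        Φ.genM_le (by simp [hx0]) (by simp) hv
      rw [Submodule.mem_bot] at hv0
      simp [hv0]
    · obtain ⟨W, hW, -, hWL⟩ := hstr i hi x hx hx0
      have hvW : v ∈ W := show v ∈ W.restrictScalars 𝕂 from hW ▸ hv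
      exact (le_sSup hWL : W ≤ isotypicComponent (Uq q) V _) hvW

end TDSystem

/-! ### The lowering operator of the second inversion -/

section TwistedCartan

variable {𝕂 E : Type*} [Field 𝕂] [Ring E] [Algebra 𝕂 E]

theorem Units.inv_mul_of_mul_eq_smul {K : Eˣ} {x : E} {c : 𝕂} (hc : c ≠ 0)
    (h : (K : E) * x = c • (x * (K : E))) :
    ((K⁻¹ : Eˣ) : E) * x = c⁻¹ • (x * ((K⁻¹ : Eˣ) : E)) := by
  have h1 : x * ((K⁻¹ : Eˣ) : E) = c • (((K⁻¹ : Eˣ) : E) * x) := by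
    calc x * ((K⁻¹ : Eˣ) : E)
        = ((K⁻¹ : Eˣ) : E) * ((K : E) * x) * ((K⁻¹ : Eˣ) : E) := by rw [Units.inv_mul_cancel_left]
      _ = c • (((K⁻¹ : Eˣ) : E) * x) := by
        rw [h, mul_smul_comm, smul_mul_assoc, ← mul_assoc, Units.mul_inv_cancel_right]
  rw [h1, smul_smul, inv_mul_cancel₀ hc, one_smul]

/-- Bundled relations between `ψ`, `A` and `K`, where the raising map is
`R = A - a K - a⁻¹ K⁻¹`, together with the two invertible elements `N = 1 - a q ψ` and
`N' = 1 - a⁻¹ q ψ`. -/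
structure TwistData (q a : 𝕂) (ψ A : E) (K N N' : Eˣ) : Prop where
  K_psi : (K : E) * ψ = q ^ 2 • (ψ * (K : E))
  K_A : q • ((K : E) * A) - q⁻¹ • (A * (K : E)) =
    (q - q⁻¹) • (a • ((K : E) * (K : E)) + a⁻¹ • 1)
  psi_A : ψ * A - A * ψ = (q - q⁻¹) • ((N : E) * (K : E) - ((K⁻¹ : Eˣ) : E) * (N' : E))
  N_eq : (N : E) = 1 - (a * q) • ψ
  N'_eq : (N' : E) = 1 - (a⁻¹ * q) • ψ

/-- The relations for `A` in terms of the raising map. -/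
theorem TwistData.of_raising {q a : 𝕂} (hq : q ≠ 0) (ha : a ≠ 0) {ψ A R : E} {K N N' : Eˣ}
    (hR : R = A - a • (K : E) - a⁻¹ • ((K⁻¹ : Eˣ) : E))
    (hKψ : (K : E) * ψ = q ^ 2 • (ψ * (K : E)))
    (hKR : (K : E) * R = (q ^ 2)⁻¹ • (R * (K : E)))
    (hψR : ψ * R - R * ψ = (q - q⁻¹) • ((K : E) - ((K⁻¹ : Eˣ) : E)))
    (hN : (N : E) = 1 - (a * q) • ψ) (hN' : (N' : E) = 1 - (a⁻¹ * q) • ψ) :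
    TwistData q a ψ A K N N' := by
  have hKi := Units.inv_mul_of_mul_eq_smul (pow_ne_zero 2 hq) hKψ
  refine ⟨hKψ, ?_, ?_, hN, hN'⟩
  · simp only [hR, mul_sub, sub_mul, mul_smul_comm, smul_mul_assoc, Units.mul_inv,
      Units.inv_mul] at hKR
    have h2 : (K : E) * A = (q ^ 2)⁻¹ • (A * (K : E) - a • ((K : E) * (K : E)) - a⁻¹ • 1) +
        a • ((K : E) * (K : E)) + a⁻¹ • 1 := by
      rw [← hKR]
      abel
    rw [h2]
    match_scalars <;> field_simp <;> ring
  · simp only [hR, mul_sub, sub_mul, mul_smul_comm, smul_mul_assoc, hKψ, hKi] at hψR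
    have h2 : ψ * A = A * ψ + (q - q⁻¹) • ((K : E) - ((K⁻¹ : Eˣ) : E)) +
        a • (ψ * (K : E)) + a⁻¹ • (ψ * ((K⁻¹ : Eˣ) : E)) - a • q ^ 2 • (ψ * (K : E)) -
        a⁻¹ • (q ^ 2)⁻¹ • (ψ * ((K⁻¹ : Eˣ) : E)) := by
      rw [← hψR]
      abel
    rw [h2, hN, hN', sub_mul, mul_sub, one_mul, mul_one, smul_mul_assoc, mul_smul_comm, hKi]
    match_scalars <;> field_simp <;> ring

variable {q a : 𝕂} {ψ A : E} {K N N' : Eˣ}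

namespace TwistData

theorem commute_N (h : TwistData q a ψ A K N N') : Commute (N : E) ψ := by
  rw [h.N_eq]
  exact (Commute.one_left ψ).sub_left ((Commute.refl ψ).smul_left _)

theorem commute_N' (h : TwistData q a ψ A K N N') : Commute (N' : E) ψ := by
  rw [h.N'_eq]
  exact (Commute.one_left ψ).sub_left ((Commute.refl ψ).smul_left _)

theorem commute_N_N' (h : TwistData q a ψ A K N N') : Commute (N : E) (N' : E) := by
  rw [h.N'_eq]
  exact (Commute.one_right _).sub_right (h.commute_N.smul_right _)

theorem N'_mul (N' : Eˣ) (x y : Eˣ) : (N' : E) * ((N'⁻¹ * x * y : Eˣ) : E) = (x : E) * (y : E) := by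
  simp [mul_assoc]

theorem B_psi (h : TwistData q a ψ A K N N') :
    ((N'⁻¹ * N * K : Eˣ) : E) * ψ = q ^ 2 • (ψ * ((N'⁻¹ * N * K : Eˣ) : E)) := by
  have h1 : ((N'⁻¹ : Eˣ) : E) * ψ = ψ * ((N'⁻¹ : Eˣ) : E) := h.commute_N'.units_inv_left
  have h2 : (N : E) * ψ = ψ * (N : E) := h.commute_N
  simp only [Units.val_mul]
  rw [mul_assoc, h.K_psi, mul_smul_comm, ← mul_assoc, mul_assoc _ (N : E) ψ, h2, ← mul_assoc,
    h1]
  simp only [mul_assoc]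

theorem Binv_mul_N (h : TwistData q a ψ A K N N') :
    (((N'⁻¹ * N * K)⁻¹ : Eˣ) : E) * (N : E) = ((K⁻¹ : Eˣ) : E) * (N' : E) := by
  have h1 : (N' : E) * (N : E) = (N : E) * (N' : E) := h.commute_N_N'.symm
  simp only [mul_inv_rev, inv_inv, Units.val_mul]
  rw [mul_assoc, mul_assoc, h1, Units.inv_mul_cancel_left]

/-- `ψ` satisfies the same commutation rule for `B = N'⁻¹ N K` and `a⁻¹` as for `K` and `a`. -/
theorem psi_comm (h : TwistData q a ψ A K N N') (hq : q ≠ 0) (ha : a ≠ 0) {B : Eˣ}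
    (hB : B = N'⁻¹ * N * K) :
    ψ * (A - a⁻¹ • (B : E) - a • ((B⁻¹ : Eˣ) : E)) -
      (A - a⁻¹ • (B : E) - a • ((B⁻¹ : Eˣ) : E)) * ψ =
        (q - q⁻¹) • ((B : E) - ((B⁻¹ : Eˣ) : E)) := by
  have hBψ : (B : E) * ψ = q ^ 2 • (ψ * (B : E)) := hB ▸ h.B_psi
  have hBi := Units.inv_mul_of_mul_eq_smul (pow_ne_zero 2 hq) hBψ
  have hC : (N : E) * (K : E) = (B : E) - (a⁻¹ * q) • (ψ * (B : E)) := by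
    rw [← N'_mul N' N K, ← hB, h.N'_eq, sub_mul, one_mul, smul_mul_assoc]
  have hD : ((K⁻¹ : Eˣ) : E) * (N' : E) =
      ((B⁻¹ : Eˣ) : E) - (a * q) • (q ^ 2)⁻¹ • (ψ * ((B⁻¹ : Eˣ) : E)) := by
    rw [← h.Binv_mul_N, ← hB, h.N_eq, mul_sub, mul_one, mul_smul_comm, hBi]
  have h2 : ψ * A = A * ψ + (q - q⁻¹) • ((N : E) * (K : E) - ((K⁻¹ : Eˣ) : E) * (N' : E)) := by
    rw [← h.psi_A]
    abel
  simp only [mul_sub, sub_mul, mul_smul_comm, smul_mul_assoc, hBψ, hBi]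
  rw [h2, hC, hD]
  match_scalars <;> field_simp <;> ring

/-- `A` and `B = N'⁻¹ N K` satisfy the `q`-Weyl type relation of `A` and `K`, with `a` replaced
by `a⁻¹`. -/
theorem B_A (h : TwistData q a ψ A K N N') (hq : q ≠ 0) (ha : a ≠ 0) {B : Eˣ}
    (hB : B = N'⁻¹ * N * K) :
    q • ((B : E) * A) - q⁻¹ • (A * (B : E)) =
      (q - q⁻¹) • (a⁻¹ • ((B : E) * (B : E)) + a • 1) := by
  have hKi := Units.inv_mul_of_mul_eq_smul (pow_ne_zero 2 hq) h.K_psi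
  set C : E := (N : E) * (K : E) with hC
  set D : E := ((K⁻¹ : Eˣ) : E) * (N' : E) with hD
  have hNB : (N' : E) * (B : E) = C := by rw [hB, N'_mul]
  have hDK : D * (K : E) = 1 - (a⁻¹ * q⁻¹) • ψ := by
    rw [hD, h.N'_eq, mul_sub, mul_one, mul_smul_comm, hKi, sub_mul, Units.inv_mul,
      smul_mul_assoc, smul_mul_assoc, mul_assoc, Units.inv_mul, mul_one]
    match_scalars <;> field_simp
  have hDB : D * (B : E) = 1 - (a * q⁻¹) • ψ := by
    rw [hD, mul_assoc, hNB, hC, h.N_eq, sub_mul, one_mul, mul_sub, Units.inv_mul,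
      smul_mul_assoc, mul_smul_comm, ← mul_assoc, hKi, smul_mul_assoc, mul_assoc, Units.inv_mul,
      mul_one]
    match_scalars <;> field_simp
  have hψA : ψ * A = A * ψ + (q - q⁻¹) • (C - D) := by
    rw [← h.psi_A]
    abel
  have hAN : A * (N : E) = (N : E) * A + (a * q * (q - q⁻¹)) • (C - D) := by
    rw [h.N_eq, mul_sub, sub_mul, mul_one, one_mul, mul_smul_comm, smul_mul_assoc, hψA]
    module
  have hN'A : (N' : E) * A = A * (N' : E) - (a⁻¹ * q * (q - q⁻¹)) • (C - D) := by
    rw [h.N'_eq, mul_sub, sub_mul, mul_one, one_mul, mul_smul_comm, smul_mul_assoc, hψA]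
    module
  have hAC : A * C = (N : E) * (A * (K : E)) +
      (a * q * (q - q⁻¹)) • (C * (K : E) - (1 - (a⁻¹ * q⁻¹) • ψ)) := by
    rw [hC, ← mul_assoc, hAN, add_mul, smul_mul_assoc, sub_mul, hDK, mul_assoc]
  have hKA : (K : E) * A = q⁻¹ • (q⁻¹ • (A * (K : E)) +
      (q - q⁻¹) • (a • ((K : E) * (K : E)) + a⁻¹ • 1)) := by
    rw [← h.K_A, add_sub_cancel, smul_smul, inv_mul_cancel₀ hq, one_smul]
  have hCA : C * A = q⁻¹ • (q⁻¹ • ((N : E) * (A * (K : E))) +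
      (q - q⁻¹) • (a • (C * (K : E)) + a⁻¹ • (1 - (a * q) • ψ))) := by
    rw [hC, mul_assoc, hKA, ← h.N_eq]
    simp only [mul_smul_comm, mul_add, mul_one, mul_assoc]
  have hN'AB : (N' : E) * (A * (B : E)) =
      A * C - (a⁻¹ * q * (q - q⁻¹)) • (C * (B : E) - (1 - (a * q⁻¹) • ψ)) := by
    rw [← mul_assoc, hN'A, sub_mul, smul_mul_assoc, sub_mul, hDB, mul_assoc, hNB]
  refine N'.isUnit.mul_left_cancel ?_
  rw [mul_sub, mul_smul_comm, mul_smul_comm, ← mul_assoc (N' : E) (B : E) A, hNB, hN'AB, hCA, hAC,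
    mul_smul_comm, mul_add, mul_smul_comm, mul_smul_comm, ← mul_assoc (N' : E) (B : E) (B : E),
    hNB, mul_one, h.N'_eq]
  match_scalars <;> field_simp <;> ring

end TwistData

end TwistedCartan

/-! ### Triangular operators on the flag of the dual eigenspaces -/

namespace TDSystem

variable {𝕂 V : Type*} [Field 𝕂] [AddCommGroup V] [Module 𝕂 V] {d : ℕ}
  {Φ : TDSystem 𝕂 V d} {θ θs : ℕ → 𝕂} {q a : 𝕂} {K : (Module.End 𝕂 V)ˣ} {ψ : Module.End 𝕂 V}

/-- `ψ` strictly lowers the flag of `A*`. -/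
theorem HasEigenvalues.lowering_mem_lowerStar [FiniteDimensional 𝕂 V]
    (h : Φ.HasEigenvalues (fun i => qRacah q a d i) (fun i => θs i)) (hq : q ≠ 0)
    (hK : Φ.IsSplitOperator q K) (hψ : Φ.IsPsi q a K ψ) {i : ℕ} {v : V}
    (hv : v ∈ Φ.lowerStar (i + 1)) : ψ v ∈ Φ.lowerStar i := by
  suffices Φ.lowerStar (i + 1) ≤ (Φ.lowerStar i).comap ψ from this hv
  rw [HasEigenvalues.lowerStar_eq_iSup (θ := qRacah q a d) h (i + 1)]
  refine iSup₂_le fun j hj v hv => ?_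
  have h1 := (h.isLefschetz_raising hq hK).lowering_mem hq hK
    ((isPsi_iff_isLoweringOperator h hq hK ψ).mp hψ) j hv
  rw [← HasEigenvalues.lowerStar_eq_iSup (θ := qRacah q a d) h j] at h1
  exact Φ.lowerStar_mono (Nat.lt_succ_iff.mp hj) h1

theorem HasEigenvalues.isNilpotent_lowering [FiniteDimensional 𝕂 V]
    (h : Φ.HasEigenvalues (fun i => qRacah q a d i) (fun i => θs i)) (hq : q ≠ 0)
    (hK : Φ.IsSplitOperator q K) (hψ : Φ.IsPsi q a K ψ) : IsNilpotent ψ := by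
  have hpow : ∀ k ≤ d + 1, ∀ v, (ψ ^ k) v ∈ Φ.lowerStar (d + 1 - k) := by
    intro k
    induction k with
    | zero =>
      intro _ v
      rw [Nat.sub_zero, HasEigenvalues.lowerStar_top (θ := qRacah q a d) h]
      trivial
    | succ k ih =>
      intro hk v
      rw [pow_succ', Module.End.mul_apply]
      refine h.lowering_mem_lowerStar hq hK hψ ?_
      rw [show d + 1 - (k + 1) + 1 = d + 1 - k by omega]
      exact ih (by omega) v
  refine ⟨d + 1, LinearMap.ext fun v => ?_⟩
  have := hpow (d + 1) le_rfl v
  rwa [Nat.sub_self, lowerStar_zero, Submodule.mem_bot] at this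

/-- `K` is upper triangular for the flag of `A*`. -/
theorem HasEigenvalues.splitOperator_sub_mem (h : Φ.HasEigenvalues (fun i => θ i) (fun i => θs i))
    (hK : Φ.IsSplitOperator q K) {i : ℕ} (hi : i ≤ d) {v : V} (hv : v ∈ Φ.lowerStar (i + 1)) :
    (K : Module.End 𝕂 V) v - q ^ ((d : ℤ) - 2 * (i : ℤ)) • v ∈ Φ.lowerStar i := by
  suffices Φ.lowerStar (i + 1) ≤ (Φ.lowerStar i).comap
      ((K : Module.End 𝕂 V) - q ^ ((d : ℤ) - 2 * (i : ℤ)) • 1) by simpa using this hv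
  rw [h.lowerStar_eq_iSup (i + 1)]
  refine iSup₂_le fun j hj v hv => ?_
  have h1 := hK j (by omega) v hv
  simp only [Submodule.mem_comap, LinearMap.sub_apply, LinearMap.smul_apply,
    Module.End.one_apply, h1]
  rcases Nat.lt_succ_iff_lt_or_eq.mp hj with hj | rfl
  · rw [← sub_smul]
    exact Submodule.smul_mem _ _ (Φ.splitSpace_le_lowerStar hj hv)
  · simp

/-- An operator that is upper triangular for the flag of `A*`, with diagonal entries `c_i`. -/
def IsFlagTriangular (Φ : TDSystem 𝕂 V d) (T : Module.End 𝕂 V) (c : ℕ → 𝕂) : Prop :=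
  ∀ i ≤ d, ∀ v ∈ Φ.lowerStar (i + 1), T v - c i • v ∈ Φ.lowerStar i

open Polynomial in
theorem IsFlagTriangular.iSup_eigenspace {T : Module.End 𝕂 V} {c : ℕ → 𝕂}
    (hT : Φ.IsFlagTriangular T c) (hc : Set.InjOn c (Set.Iic d))
    (h : Φ.HasEigenvalues (fun i => θ i) (fun i => θs i)) :
    ⨆ j ∈ Finset.range (d + 1), T.eigenspace (c j) = ⊤ := by
  rw [← Module.End.ker_aeval_prod_X_sub_C T _ c (hc.mono fun j hj => by
    simpa [Nat.lt_succ_iff] using hj), eq_top_iff, ← h.lowerStar_top]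
  suffices ∀ i ≤ d + 1, ∀ v ∈ Φ.lowerStar i,
      aeval T (∏ j ∈ Finset.range i, (X - C (c j))) v = 0 from this _ le_rfl
  intro i
  induction i with
  | zero =>
    intro _ v hv
    rw [lowerStar_zero, Submodule.mem_bot] at hv
    simp [hv]
  | succ i ih =>
    intro hi v hv
    rw [Finset.prod_range_succ, map_mul, Module.End.mul_apply]
    refine ih (by omega) _ ?_
    simpa [Module.algebraMap_end_apply] using hT i (by omega) v hv

/-- Eigenvectors of a triangular operator lie low in the flag. -/
theorem IsFlagTriangular.mem_lowerStar {T : Module.End 𝕂 V} {c : ℕ → 𝕂}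
    (hT : Φ.IsFlagTriangular T c) (h : Φ.HasEigenvalues (fun i => θ i) (fun i => θs i)) {μ : 𝕂}
    {i : ℕ} (hi : i ≤ d + 1) (hμ : ∀ j, i ≤ j → j ≤ d → c j ≠ μ) {v : V} (hv : T v = μ • v) :
    v ∈ Φ.lowerStar i := by
  induction hi using Nat.decreasingInduction with
  | self =>
    rw [h.lowerStar_top]
    trivial
  | of_succ j hj ih =>
    have h1 := hT j (by omega) v (ih fun k hk => hμ k (by omega))
    rw [hv, ← sub_smul] at h1
    exact (Submodule.smul_mem_iff _ (sub_ne_zero.mpr (hμ j le_rfl (by omega)).symm)).mp h1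

/-- The power `q^{d-2i}` differs from each of the next `d` powers `q^{d-2i-2}, q^{d-2i-4}, …`. -/
theorem zpow_ne_zpow (hq : q ≠ 0) (hqd : ∀ j, 1 ≤ j → j ≤ d → q ^ (2 * j) ≠ 1) {i j : ℕ}
    (hij : i < j) (hj : j ≤ i + d) :
    q ^ ((d : ℤ) - 2 * (i : ℤ)) ≠ q ^ ((d : ℤ) - 2 * (j : ℤ)) := by
  intro he
  refine hqd (j - i) (by omega) (by omega) ?_
  have h1 : q ^ ((d : ℤ) - 2 * (i : ℤ)) =
      q ^ (2 * (j - i)) * q ^ ((d : ℤ) - 2 * (j : ℤ)) := by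
    rw [← zpow_natCast, ← zpow_add₀ hq]
    congr 1
    omega
  rw [he] at h1
  exact mul_right_cancel₀ (zpow_ne_zero ((d : ℤ) - 2 * (j : ℤ)) hq)
    (h1.symm.trans (one_mul _).symm)

open Polynomial in
/-- A triangular operator with the eigenvalues `q^{d-2i}` that satisfies the relation of the
split operator of the second inversion is that operator. Its `q^{d-2i}`-eigenvectors lie in
`E*_0 V + ⋯ + E*_i V` by triangularity, and the relation makes `A - θ_{d-i}` shift them to
`q^{d-2i-2}`-eigenvectors, so that `(A - θ_0) ⋯ (A - θ_{d-i})` kills them. -/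
theorem HasEigenvalues.eq_splitOperator
    (h : Φ.HasEigenvalues (fun i => qRacah q a d i) (fun i => θs i)) (hq : q ≠ 0)
    {B B' : (Module.End 𝕂 V)ˣ} (hB : Φ.secondInversion.IsSplitOperator q B)
    (hT : Φ.IsFlagTriangular B' fun i => q ^ ((d : ℤ) - 2 * (i : ℤ)))
    (hrel : q • ((B' : Module.End 𝕂 V) * Φ.A) - q⁻¹ • (Φ.A * (B' : Module.End 𝕂 V)) =
      (q - q⁻¹) • (a⁻¹ • ((B' : Module.End 𝕂 V) * (B' : Module.End 𝕂 V)) + a • 1)) :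
    B = B' := by
  have hqd : ∀ j, 1 ≤ j → j ≤ d → q ^ (2 * j) ≠ 1 := fun _ => h.pow_ne_one hq
  have hc : Set.InjOn (fun i : ℕ => q ^ ((d : ℤ) - 2 * (i : ℤ))) (Set.Iic d) := by
    intro i hi j hj he
    simp only [Set.mem_Iic] at hi hj
    rcases lt_trichotomy i j with hlt | heq | hlt
    · exact absurd he (zpow_ne_zpow hq hqd hlt (by omega))
    · exact heq
    · exact absurd he.symm (zpow_ne_zpow hq hqd hlt (by omega))
  have hshift : ∀ i ≤ d, ∀ v, (B' : Module.End 𝕂 V) v = q ^ ((d : ℤ) - 2 * (i : ℤ)) • v →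
      (B' : Module.End 𝕂 V) (Φ.A v - qRacah q a d (d - i) • v) =
        q ^ ((d : ℤ) - 2 * ((i + 1 : ℕ) : ℤ)) • (Φ.A v - qRacah q a d (d - i) • v) := by
    intro i hi v hv
    have h1 := LinearMap.congr_fun hrel v
    simp only [LinearMap.sub_apply, LinearMap.smul_apply, Module.End.mul_apply,
      LinearMap.add_apply, Module.End.one_apply, hv, map_smul] at h1
    have h2 : q ^ ((d : ℤ) - 2 * ((i + 1 : ℕ) : ℤ)) =
        q⁻¹ * q⁻¹ * q ^ ((d : ℤ) - 2 * (i : ℤ)) := by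
      rw [← zpow_neg_one, ← zpow_add₀ hq, ← zpow_add₀ hq]
      congr 1
      push_cast
      ring
    have h3 : qRacah q a d (d - i) =
        a⁻¹ * q ^ ((d : ℤ) - 2 * (i : ℤ)) + a * (q ^ ((d : ℤ) - 2 * (i : ℤ)))⁻¹ := by
      rw [← qRacah_inv q a hi, qRacah, inv_inv, ← zpow_neg, neg_sub]
    have hc0 : q ^ ((d : ℤ) - 2 * (i : ℤ)) ≠ 0 := zpow_ne_zero _ hq
    rw [h2, h3, map_sub, map_smul, hv]
    generalize q ^ ((d : ℤ) - 2 * (i : ℤ)) = c at *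
    have h4 : (B' : Module.End 𝕂 V) (Φ.A v) = q⁻¹ • (q⁻¹ • c • Φ.A v +
        (q - q⁻¹) • (a⁻¹ • c • c • v + a • v)) := by
      rw [← h1, add_sub_cancel, smul_smul, inv_mul_cancel₀ hq, one_smul]
    rw [h4]
    match_scalars <;> field_simp
    ring
  -- All eigenvalues together: `∏ (A - θ_j) = 0`.
  have hzero : ∀ v, aeval Φ.A (∏ j ∈ Finset.range (d + 1), (X - C (qRacah q a d j))) v = 0 := by
    intro v
    rw [← LinearMap.mem_ker, ← HasEigenvalues.iSup_range_E (θ := qRacah q a d) h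
      (fun j hj => by rw [Finset.mem_range] at hj; omega)]
    have h1 : (⨆ j, LinearMap.range (Φ.E j)) = ⊤ :=
      (Φ.standard.isStandardOrdering_range Φ.isTDPair.diag_left).iSup_eq_top Φ.isTDPair.diag_left
    have h2 : v ∈ ⨆ j, LinearMap.range (Φ.E j) := h1 ▸ Submodule.mem_top
    exact (iSup_le fun j => le_iSup₂_of_le j (Finset.mem_range.mpr j.2) le_rfl :
      (⨆ j, LinearMap.range (Φ.E j)) ≤ _) h2
  have hkill : ∀ m ≤ d, ∀ v,
      (B' : Module.End 𝕂 V) v = q ^ ((d : ℤ) - 2 * ((d - m : ℕ) : ℤ)) • v →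
      aeval Φ.A (∏ j ∈ Finset.range (m + 1), (X - C (qRacah q a d j))) v = 0 := by
    intro m
    induction m with
    | zero =>
      -- `q^{-d-2}` may coincide with `q^d`, but then the shifted vector lies in
      -- `E*_0 V ∩ (E_1 V + ⋯ + E_d V) = 0`.
      intro _ v hv
      have h1 := hshift (d - 0) (by omega) v hv
      rw [Nat.sub_zero, Nat.sub_self] at h1
      have h2 : Φ.A v - qRacah q a d 0 • v ∈ Φ.lowerStar 1 :=
        hT.mem_lowerStar (θ := qRacah q a d) h (by omega)
          (fun j hj hjd => zpow_ne_zpow hq hqd (by omega) (by omega)) h1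
      have h3 : Φ.A v - qRacah q a d 0 • v ∈ Φ.upper 1 := by
        have h4 : Φ.upper 1 = ⨆ (j : Fin (d + 1)) (_ : (j : ℕ) ∈ Finset.Ico 1 (d + 1)),
            LinearMap.range (Φ.E j) := by
          refine iSup_congr fun j => iSup_congr_Prop ?_ fun _ => rfl
          rw [Finset.mem_Ico]
          omega
        rw [h4, HasEigenvalues.iSup_range_E (θ := qRacah q a d) h
          (fun j hj => by rw [Finset.mem_Ico] at hj; omega), LinearMap.mem_ker, ← hzero v,
          Finset.range_eq_Ico, Finset.prod_eq_prod_Ico_succ_bot (Nat.succ_pos d), mul_comm,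
          map_mul, Module.End.mul_apply]
        simp [Module.algebraMap_end_apply]
      have h4 : Φ.A v - qRacah q a d 0 • v ∈ Φ.lowerStar 1 ⊓ Φ.upper 1 := ⟨h2, h3⟩
      rw [HasEigenvalues.lowerStar_inf_upper (θ := qRacah q a d) h, Submodule.mem_bot] at h4
      simpa [Module.algebraMap_end_apply] using h4
    | succ m ih =>
      intro hm v hv
      have h1 := hshift (d - (m + 1)) (by omega) v hv
      rw [Nat.sub_sub_self hm, show d - (m + 1) + 1 = d - m by omega] at h1
      have h2 := ih (by omega) _ h1
      rw [Finset.prod_range_succ, map_mul, Module.End.mul_apply]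
      simpa [Module.algebraMap_end_apply] using h2
  refine Units.ext (LinearMap.ext_of_iSup_eq_top
    (hT.iSup_eigenspace (θ := qRacah q a d) hc h) fun i v hv => ?_)
  by_cases hi : i ∈ Finset.range (d + 1)
  · have hid : i ≤ d := by
      rw [Finset.mem_range] at hi
      omega
    rw [iSup_pos hi, Module.End.mem_eigenspace_iff] at hv
    rw [hv]
    refine hB i hid v ?_
    rw [splitSpace_eq]
    refine ⟨hT.mem_lowerStar (θ := qRacah q a d) h (by omega) (fun j hj hjd he => ?_) hv, ?_⟩
    · exact zpow_ne_zpow hq hqd (by omega : i < j) (by omega) he.symm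
    · rw [secondInversion_upper _ hid, HasEigenvalues.iSup_range_E (θ := qRacah q a d) h
        (fun j hj => by rw [Finset.mem_range] at hj; omega)]
      exact hkill (d - i) (by omega) v (by rwa [Nat.sub_sub_self hid])
  · rw [iSup_neg hi, Submodule.mem_bot] at hv
    simp [hv]

/-- The map `ψ` of a system of `q`-Racah type is also the map `ψ` of its second inversion. -/
theorem IsPsi.secondInversion [FiniteDimensional 𝕂 V]
    (h : Φ.HasEigenvalues (fun i => qRacah q a d i) (fun i => θs i)) (hq : q ≠ 0) (ha : a ≠ 0)
    (hK : Φ.IsSplitOperator q K) (hψ : Φ.IsPsi q a K ψ) {B : (Module.End 𝕂 V)ˣ}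
    (hB : Φ.secondInversion.IsSplitOperator q B) : Φ.secondInversion.IsPsi q a⁻¹ B ψ := by
  have hL := h.isLefschetz_raising hq hK
  have hlow := (isPsi_iff_isLoweringOperator h hq hK ψ).mp hψ
  have hnil := h.isNilpotent_lowering hq hK hψ
  obtain ⟨N, hN⟩ := (hnil.smul (a * q)).isUnit_one_sub
  obtain ⟨N', hN'⟩ := (hnil.smul (a⁻¹ * q)).isUnit_one_sub
  have htw : TwistData q a ψ Φ.A K N N' := .of_raising hq ha rfl
    (hL.K_mul_lowering hq hK hlow) (hL.K_mul_R hq hK) hlow.comm hN hN'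
  have hψmem : ∀ i, ∀ v ∈ Φ.lowerStar (i + 1), ψ v ∈ Φ.lowerStar i :=
    fun i v hv => h.lowering_mem_lowerStar hq hK hψ hv
  -- `N'` is unipotent for the flag, so it reflects membership in its terms.
  have hrefl : ∀ i m, ∀ v ∈ Φ.lowerStar (i + m), (N' : Module.End 𝕂 V) v ∈ Φ.lowerStar i →
      v ∈ Φ.lowerStar i := by
    intro i m
    induction m with
    | zero => exact fun v hv _ => hv
    | succ m ih =>
      intro v hv hNv
      refine ih v ?_ hNv
      have h1 : v = (N' : Module.End 𝕂 V) v + (a⁻¹ * q) • ψ v := by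
        rw [hN']
        simp
      rw [h1]
      exact Submodule.add_mem _ (Φ.lowerStar_mono (by omega) hNv)
        (Submodule.smul_mem _ _ (hψmem _ v hv))
  have hT : Φ.IsFlagTriangular ((N'⁻¹ * N * K : (Module.End 𝕂 V)ˣ) : Module.End 𝕂 V)
      fun i => q ^ ((d : ℤ) - 2 * (i : ℤ)) := by
    intro i hi v hv
    have hKv := HasEigenvalues.splitOperator_sub_mem (θ := qRacah q a d) h hK hi hv
    have hKv' : (K : Module.End 𝕂 V) v ∈ Φ.lowerStar (i + 1) := by
      have := Submodule.add_mem _ (Φ.lowerStar_mono (Nat.le_succ i) hKv)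
        (Submodule.smul_mem _ (q ^ ((d : ℤ) - 2 * (i : ℤ))) hv)
      rwa [sub_add_cancel] at this
    refine hrefl i (d + 1) _ ?_ ?_
    · refine Φ.lowerStar_mono (Nat.le_add_left _ _) ?_
      rw [HasEigenvalues.lowerStar_top (θ := qRacah q a d) h]
      trivial
    · have h1 : (N' : Module.End 𝕂 V) (((N'⁻¹ * N * K : (Module.End 𝕂 V)ˣ) : Module.End 𝕂 V) v -
          q ^ ((d : ℤ) - 2 * (i : ℤ)) • v) =
          ((K : Module.End 𝕂 V) v - q ^ ((d : ℤ) - 2 * (i : ℤ)) • v) -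
            (a * q) • ψ ((K : Module.End 𝕂 V) v) +
            (q ^ ((d : ℤ) - 2 * (i : ℤ)) * (a⁻¹ * q)) • ψ v := by
        rw [map_sub, map_smul, ← Module.End.mul_apply, TwistData.N'_mul, Module.End.mul_apply,
          hN, hN']
        simp only [LinearMap.sub_apply, Module.End.one_apply, LinearMap.smul_apply]
        module
      rw [h1]
      exact Submodule.add_mem _ (Submodule.sub_mem _ hKv
        (Submodule.smul_mem _ _ (hψmem i _ hKv'))) (Submodule.smul_mem _ _ (hψmem i v hv))
  have hBeq : B = N'⁻¹ * N * K := h.eq_splitOperator hq hB hT (htw.B_A hq ha rfl)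
  refine ⟨?_, fun i hi v hv => hψ.2 i hi v (by rwa [secondInversion_kerSpace] at hv)⟩
  have := htw.psi_comm hq ha hBeq
  simp only [raising, inv_inv]
  exact this

end TDSystem

theorem lemma7 {𝕂 V : Type*} [Field 𝕂] [IsAlgClosed 𝕂] [AddCommGroup V] [Module 𝕂 V]
    [FiniteDimensional 𝕂 V] [Nontrivial V] {d : ℕ} (hd : 1 ≤ d) (Φ : TDSystem 𝕂 V d)
    (q a b : 𝕂) (hq : q ≠ 0) (ha : a ≠ 0) (hb : b ≠ 0) (hq4 : q ^ 4 ≠ 1)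
    (hθ : Φ.HasEigenvalues
      (fun i => a * q ^ ((d : ℤ) - 2 * (i : ℕ)) + a⁻¹ * q ^ (2 * (i : ℕ) - (d : ℤ)))
      (fun i => b * q ^ ((d : ℤ) - 2 * (i : ℕ)) + b⁻¹ * q ^ (2 * (i : ℕ) - (d : ℤ)))) :
    -- the maps `K`, `B` and `ψ` exist and are unique
    (∃! K : (Module.End 𝕂 V)ˣ, Φ.IsSplitOperator q K) ∧
    (∃! B : (Module.End 𝕂 V)ˣ, Φ.secondInversion.IsSplitOperator q B) ∧
    ∀ K B : (Module.End 𝕂 V)ˣ,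
      Φ.IsSplitOperator q K → Φ.secondInversion.IsSplitOperator q B →
      (∃! ψ : Module.End 𝕂 V, Φ.IsPsi q a K ψ) ∧
      ∀ ψ : Module.End 𝕂 V, Φ.IsPsi q a K ψ →
        -- the first action
        (∃ (_ : Module (Uq q) V) (_ : IsScalarTower 𝕂 (Uq q) V),
          Uq.ActsBy q ψ (Φ.raising a K) K ∧
          IsSemisimpleModule (Uq q) V ∧
          (∀ W : Submodule (Uq q) V, IsSimpleModule (Uq q) W →
            ∃ i : ℕ, 2 * i ≤ d ∧ Nonempty (W ≃ₗ[Uq q] Uq.L hq hq4 (d - 2 * i) 1)) ∧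
          ∀ i : ℕ, 2 * i ≤ d →
            (∀ v ∈ Φ.kerSpace i, v ≠ 0 →
              ∃ W : Submodule (Uq q) V, W.restrictScalars 𝕂 = Φ.genM {v} ∧
                IsSimpleModule (Uq q) W ∧
                Nonempty (W ≃ₗ[Uq q] Uq.L hq hq4 (d - 2 * i) 1)) ∧
            (isotypicComponent (Uq q) V (Uq.L hq hq4 (d - 2 * i) 1)).restrictScalars 𝕂 =
              Φ.genM (Φ.kerSpace i) ∧
            ∀ v : V, v ∈ Φ.genM (Φ.kerSpace i) ↔
              Uq.casimir q • v =
                (q ^ ((d : ℤ) - 2 * i + 1) + q ^ (2 * i - (d : ℤ) - 1)) • v) ∧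
        -- the second action
        (∃ (_ : Module (Uq q) V) (_ : IsScalarTower 𝕂 (Uq q) V),
          Uq.ActsBy q ψ (Φ.secondInversion.raising a⁻¹ B) B ∧
          IsSemisimpleModule (Uq q) V ∧
          (∀ W : Submodule (Uq q) V, IsSimpleModule (Uq q) W →
            ∃ i : ℕ, 2 * i ≤ d ∧ Nonempty (W ≃ₗ[Uq q] Uq.L hq hq4 (d - 2 * i) 1)) ∧
          ∀ i : ℕ, 2 * i ≤ d →
            (∀ v ∈ Φ.kerSpace i, v ≠ 0 →
              ∃ W : Submodule (Uq q) V, W.restrictScalars 𝕂 = Φ.genM {v} ∧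
                IsSimpleModule (Uq q) W ∧
                Nonempty (W ≃ₗ[Uq q] Uq.L hq hq4 (d - 2 * i) 1)) ∧
            (isotypicComponent (Uq q) V (Uq.L hq hq4 (d - 2 * i) 1)).restrictScalars 𝕂 =
              Φ.genM (Φ.kerSpace i) ∧
            ∀ v : V, v ∈ Φ.genM (Φ.kerSpace i) ↔
              Uq.casimir q • v =
                (q ^ ((d : ℤ) - 2 * i + 1) + q ^ (2 * i - (d : ℤ) - 1)) • v) := by
  have h : Φ.HasEigenvalues (fun i => TDSystem.qRacah q a d i)
    (fun i => TDSystem.qRacah q b d i) := hθ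
  have h' : Φ.secondInversion.HasEigenvalues (fun i => TDSystem.qRacah q a⁻¹ d i)
      (fun i => TDSystem.qRacah q b d i) :=
    TDSystem.HasEigenvalues.secondInversion (θ := TDSystem.qRacah q a d)
      (θ' := TDSystem.qRacah q a⁻¹ d) h fun _ hi => TDSystem.qRacah_inv q a hi
  refine ⟨TDSystem.HasEigenvalues.existsUnique_splitOperator (θ := TDSystem.qRacah q a d) h hq,
    TDSystem.HasEigenvalues.existsUnique_splitOperator (θ := TDSystem.qRacah q a⁻¹ d) h' hq,
    fun K B hK hB => ⟨h.existsUnique_isPsi hq hK, fun ψ hψ =>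
      ⟨TDSystem.exists_action h hq hq4 hK hψ, ?_⟩⟩⟩
  have h2 := TDSystem.exists_action h' hq hq4 hB (hψ.secondInversion h hq ha hK hB)
  simp only [TDSystem.secondInversion_kerSpace] at h2
  exact h2
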